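/- Let $\Gamma(\tau)$, $0\le\tau\le T$, be a smoothly moving boundary in $\mathbb R^2$: for each $\tau$ it is a disjoint union of finitely many simple closed curves, with regular periodic parametrizations that are jointly $C^\infty$ in the parameter and in $\tau\in[0,T]$. Each curve has unit tangent $\mathbf t$ and arclength $s$ in the direction of its parametrization, unit normal $\mathbf n$ ($\mathbf t$ rotated clockwise by $\pi/2$; any orientation of each curve is allowed), signed curvature $\kappa$ given by $\mathbf t_s=-\kappa\,\mathbf n$, and velocity $\mathbf v$. Let $\varphi(\mathbf y,\tau)\in\mathbb R^2$ be a density that is smooth on $\{(\mathbf y,\tau):0\le\tau\le T,\ \mathbf y\in\Gamma(\tau)\}$. Write $\mathbf a\otimes\mathbf b=\mathbf a\mathbf b^{\mathsf T}$. For $\mathbf y\in\Gamma(\tau)$, $\tau<t$, put $\mathbf r=\mathbf x-\mathbf y$, $\lambda=\frac{|\mathbf r|^2}{4(t-\tau)}$, $\mathbf n_y=\mathbf n(\mathbf y)$, and let $$D(\mathbf x,t;\mathbf y,\tau)=\frac{\mathbf n_y\otimes\mathbf r+(\mathbf n_y\cdot\mathbf r)\bigl(I-2\frac{\mathbf r\otimes\mathbf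 r}{|\mathbf r|^2}\bigr)}{8\pi}\,\frac{e^{-\lambda}}{(t-\tau)^2}-\frac{\mathbf n_y\otimes\mathbf r+\mathbf r\otimes\mathbf n_y+(\mathbf n_y\cdot\mathbf r)\bigl(I-4\frac{\mathbf r\otimes\mathbf r}{|\mathbf r|^2}\bigr)}{8\pi}\,\frac{1-e^{-\lambda}-\lambda e^{-\lambda}}{\lambda^2(t-\tau)^2}$$ be the kernel of the unsteady Stokes double layer potential (without the instantaneous pressure term). Fix $t\in(0,T]$ and $\mathbf x\in\Gamma(t)$. Then for every $0<\varepsilon\le t$ the principal value $$\mathcal D_\varepsilon[\varphi](\mathbf x,t)=\mathrm{p.v.}\!\int_{t-\varepsilon}^t\int_{\Gamma(\tau)}D(\mathbf x,t;\mathbf y,\tau)\,\varphi(\mathbf y,\tau)\,ds(\mathbf y)\,d\tau:=\lim_{\eta\to0^+}\int_{t-\varepsilon}^t\int_{\Gamma(\tau)\cap\{|\mathbf y-\mathbf x|>\eta\}}D(\mathbf x,t;\mathbf y,\tau)\,\varphi(\mathbf y,\tau)\,ds(\mathbf y)\,d\tau$$ exists (the integrals on the right converging absolutely), and, as $\varepsilon\to0^+$,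 $$\mathcal D_\varepsilon[\varphi](\mathbf x,t)=\sqrt{\tfrac{\varepsilon}{\pi}}\Bigl\{\bigl(\tfrac16\mathbf v\cdot\mathbf n+\tfrac12\kappa\bigr)I+\tfrac13(\mathbf v\cdot\mathbf n)\,\mathbf t\otimes\mathbf t-\bigl(\tfrac16\mathbf v\cdot\mathbf n+\tfrac32\kappa\bigr)\mathbf n\otimes\mathbf n\Bigr\}\varphi(\mathbf x,t)+\sqrt{\tfrac{\varepsilon}{\pi}}\,\bigl\{\mathbf n\otimes\mathbf t+2\,\mathbf t\otimes\mathbf n\bigr\}\varphi_s(\mathbf x,t)+O(\varepsilon),$$ where $\mathbf t,\mathbf n,\kappa,\mathbf v$ are taken at $(\mathbf x,t)$ and $\varphi_s$ is the arclength derivative of $\varphi(\cdot,t)$ along $\Gamma(t)$. -/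

import Mathlib

open Set Filter Topology MeasureTheory Asymptotics
open scoped ContDiff RealInnerProductSpace

noncomputable section

/-- The Euclidean plane. -/
abbrev Plane : Type := EuclideanSpace ℝ (Fin 2)

/-- The tensor product `a ⊗ b` of two plane vectors, acting by `(a ⊗ b) c = ⟪b, c⟫ a`. -/
def dyad (a b : Plane) : Plane →L[ℝ] Plane := InnerProductSpace.rankOne ℝ a b

/-- The kernel of the unsteady Stokes double layer potential (without the instantaneous
pressurelet), with `n` the unit normal at the source point, `r` = target minus source, and
`σ` the elapsed time; here `l = |r|² / (4σ)`. -/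
def dlKernel (n r : Plane) (σ : ℝ) : Plane →L[ℝ] Plane :=
  let l : ℝ := ‖r‖ ^ 2 / (4 * σ)
  (Real.exp (-l) / (8 * Real.pi * σ ^ 2)) •
      (dyad n r + ⟪n, r⟫ • (1 - (2 / ‖r‖ ^ 2) • dyad r r))
    - ((1 - Real.exp (-l) - l * Real.exp (-l)) / (8 * Real.pi * (l ^ 2 * σ ^ 2))) •
      (dyad n r + dyad r n + ⟪n, r⟫ • (1 - (4 / ‖r‖ ^ 2) • dyad r r))

/-- A smoothly moving boundary `Γ(τ)`, `0 ≤ τ ≤ T`: for every time `τ`, a disjoint union of `m`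
smooth simple closed curves, the `i`-th one being parametrized by the `2π`-periodic function
`θ ↦ pos i θ τ`. Smoothness is joint in `(θ, τ)`, up to the initial and final times. -/
structure MovingBoundary (m : ℕ) (T : ℝ) where
  pos : Fin m → ℝ → ℝ → Plane
  smooth : ∀ i, ContDiffOn ℝ ∞ (fun p : ℝ × ℝ => pos i p.1 p.2) (univ ×ˢ Icc 0 T)
  periodic : ∀ i, ∀ τ ∈ Icc 0 T, ∀ θ, pos i (θ + 2 * Real.pi) τ = pos i θ τ
  immersed : ∀ i, ∀ τ ∈ Icc 0 T, ∀ θ, deriv (fun θ' => pos i θ' τ) θ ≠ 0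
  embedded : ∀ τ ∈ Icc 0 T, ∀ i j, ∀ θ ∈ Ico 0 (2 * Real.pi), ∀ θ' ∈ Ico 0 (2 * Real.pi),
    pos i θ τ = pos j θ' τ → i = j ∧ θ = θ'

namespace MovingBoundary

variable {m : ℕ} {T : ℝ}

/-- The line element `ds / dθ`. -/
def speed (Γ : MovingBoundary m T) (i : Fin m) (θ τ : ℝ) : ℝ :=
  ‖deriv (fun θ' => Γ.pos i θ' τ) θ‖

/-- The arclength derivative, at the parameter `θ`, of a function along the `i`-th component
of `Γ(τ)`. -/
def arcDeriv (Γ : MovingBoundary m T) (i : Fin m) (τ : ℝ) (f : ℝ → Plane) (θ : ℝ) : Plane :=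
  (Γ.speed i θ τ)⁻¹ • deriv f θ

/-- The unit tangent vector. -/
def tangent (Γ : MovingBoundary m T) (i : Fin m) (θ τ : ℝ) : Plane :=
  Γ.arcDeriv i τ (fun θ' => Γ.pos i θ' τ) θ

/-- The unit normal vector: the unit tangent rotated clockwise by a right angle. It is the outward
normal of the region that lies to the left of the curve. -/
def normal (Γ : MovingBoundary m T) (i : Fin m) (θ τ : ℝ) : Plane :=
  !₂[Γ.tangent i θ τ 1, -Γ.tangent i θ τ 0]

/-- The signed curvature `κ`, determined by `dt/ds = -κ n`; a circle with outward normal has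
positive curvature. -/
def curvature (Γ : MovingBoundary m T) (i : Fin m) (θ τ : ℝ) : ℝ :=
  -⟪Γ.arcDeriv i τ (fun θ' => Γ.tangent i θ' τ) θ, Γ.normal i θ τ⟫

/-- The velocity of the boundary (one-sided at the initial and final times). -/
def velocity (Γ : MovingBoundary m T) (i : Fin m) (θ τ : ℝ) : Plane :=
  derivWithin (fun τ' => Γ.pos i θ τ') (Icc 0 T) τ

/-- `φ` restricts to a smooth function on the space-time boundary `{(y, τ) : y ∈ Γ(τ)}`. Its
values off the boundary are irrelevant. -/
def SmoothDensity (Γ : MovingBoundary m T) (φ : Plane → ℝ → Plane) : Prop :=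
  ∀ i, ContDiffOn ℝ ∞ (fun p : ℝ × ℝ => φ (Γ.pos i p.1 p.2) p.2) (univ ×ˢ Icc 0 T)

/-- The integrand `D(x, t; y, τ) φ(y, τ) ds(y)/dθ` at the point `y = pos i θ τ` of `Γ(τ)`. -/
def dlIntegrand (Γ : MovingBoundary m T) (φ : Plane → ℝ → Plane) (x : Plane) (t : ℝ)
    (i : Fin m) (θ τ : ℝ) : Plane :=
  Γ.speed i θ τ •
    dlKernel (Γ.normal i θ τ) (x - Γ.pos i θ τ) (t - τ) (φ (Γ.pos i θ τ) τ)

/-- The parameters `θ ∈ [0, 2π)` whose points on the `i`-th component of `Γ(τ)` have distance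
more than `η` from `x`. -/
def awayFrom (Γ : MovingBoundary m T) (x : Plane) (η : ℝ) (i : Fin m) (τ : ℝ) : Set ℝ :=
  {θ | θ ∈ Ico 0 (2 * Real.pi) ∧ η < ‖x - Γ.pos i θ τ‖}

/-- `V` is the value, in the principal value sense, of
`∫_{t-ε}^t ∫_{Γ(τ)} D(x, t; y, τ) φ(y, τ) ds(y) dτ`: after excision of the disk of radius `η`
about `x` the space-time integral converges absolutely, and it tends to `V` as `η → 0+`. -/
def IsDoubleLayerPV (Γ : MovingBoundary m T) (φ : Plane → ℝ → Plane) (x : Plane) (t ε : ℝ)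
    (V : Plane) : Prop :=
  (∀ η > 0, ∀ i, IntegrableOn (fun p : ℝ × ℝ => Γ.dlIntegrand φ x t i p.2 p.1)
      {p : ℝ × ℝ | p.1 ∈ Ioo (t - ε) t ∧ p.2 ∈ Γ.awayFrom x η i p.1}) ∧
  Tendsto (fun η : ℝ => ∫ τ in (t - ε)..t, ∑ i, ∫ θ in Γ.awayFrom x η i τ,
      Γ.dlIntegrand φ x t i θ τ) (𝓝[>] 0) (𝓝 V)

end MovingBoundary

end

/-! Near the singularity, let `s` be the parameter displacement from `x` and `σ = t - τ` the elapsed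
time, with parabolic weights 1 and 2. Expressed through the moments `Hₖ(q, σ) = σ^{-(k+1)} ∫₀¹ uᵏ
e^{-qu/(4σ)} du` at `q = |r|²`, the kernel has no division by `|r|²` left: it is `H₁` times a form
linear in `r` plus `H₂` times a cubic one (`dlKernel_apply`). Since `Hₖ` is bounded by a multiple of
`(q + σ)^{-(k+1)}`, the kernel has order -3, exactly the weight of `ds dσ`, so absolute convergence
is borderline and parity in `s` must help.

Expansion. Taylor expansion of the curve, the normal and the density, carried through sums, products
and `Hₖ`, gives a leading term of order -3 odd in `s`, a second term of order -2 even in `s`, and a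
remainder of order -1 that is odd modulo order 0 (`exists_hasExp_layerFun`). Adding the values at
`s` and `-s` leaves twice the even term up to a bounded error (`exists_layerFun_pair_le`).
Integrated over the line, the even term is exactly a constant vector times `σ^{-1/2}`; thus the
integral over `Γ(t - σ)` is this vector times `σ^{-1/2}`, plus O(1), and integrating in `σ` gives
`√ε` and O(ε). Without the parity of the remainder the error would only be O(ε log(1/ε)). Gaussian
moments and the moving frame turn the constant into the curvature and velocity terms
(`profileIntegral_frame`).

Principal value. The excised set `{|r| ≤ η}` is not symmetric in `s`, so parity does not control the
truncated integrals. Instead the leading term agrees, up to order -2, with the `s`-derivative of a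
function of `q = |r|²`. On a closed curve such a derivative integrates to zero over every superlevel
set of `q` (`integral_superlevel_comp_mul_deriv`). The rest is at most `C / (s² + σ)`, so the
truncated curve integrals are bounded by `C / √σ` uniformly in `η`. Dominated convergence in time
then identifies the principal value with the iterated integral over the whole boundary. -/

set_option linter.unusedSectionVars false

/-! ### Exponential moments and heat moments -/

noncomputable section

/-- The truncated exponential moment `∫₀¹ uᵏ e^{-lu} du`. -/
def expMoment (k : ℕ) (l : ℝ) : ℝ := ∫ u in (0 : ℝ)..1, u ^ k * Real.exp (-(l * u))

theorem intervalIntegrable_expMoment (k : ℕ) (l a b : ℝ) :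
    IntervalIntegrable (fun u => u ^ k * Real.exp (-(l * u))) volume a b :=
  Continuous.intervalIntegrable (by fun_prop) _ _

theorem continuous_expMoment (k : ℕ) : Continuous (expMoment k) := by
  unfold expMoment
  apply intervalIntegral.continuous_parametric_intervalIntegral_of_continuous'
  simp only [Function.uncurry_def]
  fun_prop

theorem expMoment_nonneg (k : ℕ) (l : ℝ) : 0 ≤ expMoment k l :=
  intervalIntegral.integral_nonneg zero_le_one fun u hu => by
    have := hu.1
    positivity

theorem expMoment_zero (l : ℝ) : 1 - l * expMoment 0 l = Real.exp (-l) := by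
  have h : ∫ u in (0 : ℝ)..1, -(l * (u ^ 0 * Real.exp (-(l * u))))
      = Real.exp (-(l * 1)) - Real.exp (-(l * 0)) := by
    apply intervalIntegral.integral_eq_sub_of_hasDerivAt
      (f := fun u : ℝ => Real.exp (-(l * u)))
    · intro u _
      have := (((hasDerivAt_id u).const_mul l).neg).exp
      refine this.congr_deriv ?_
      simp
      ring
    · exact ((intervalIntegrable_expMoment 0 l 0 1).const_mul l).neg
  rw [intervalIntegral.integral_neg, intervalIntegral.integral_const_mul] at h
  simp only [mul_one, mul_zero, neg_zero, Real.exp_zero] at h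
  unfold expMoment
  linarith

/-- Integration by parts, through the primitive `u^(k+1) e^{-lu}`. This recursion converts the two
radial profiles of the kernel into moments and also yields the decay in `l`. -/
theorem expMoment_succ (k : ℕ) (l : ℝ) :
    (k + 1) * expMoment k l - l * expMoment (k + 1) l = Real.exp (-l) := by
  have h : ∫ u in (0 : ℝ)..1, ((k + 1 : ℝ) * (u ^ k * Real.exp (-(l * u)))
        - l * (u ^ (k + 1) * Real.exp (-(l * u))))
      = 1 ^ (k + 1) * Real.exp (-(l * 1)) - 0 ^ (k + 1) * Real.exp (-(l * 0)) := by
    apply intervalIntegral.integral_eq_sub_of_hasDerivAt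
      (f := fun u : ℝ => u ^ (k + 1) * Real.exp (-(l * u)))
    · intro u _
      have := (hasDerivAt_pow (k + 1) u).mul (((hasDerivAt_id u).const_mul l).neg).exp
      refine this.congr_deriv ?_
      simp
      ring
    · exact ((intervalIntegrable_expMoment k l 0 1).const_mul _).sub
        ((intervalIntegrable_expMoment (k + 1) l 0 1).const_mul _)
  rw [intervalIntegral.integral_sub ((intervalIntegrable_expMoment k l 0 1).const_mul _)
        ((intervalIntegrable_expMoment (k + 1) l 0 1).const_mul _),
    intervalIntegral.integral_const_mul, intervalIntegral.integral_const_mul] at h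
  simpa [expMoment] using h

theorem expMoment_succ_le (k : ℕ) (l : ℝ) : expMoment (k + 1) l ≤ expMoment k l := by
  apply intervalIntegral.integral_mono_on zero_le_one
    (intervalIntegrable_expMoment _ _ _ _) (intervalIntegrable_expMoment _ _ _ _)
  intro u hu
  have h0 := hu.1
  have : u ^ (k + 1) ≤ u ^ k := pow_le_pow_of_le_one h0 hu.2 (Nat.le_succ k)
  gcongr

theorem expMoment_zero_le_one {l : ℝ} (hl : 0 ≤ l) : expMoment 0 l ≤ 1 := by
  have : expMoment 0 l ≤ ∫ u in (0 : ℝ)..1, (1 : ℝ) := by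
    apply intervalIntegral.integral_mono_on zero_le_one
      (intervalIntegrable_expMoment _ _ _ _) (by simp)
    intro u hu
    simpa using mul_nonneg hl hu.1
  simpa using this

/-- The recursion together with monotonicity in `k` gives `(1 + l) M_{k+1} ≤ (k + 2) M_k`, so each
step gains one power of `1 + l`. -/
theorem expMoment_mul_le (k : ℕ) {l : ℝ} (hl : 0 ≤ l) :
    expMoment k l * (1 + l) ^ (k + 1) ≤ 2 * (k + 1).factorial := by
  induction k with
  | zero =>
    have := expMoment_zero l
    have := Real.exp_pos (-l)
    have := expMoment_zero_le_one hl
    norm_num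
    linarith
  | succ k ih =>
    have h1 := expMoment_succ k l
    have h2 := expMoment_succ_le k l
    have h3 := Real.exp_pos (-l)
    have h4 := expMoment_nonneg k l
    have h5 : expMoment (k + 1) l * (1 + l) ≤ (k + 2) * expMoment k l := by linarith
    have h6 : 0 ≤ (1 + l) ^ (k + 1) := by positivity
    calc expMoment (k + 1) l * (1 + l) ^ (k + 1 + 1)
        = expMoment (k + 1) l * (1 + l) * (1 + l) ^ (k + 1) := by ring
      _ ≤ (k + 2) * expMoment k l * (1 + l) ^ (k + 1) := by gcongr
      _ = (k + 2) * (expMoment k l * (1 + l) ^ (k + 1)) := by ring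
      _ ≤ (k + 2) * (2 * (k + 1).factorial) := by gcongr
      _ = 2 * (k + 1 + 1).factorial := by
        rw [Nat.factorial_succ (k + 1)]; push_cast; ring

/-- The factor `1 + e^{-d}` covers both signs of `d`. After multiplication by `e^{-lu}` it becomes
the sum of the exponentials at the two arguments `l` and `l'`, so the Taylor remainder of the
moments keeps their decay. -/
theorem abs_exp_neg_sub_quadratic_le (d : ℝ) :
    |Real.exp (-d) - (1 - d + d ^ 2 / 2)| ≤ 4 * |d| ^ 3 * (1 + Real.exp (-d)) := by
  have he := Real.exp_pos (-d)
  by_cases h : |d| ≤ 1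
  · have := Real.exp_bound (x := -d) (by simpa using h) (n := 3) (by norm_num)
    simp only [Finset.sum_range_succ, Finset.sum_range_zero, abs_neg] at this
    norm_num [Nat.factorial] at this
    have h3 : 0 ≤ |d| ^ 3 := by positivity
    have e : Real.exp (-d) - (1 - d + d ^ 2 / 2) = Real.exp (-d) - (1 + -d + d ^ 2 / 2) := by ring
    rw [e]
    nlinarith [mul_nonneg h3 he.le]
  · push Not at h
    have h1 : |d| ≤ |d| ^ 3 := le_self_pow₀ h.le (by norm_num)
    have h2 : |d| ^ 2 ≤ |d| ^ 3 := pow_le_pow_right₀ h.le (by norm_num)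
    have h3 : |Real.exp (-d) - (1 - d + d ^ 2 / 2)| ≤ Real.exp (-d) + (1 + |d| + |d| ^ 2 / 2) := by
      rw [abs_le, sq_abs]
      have := neg_abs_le d
      have := le_abs_self d
      constructor <;> nlinarith [sq_nonneg d]
    nlinarith [mul_le_mul_of_nonneg_right (h.le.trans h1) he.le]

theorem abs_expMoment_taylor_le (k : ℕ) (l l' : ℝ) :
    |expMoment k l' - (expMoment k l - (l' - l) * expMoment (k + 1) l
        + (l' - l) ^ 2 / 2 * expMoment (k + 2) l)|
      ≤ 4 * |l' - l| ^ 3 * (expMoment (k + 3) l + expMoment (k + 3) l') := by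
  have e1 : expMoment k l' - (expMoment k l - (l' - l) * expMoment (k + 1) l
        + (l' - l) ^ 2 / 2 * expMoment (k + 2) l)
      = ∫ u in (0 : ℝ)..1, (u ^ k * Real.exp (-(l' * u)) - (u ^ k * Real.exp (-(l * u))
          - (l' - l) * (u ^ (k + 1) * Real.exp (-(l * u)))
          + (l' - l) ^ 2 / 2 * (u ^ (k + 2) * Real.exp (-(l * u))))) := by
    rw [intervalIntegral.integral_sub, intervalIntegral.integral_add, intervalIntegral.integral_sub,
      intervalIntegral.integral_const_mul, intervalIntegral.integral_const_mul]
    · rfl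
    all_goals exact Continuous.intervalIntegrable (by fun_prop) _ _
  have e2 : 4 * |l' - l| ^ 3 * (expMoment (k + 3) l + expMoment (k + 3) l')
      = ∫ u in (0 : ℝ)..1, 4 * |l' - l| ^ 3 * (u ^ (k + 3) * Real.exp (-(l * u))
          + u ^ (k + 3) * Real.exp (-(l' * u))) := by
    rw [intervalIntegral.integral_const_mul, intervalIntegral.integral_add]
    · rfl
    all_goals exact Continuous.intervalIntegrable (by fun_prop) _ _
  rw [e1, e2, ← Real.norm_eq_abs]
  apply intervalIntegral.norm_integral_le_of_norm_le zero_le_one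
  · refine ae_of_all _ fun u hu => ?_
    have h0 : 0 ≤ u := hu.1.le
    have hexp : Real.exp (-(l' * u)) = Real.exp (-(l * u)) * Real.exp (-((l' - l) * u)) := by
      rw [← Real.exp_add]; ring_nf
    have key := abs_exp_neg_sub_quadratic_le ((l' - l) * u)
    have hf : u ^ k * Real.exp (-(l' * u)) - (u ^ k * Real.exp (-(l * u))
          - (l' - l) * (u ^ (k + 1) * Real.exp (-(l * u)))
          + (l' - l) ^ 2 / 2 * (u ^ (k + 2) * Real.exp (-(l * u))))
        = u ^ k * Real.exp (-(l * u)) * (Real.exp (-((l' - l) * u))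
          - (1 - (l' - l) * u + ((l' - l) * u) ^ 2 / 2)) := by
      rw [hexp]; ring
    rw [hf, norm_mul, Real.norm_eq_abs, Real.norm_eq_abs,
      abs_of_nonneg (by positivity : 0 ≤ u ^ k * Real.exp (-(l * u)))]
    calc _ ≤ u ^ k * Real.exp (-(l * u)) * (4 * |(l' - l) * u| ^ 3
          * (1 + Real.exp (-((l' - l) * u)))) := by gcongr
      _ = _ := by rw [hexp, abs_mul, abs_of_nonneg h0]; ring
  · exact Continuous.intervalIntegrable (by fun_prop) _ _

/-- `∫₀^{1/σ} wᵏ e^{-qw/4} dw`, written over the unit interval. -/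
def heatMoment (k : ℕ) (q σ : ℝ) : ℝ := expMoment k (q / (4 * σ)) / σ ^ (k + 1)

theorem heatMoment_nonneg (k : ℕ) (q : ℝ) {σ : ℝ} (hσ : 0 < σ) : 0 ≤ heatMoment k q σ :=
  div_nonneg (expMoment_nonneg _ _) (by positivity)

theorem continuousOn_heatMoment (k : ℕ) :
    ContinuousOn (fun p : ℝ × ℝ => heatMoment k p.1 p.2) {p | 0 < p.2} := by
  unfold heatMoment
  refine ContinuousOn.div ?_ (by fun_prop) fun p hp => pow_ne_zero _ (ne_of_gt hp)
  refine (continuous_expMoment k).comp_continuousOn ?_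
  exact ContinuousOn.div (by fun_prop) (by fun_prop) fun p hp =>
    mul_ne_zero four_ne_zero (ne_of_gt hp)

theorem continuous_heatMoment (k : ℕ) (σ : ℝ) : Continuous (fun q => heatMoment k q σ) := by
  unfold heatMoment
  exact ((continuous_expMoment k).comp (by fun_prop)).div_const _

/-- Parabolic decay: with `q` of weight 2, the `k`-th heat moment has order `-(2k + 2)`, uniformly
as `q` or `σ` tends to zero. -/
theorem exists_heatMoment_le (k : ℕ) : ∃ C > 0, ∀ q σ : ℝ, 0 ≤ q → 0 < σ →
    heatMoment k q σ ≤ C / (q + σ) ^ (k + 1) := by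
  refine ⟨2 * (k + 1).factorial * 4 ^ (k + 1), by positivity, fun q σ hq hσ => ?_⟩
  have h := expMoment_mul_le k (l := q / (4 * σ)) (by positivity)
  have hpos : 0 < (q + σ) ^ (k + 1) := by positivity
  rw [le_div_iff₀ hpos]
  unfold heatMoment
  have h1 : (q + σ) ^ (k + 1) ≤ 4 ^ (k + 1) * (σ ^ (k + 1) * (1 + q / (4 * σ)) ^ (k + 1)) := by
    rw [← mul_pow, ← mul_pow]
    apply pow_le_pow_left₀ (by positivity)
    have : 4 * (σ * (1 + q / (4 * σ))) = 4 * σ + q := by field_simp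
    rw [this]; linarith
  have h2 := expMoment_nonneg k (q / (4 * σ))
  calc expMoment k (q / (4 * σ)) / σ ^ (k + 1) * (q + σ) ^ (k + 1)
      ≤ expMoment k (q / (4 * σ)) / σ ^ (k + 1) *
        (4 ^ (k + 1) * (σ ^ (k + 1) * (1 + q / (4 * σ)) ^ (k + 1))) := by gcongr
    _ = expMoment k (q / (4 * σ)) * (1 + q / (4 * σ)) ^ (k + 1) * 4 ^ (k + 1) := by
      field_simp
    _ ≤ _ := by gcongr

/-- Differentiation in `q` sends `Hₖ` to `-H_{k+1} / 4`, which explains the coefficients 1/4 and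
1/32. Each power of `q' - q` is paired with one more moment. -/
theorem abs_heatMoment_taylor_le (k : ℕ) (q q' : ℝ) {σ : ℝ} (hσ : 0 < σ) :
    |heatMoment k q' σ - (heatMoment k q σ - (q' - q) / 4 * heatMoment (k + 1) q σ
        + (q' - q) ^ 2 / 32 * heatMoment (k + 2) q σ)|
      ≤ |q' - q| ^ 3 * (heatMoment (k + 3) q σ + heatMoment (k + 3) q' σ) := by
  have h := abs_expMoment_taylor_le k (q / (4 * σ)) (q' / (4 * σ))
  have hd : q' / (4 * σ) - q / (4 * σ) = (q' - q) / (4 * σ) := by ring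
  rw [hd] at h
  have e : heatMoment k q' σ - (heatMoment k q σ - (q' - q) / 4 * heatMoment (k + 1) q σ
        + (q' - q) ^ 2 / 32 * heatMoment (k + 2) q σ)
      = (expMoment k (q' / (4 * σ)) - (expMoment k (q / (4 * σ))
        - (q' - q) / (4 * σ) * expMoment (k + 1) (q / (4 * σ))
        + ((q' - q) / (4 * σ)) ^ 2 / 2 * expMoment (k + 2) (q / (4 * σ)))) / σ ^ (k + 1) := by
    unfold heatMoment
    field_simp
    ring
  rw [e, abs_div, abs_of_pos (by positivity : 0 < σ ^ (k + 1)), div_le_iff₀ (by positivity)]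
  refine h.trans ?_
  rw [abs_div, abs_of_pos (by positivity : 0 < 4 * σ)]
  have n1 := expMoment_nonneg (k + 3) (q / (4 * σ))
  have n2 := expMoment_nonneg (k + 3) (q' / (4 * σ))
  have e2 : |q' - q| ^ 3 * (heatMoment (k + 3) q σ + heatMoment (k + 3) q' σ) * σ ^ (k + 1)
      = |q' - q| ^ 3 * (expMoment (k + 3) (q / (4 * σ)) + expMoment (k + 3) (q' / (4 * σ)))
        / σ ^ 3 := by
    unfold heatMoment
    field_simp
    ring
  rw [e2]
  have e3 : 4 * (|q' - q| / (4 * σ)) ^ 3 *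
      (expMoment (k + 3) (q / (4 * σ)) + expMoment (k + 3) (q' / (4 * σ)))
      = 1 / 16 * (|q' - q| ^ 3 * (expMoment (k + 3) (q / (4 * σ))
        + expMoment (k + 3) (q' / (4 * σ))) / σ ^ 3) := by
    field_simp
    ring
  rw [e3]
  have : 0 ≤ |q' - q| ^ 3 * (expMoment (k + 3) (q / (4 * σ)) + expMoment (k + 3) (q' / (4 * σ)))
        / σ ^ 3 := by positivity
  linarith

/-! ### The kernel in terms of heat moments -/

/-- `8π` times the double layer kernel with (not necessarily unit) normal `n`, applied to `p`. -/
def layerDensity (n r p : Plane) (σ : ℝ) : Plane :=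
  heatMoment 1 ⟪r, r⟫ σ • (⟪r, p⟫ • n - ⟪n, p⟫ • r + ⟪n, r⟫ • p)
    + heatMoment 2 ⟪r, r⟫ σ • ((1 / 2 : ℝ) • (⟪n, r⟫ • (⟪r, p⟫ • r))
      - (1 / 4 : ℝ) • (⟪r, r⟫ • (⟪r, p⟫ • n + ⟪n, r⟫ • p)))

theorem layerDensity_smul (c : ℝ) (n r p : Plane) (σ : ℝ) :
    layerDensity (c • n) r p σ = c • layerDensity n r p σ := by
  simp only [layerDensity, real_inner_smul_left]
  module

theorem dyad_apply (a b c : Plane) : dyad a b c = ⟪b, c⟫ • a := by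
  simp [dyad]

/-- The apparent singularities in `|r|²` cancel by the moment recursion. What remains is meaningful
at `r = 0`, where both sides vanish, and is linear in the normal. -/
theorem dlKernel_apply (n r p : Plane) {σ : ℝ} (hσ : 0 < σ) :
    dlKernel n r σ p = (1 / (8 * Real.pi)) • layerDensity n r p σ := by
  rcases eq_or_ne r 0 with rfl | hr
  · simp [dlKernel, layerDensity, dyad]
  have hq : 0 < ‖r‖ ^ 2 := by positivity
  simp only [dlKernel, layerDensity, real_inner_self_eq_norm_sq]
  set q := ‖r‖ ^ 2 with hqdef
  set l := q / (4 * σ) with hl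
  have hl0 : 0 < l := by positivity
  have m0 := expMoment_zero l
  have m1 := expMoment_succ 0 l
  have m2 := expMoment_succ 1 l
  norm_num at m1 m2
  -- Both radial profiles become combinations of the first and second moments: the numerator of the
  -- second kernel term contains the factor `l²` explicitly, and `e^{-l} = 2 M₁ - l M₂`. Then `q =
  -- 4σl` removes every division by `q`.
  have hB : 1 - Real.exp (-l) - l * Real.exp (-l) = l ^ 2 * expMoment 1 l := by
    linear_combination m0 + l * m1
  have hA : Real.exp (-l) = 2 * expMoment 1 l - l * expMoment 2 l := by linarith
  have hqσ : q = 4 * σ * l := by rw [hl]; field_simp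
  rw [hB, hA]
  simp only [heatMoment, ← hl]
  simp only [sub_apply, add_apply,
    smul_apply, dyad_apply, one_apply_eq_self]
  have hpi := Real.pi_pos
  rw [hqσ]
  match_scalars <;> (field_simp; ring)


/-! ### Parabolic order at the singularity -/

/-- The parabolic size of a displacement `s` together with an elapsed time `σ`. -/
def paraSize (p : ℝ × ℝ) : ℝ := Real.sqrt (p.1 ^ 2 + p.2)

/-- The germs at the origin of the upper half plane of pairs `(s, σ)` with `0 < σ`. -/
def paraFilter : Filter (ℝ × ℝ) := 𝓝[{p | 0 < p.2}] 0

/-- The reflection `(s, σ) ↦ (-s, σ)`. -/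
def spaceFlip (p : ℝ × ℝ) : ℝ × ℝ := (-p.1, p.2)

theorem eventually_paraFilter {P : ℝ × ℝ → Prop} :
    (∀ᶠ p in paraFilter, P p) ↔ ∃ r > 0, ∀ p : ℝ × ℝ, |p.1| < r → 0 < p.2 → p.2 < r → P p := by
  unfold paraFilter
  rw [eventually_nhdsWithin_iff, Metric.eventually_nhds_iff]
  constructor
  · rintro ⟨r, hr, h⟩
    refine ⟨r, hr, fun p h1 h2 h3 => h ?_ h2⟩
    rw [dist_zero_right, Prod.norm_def, max_lt_iff]
    exact ⟨h1, by rwa [Real.norm_eq_abs, abs_of_pos h2]⟩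
  · rintro ⟨r, hr, h⟩
    refine ⟨r, hr, fun p hp h2 => ?_⟩
    rw [dist_zero_right, Prod.norm_def, max_lt_iff] at hp
    exact h p hp.1 h2 ((le_abs_self _).trans_lt hp.2)

theorem tendsto_spaceFlip : Tendsto spaceFlip paraFilter paraFilter := by
  intro s hs
  obtain ⟨r, hr, h⟩ := eventually_paraFilter.1 hs
  exact eventually_paraFilter.2 ⟨r, hr, fun p h1 h2 h3 =>
    h (spaceFlip p) (by simpa [spaceFlip] using h1) h2 h3⟩

theorem paraSize_nonneg (p : ℝ × ℝ) : 0 ≤ paraSize p := Real.sqrt_nonneg _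

theorem paraSize_pos {p : ℝ × ℝ} (h : 0 < p.2) : 0 < paraSize p :=
  Real.sqrt_pos.2 (by positivity)

theorem paraSize_sq {p : ℝ × ℝ} (h : 0 < p.2) : paraSize p ^ 2 = p.1 ^ 2 + p.2 :=
  Real.sq_sqrt (by positivity)

theorem paraSize_flip (p : ℝ × ℝ) : paraSize (spaceFlip p) = paraSize p := by
  simp [paraSize, spaceFlip]

theorem abs_fst_le_paraSize {p : ℝ × ℝ} (h : 0 < p.2) : |p.1| ≤ paraSize p := by
  rw [← Real.sqrt_sq_eq_abs]
  exact Real.sqrt_le_sqrt (by linarith)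

theorem snd_le_paraSize_sq {p : ℝ × ℝ} (h : 0 < p.2) : p.2 ≤ paraSize p ^ 2 := by
  rw [paraSize_sq h]
  nlinarith [sq_nonneg p.1]

theorem eventually_snd_pos : ∀ᶠ p in paraFilter, 0 < p.2 :=
  eventually_paraFilter.2 ⟨1, one_pos, fun _ _ h _ => h⟩

theorem eventually_paraSize_lt {c : ℝ} (hc : 0 < c) : ∀ᶠ p in paraFilter, paraSize p < c := by
  have hcont : Continuous paraSize := by unfold paraSize; fun_prop
  have : Tendsto paraSize paraFilter (𝓝 0) := by
    have h := hcont.tendsto (0 : ℝ × ℝ)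
    simp only [paraSize, Prod.fst_zero, Prod.snd_zero] at h
    norm_num at h
    exact h.mono_left nhdsWithin_le_nhds
  exact this.eventually_lt_const hc

section ParaO

variable {E F G : Type*} [NormedAddCommGroup E] [NormedSpace ℝ E] [NormedAddCommGroup F]
  [NormedSpace ℝ F] [NormedAddCommGroup G] [NormedSpace ℝ G]

/-- `f` has parabolic order at least `w` at the origin. -/
def ParaO (f : ℝ × ℝ → E) (w : ℤ) : Prop := f =O[paraFilter] fun p => paraSize p ^ w

theorem ParaO.add {f g : ℝ × ℝ → E} {w : ℤ} (hf : ParaO f w) (hg : ParaO g w) :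
    ParaO (fun p => f p + g p) w := IsBigO.add hf hg

theorem ParaO.sub {f g : ℝ × ℝ → E} {w : ℤ} (hf : ParaO f w) (hg : ParaO g w) :
    ParaO (fun p => f p - g p) w := IsBigO.sub hf hg

theorem ParaO.const_smul {f : ℝ × ℝ → E} {w : ℤ} (hf : ParaO f w) (c : ℝ) :
    ParaO (fun p => c • f p) w := IsBigO.const_smul_left hf c

theorem ParaO.congr {f g : ℝ × ℝ → E} {w : ℤ} (hf : ParaO f w)
    (h : ∀ᶠ p in paraFilter, g p = f p) : ParaO g w :=
  IsBigO.congr' hf (h.mono fun _ hp => hp.symm) EventuallyEq.rfl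

theorem ParaO.congr_all {f g : ℝ × ℝ → E} {w : ℤ} (hf : ParaO f w)
    (h : ∀ p, g p = f p) : ParaO g w := hf.congr (Eventually.of_forall h)

theorem ParaO.mono {f : ℝ × ℝ → E} {w w' : ℤ} (hf : ParaO f w) (h : w' ≤ w) : ParaO f w' := by
  refine IsBigO.trans hf (IsBigO.of_bound 1 ?_)
  filter_upwards [eventually_snd_pos, eventually_paraSize_lt one_pos] with p hp h1
  have h0 := paraSize_pos hp
  rw [one_mul, Real.norm_of_nonneg (zpow_nonneg h0.le _), Real.norm_of_nonneg (zpow_nonneg h0.le _)]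
  exact zpow_le_zpow_right_of_le_one₀ h0 h1.le h

theorem ParaO.flip {f : ℝ × ℝ → E} {w : ℤ} (hf : ParaO f w) :
    ParaO (fun p => f (spaceFlip p)) w := by
  have := IsBigO.comp_tendsto hf tendsto_spaceFlip
  simp only [Function.comp_def, paraSize_flip] at this
  exact this

theorem ParaO.bilin (B : E →L[ℝ] F →L[ℝ] G) {f : ℝ × ℝ → E} {g : ℝ × ℝ → F} {w w' : ℤ}
    (hf : ParaO f w) (hg : ParaO g w') : ParaO (fun p => B (f p) (g p)) (w + w') := by
  have h1 : (fun p => B (f p) (g p)) =O[paraFilter] fun p => ‖f p‖ * ‖g p‖ := by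
    refine IsBigO.of_bound ‖B‖ (Eventually.of_forall fun p => ?_)
    rw [norm_mul, norm_norm, norm_norm, ← mul_assoc]
    exact B.le_opNorm₂ _ _
  refine h1.trans (((IsBigO.norm_left hf).mul (IsBigO.norm_left hg)).congr' EventuallyEq.rfl ?_)
  filter_upwards [eventually_snd_pos] with p hp
  rw [zpow_add₀ (paraSize_pos hp).ne']

theorem ParaO.mul {f g : ℝ × ℝ → ℝ} {w w' : ℤ}
    (hf : ParaO f w) (hg : ParaO g w') : ParaO (fun p => f p * g p) (w + w') :=
  hf.bilin (ContinuousLinearMap.mul ℝ ℝ) hg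

theorem ParaO.smul {f : ℝ × ℝ → ℝ} {g : ℝ × ℝ → E} {w w' : ℤ}
    (hf : ParaO f w) (hg : ParaO g w') : ParaO (fun p => f p • g p) (w + w') :=
  hf.bilin (ContinuousLinearMap.lsmul ℝ ℝ) hg

theorem paraO_const (c : E) : ParaO (fun _ => c) 0 := by
  unfold ParaO
  simpa using isBigO_const_const c (one_ne_zero' ℝ) _

theorem paraO_fst : ParaO (fun p => p.1) 1 := by
  refine IsBigO.of_bound 1 ?_
  filter_upwards [eventually_snd_pos] with p hp
  rw [one_mul, zpow_one, Real.norm_of_nonneg (paraSize_nonneg p)]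
  exact abs_fst_le_paraSize hp

theorem paraO_snd : ParaO (fun p => p.2) 2 := by
  refine IsBigO.of_bound 1 ?_
  filter_upwards [eventually_snd_pos] with p hp
  rw [one_mul, zpow_ofNat, Real.norm_of_nonneg hp.le, Real.norm_of_nonneg (by positivity)]
  exact snd_le_paraSize_sq hp

theorem paraO_zero (w : ℤ) : ParaO (fun _ => (0 : E)) w := isBigO_zero _ _

theorem ParaO.exists_bound {f : ℝ × ℝ → E} {w : ℤ} (hf : ParaO f w) :
    ∃ C > 0, ∃ r > 0, ∀ p : ℝ × ℝ, |p.1| < r → 0 < p.2 → p.2 < r →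
      ‖f p‖ ≤ C * paraSize p ^ w := by
  obtain ⟨C, hC, h⟩ := IsBigO.exists_pos hf
  obtain ⟨r, hr, h⟩ := eventually_paraFilter.1 h.bound
  refine ⟨C, hC, r, hr, fun p h1 h2 h3 => ?_⟩
  have := h p h1 h2 h3
  rwa [Real.norm_of_nonneg (zpow_nonneg (paraSize_nonneg p) _)] at this

/-- Integration in the space variable raises the parabolic order by one. -/
theorem ParaO.of_hasDerivAt {g g' : ℝ × ℝ → E} {n : ℕ} {δ : ℝ} (hδ : 0 < δ)
    (hd : ∀ p : ℝ × ℝ, 0 < p.2 → p.2 < δ → HasDerivAt (fun s => g (s, p.2)) (g' p) p.1)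
    (hg' : ParaO g' n) (h0 : ParaO (fun p => g (0, p.2)) (n + 1)) : ParaO g (n + 1) := by
  obtain ⟨C, hC, r, hr, h⟩ := hg'.exists_bound
  have key : ParaO (fun p => g p - g (0, p.2)) (n + 1) := by
    refine IsBigO.of_bound C (eventually_paraFilter.2 ⟨min r δ, lt_min hr hδ, ?_⟩)
    intro p h1 h2 h3
    rw [lt_min_iff] at h1 h3
    have hb : ∀ x ∈ uIcc 0 p.1, ‖g' (x, p.2)‖ ≤ C * paraSize p ^ n := by
      intro x hx
      have hx' : |x| ≤ |p.1| := by
        have := abs_sub_left_of_mem_uIcc hx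
        simpa using this
      refine (h (x, p.2) (hx'.trans_lt h1.1) h2 h3.1).trans ?_
      -- The order `n` is a natural number, so `paraSize ^ n` is largest at the far end of the
      -- segment from `(0, σ)` to `(s, σ)`.
      rw [zpow_natCast]
      gcongr
      · exact paraSize_nonneg _
      · exact Real.sqrt_le_sqrt (by simpa using sq_le_sq.2 hx')
    have := (convex_uIcc (0 : ℝ) p.1).norm_image_sub_le_of_norm_hasDerivWithin_le
      (f := fun s => g (s, p.2)) (f' := fun s => g' (s, p.2))
      (fun x _ => (hd (x, p.2) h2 h3.2).hasDerivWithinAt) hb left_mem_uIcc right_mem_uIcc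
    simp only [sub_zero, Prod.mk.eta] at this
    refine this.trans ?_
    rw [Real.norm_of_nonneg (zpow_nonneg (paraSize_nonneg p) _), mul_assoc,
      ← Nat.cast_one (R := ℤ), ← Nat.cast_add, zpow_natCast, pow_succ]
    have := paraSize_nonneg p
    gcongr
    exact abs_fst_le_paraSize h2
  exact (key.add h0).congr_all fun p => by simp

end ParaO

/-! ### Calculus of two-term expansions with parity -/

section HasExp

variable {E F G : Type*} [NormedAddCommGroup E] [NormedSpace ℝ E] [NormedAddCommGroup F]
  [NormedSpace ℝ F] [NormedAddCommGroup G] [NormedSpace ℝ G]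

/-- A two-term expansion `f ≈ f₀ + f₁` of parabolic order `w`, whose terms alternate in parity
(starting with the sign `e`), up to and including the first remainder term. -/
structure HasExp (w : ℤ) (e : ℝ) (f f₀ f₁ : ℝ × ℝ → E) : Prop where
  lead : ParaO f₀ w
  next : ParaO f₁ (w + 1)
  rem : ParaO (fun p => f p - f₀ p - f₁ p) (w + 2)
  par : ParaO (fun p => (f (spaceFlip p) - f₀ (spaceFlip p) - f₁ (spaceFlip p))
    - e • (f p - f₀ p - f₁ p)) (w + 3)
  lead_flip : ∀ p, f₀ (spaceFlip p) = e • f₀ p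
  next_flip : ∀ p, f₁ (spaceFlip p) = -(e • f₁ p)

theorem HasExp.add {w : ℤ} {e : ℝ} {f f₀ f₁ g g₀ g₁ : ℝ × ℝ → E} (hf : HasExp w e f f₀ f₁)
    (hg : HasExp w e g g₀ g₁) : HasExp w e (fun p => f p + g p) (fun p => f₀ p + g₀ p)
      (fun p => f₁ p + g₁ p) where
  lead := hf.lead.add hg.lead
  next := hf.next.add hg.next
  rem := (hf.rem.add hg.rem).congr_all fun p => by module
  par := (hf.par.add hg.par).congr_all fun p => by module
  lead_flip p := by rw [hf.lead_flip, hg.lead_flip]; module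
  next_flip p := by rw [hf.next_flip, hg.next_flip]; module

theorem HasExp.const_smul {w : ℤ} {e : ℝ} {f f₀ f₁ : ℝ × ℝ → E} (hf : HasExp w e f f₀ f₁)
    (c : ℝ) : HasExp w e (fun p => c • f p) (fun p => c • f₀ p) (fun p => c • f₁ p) where
  lead := hf.lead.const_smul c
  next := hf.next.const_smul c
  rem := (hf.rem.const_smul c).congr_all fun p => by module
  par := (hf.par.const_smul c).congr_all fun p => by module
  lead_flip p := by rw [hf.lead_flip]; module
  next_flip p := by rw [hf.next_flip]; module

theorem HasExp.sub {w : ℤ} {e : ℝ} {f f₀ f₁ g g₀ g₁ : ℝ × ℝ → E} (hf : HasExp w e f f₀ f₁)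
    (hg : HasExp w e g g₀ g₁) : HasExp w e (fun p => f p - g p) (fun p => f₀ p - g₀ p)
      (fun p => f₁ p - g₁ p) where
  lead := hf.lead.sub hg.lead
  next := hf.next.sub hg.next
  rem := (hf.rem.sub hg.rem).congr_all fun p => by module
  par := (hf.par.sub hg.par).congr_all fun p => by module
  lead_flip p := by rw [hf.lead_flip, hg.lead_flip]; module
  next_flip p := by rw [hf.next_flip, hg.next_flip]; module

theorem HasExp.clm {w : ℤ} {e : ℝ} {f f₀ f₁ : ℝ × ℝ → E} (hf : HasExp w e f f₀ f₁)
    (A : E →L[ℝ] F) : HasExp w e (fun p => A (f p)) (fun p => A (f₀ p)) (fun p => A (f₁ p)) where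
  lead := (A.isBigO_comp _ _).trans hf.lead
  next := (A.isBigO_comp _ _).trans hf.next
  rem := IsBigO.congr_left ((A.isBigO_comp _ _).trans hf.rem) fun p => by simp
  par := IsBigO.congr_left ((A.isBigO_comp _ _).trans hf.par) fun p => by simp
  lead_flip p := by rw [hf.lead_flip]; simp
  next_flip p := by rw [hf.next_flip]; simp

/-- With `u`, `v` the remainders of the factors, the remainder of the product is `f₁g₁ + f₀v + ug₀`
plus terms of order three above the leading one. The latter need no parity, and the first three have
sign `ee'` up to that order. -/
theorem HasExp.bilin (B : E →L[ℝ] F →L[ℝ] G) {w w' : ℤ} {e e' : ℝ} {f f₀ f₁ : ℝ × ℝ → E}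
    {g g₀ g₁ : ℝ × ℝ → F} (hf : HasExp w e f f₀ f₁) (hg : HasExp w' e' g g₀ g₁) :
    HasExp (w + w') (e * e') (fun p => B (f p) (g p)) (fun p => B (f₀ p) (g₀ p))
      (fun p => B (f₀ p) (g₁ p) + B (f₁ p) (g₀ p)) := by
  set u := fun p => f p - f₀ p - f₁ p with hu
  set v := fun p => g p - g₀ p - g₁ p with hv
  have fe : ∀ p, f p = f₀ p + f₁ p + u p := fun p => by simp [hu]
  have ge : ∀ p, g p = g₀ p + g₁ p + v p := fun p => by simp [hv]
  have hu2 : ParaO u (w + 2) := hf.rem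
  have hv2 : ParaO v (w' + 2) := hg.rem
  have hu3 : ParaO (fun p => u (spaceFlip p) - e • u p) (w + 3) := hf.par
  have hv3 : ParaO (fun p => v (spaceFlip p) - e' • v p) (w' + 3) := hg.par
  -- the part of the remainder that has one order more than needed
  set R := fun p => B (f₁ p) (v p) + B (u p) (g₁ p) + B (u p) (v p) with hR
  have hR3 : ParaO R (w + w' + 3) :=
    (((hf.next.bilin B hv2).mono (by linarith)).add ((hu2.bilin B hg.next).mono (by linarith))).add
      ((hu2.bilin B hv2).mono (by linarith))
  have hrem : ∀ p, B (f p) (g p) - B (f₀ p) (g₀ p) - (B (f₀ p) (g₁ p) + B (f₁ p) (g₀ p))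
      = B (f₁ p) (g₁ p) + B (f₀ p) (v p) + B (u p) (g₀ p) + R p := by
    intro p
    rw [fe, ge, hR]
    simp only [map_add, add_apply]
    abel
  refine ⟨hf.lead.bilin B hg.lead, ?_, ?_, ?_, ?_, ?_⟩
  · exact ((hf.lead.bilin B hg.next).mono (by linarith)).add
      ((hf.next.bilin B hg.lead).mono (by linarith))
  · refine ParaO.congr_all ?_ hrem
    exact ((((hf.next.bilin B hg.next).mono (by linarith)).add
      ((hf.lead.bilin B hv2).mono (by linarith))).add
      ((hu2.bilin B hg.lead).mono (by linarith))).add (hR3.mono (by linarith))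
  · have h1 : ParaO (fun p => e • B (f₀ p) (v (spaceFlip p) - e' • v p)
        + e' • B (u (spaceFlip p) - e • u p) (g₀ p)
        + (R (spaceFlip p) - (e * e') • R p)) (w + w' + 3) :=
      (((hf.lead.bilin B hv3).mono (by linarith)).const_smul e |>.add
        (((hu3.bilin B hg.lead).mono (by linarith)).const_smul e')).add
        (hR3.flip.sub (hR3.const_smul _))
    refine h1.congr_all fun p => ?_
    rw [hrem p, hrem (spaceFlip p), hf.lead_flip, hf.next_flip, hg.lead_flip, hg.next_flip]
    simp only [map_sub, map_neg, map_smul, sub_apply, neg_apply, smul_apply]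
    module
  · intro p
    rw [hf.lead_flip, hg.lead_flip]
    simp only [map_smul, smul_apply]
    module
  · intro p
    rw [hf.lead_flip, hg.lead_flip, hf.next_flip, hg.next_flip]
    simp only [map_smul, smul_apply, map_neg, neg_apply]
    module

theorem HasExp.smul {w w' : ℤ} {e e' : ℝ} {f f₀ f₁ : ℝ × ℝ → ℝ}
    {g g₀ g₁ : ℝ × ℝ → E} (hf : HasExp w e f f₀ f₁) (hg : HasExp w' e' g g₀ g₁) :
    HasExp (w + w') (e * e') (fun p => f p • g p) (fun p => f₀ p • g₀ p)
      (fun p => f₀ p • g₁ p + f₁ p • g₀ p) :=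
  hf.bilin (ContinuousLinearMap.lsmul ℝ ℝ) hg

theorem HasExp.inner {w w' : ℤ} {e e' : ℝ} {f f₀ f₁ : ℝ × ℝ → Plane}
    {g g₀ g₁ : ℝ × ℝ → Plane} (hf : HasExp w e f f₀ f₁) (hg : HasExp w' e' g g₀ g₁) :
    HasExp (w + w') (e * e') (fun p => ⟪f p, g p⟫) (fun p => ⟪f₀ p, g₀ p⟫)
      (fun p => ⟪f₀ p, g₁ p⟫ + ⟪f₁ p, g₀ p⟫) :=
  hf.bilin (innerSL ℝ) hg

theorem HasExp.congr_index {w w' : ℤ} {e e' : ℝ} {f f₀ f₁ : ℝ × ℝ → E} (hf : HasExp w e f f₀ f₁)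
    (hw : w = w') (he : e = e') : HasExp w' e' f f₀ f₁ := hw ▸ he ▸ hf

theorem HasExp.sub_lead {w : ℤ} {e : ℝ} {f f₀ f₁ : ℝ × ℝ → E} (hf : HasExp w e f f₀ f₁) :
    ParaO (fun p => f p - f₀ p) (w + 1) :=
  (hf.next.add (hf.rem.mono (by linarith))).congr_all fun p => by simp

theorem paraO_heatMoment (k : ℕ) {q : ℝ × ℝ → ℝ} {c : ℝ} (hc : 0 < c)
    (hq : ∀ᶠ p in paraFilter, 0 ≤ q p ∧ c * paraSize p ^ 2 ≤ q p + p.2) :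
    ParaO (fun p => heatMoment k (q p) p.2) (-(2 * (k : ℤ) + 2)) := by
  obtain ⟨C, hC, h⟩ := exists_heatMoment_le k
  refine IsBigO.of_bound (C / c ^ (k + 1)) ?_
  filter_upwards [hq, eventually_snd_pos] with p ⟨h0, h1⟩ hp
  have hρ := paraSize_pos hp
  rw [Real.norm_of_nonneg (heatMoment_nonneg k _ hp), Real.norm_of_nonneg (by positivity)]
  refine (h _ _ h0 hp).trans ?_
  have e : paraSize p ^ (-(2 * (k : ℤ) + 2)) = ((paraSize p ^ 2) ^ (k + 1))⁻¹ := by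
    rw [zpow_neg, ← pow_mul]
    congr 1
  rw [e, div_mul_eq_mul_div, ← div_eq_mul_inv, div_div, ← mul_pow, mul_comm _ c]
  gcongr

/-- The deviation of `q` from `a s²` has order 3, so near the origin it is absorbed by half of the
form `a s² + σ`. -/
theorem HasExp.eventually_le_add {q q₁ : ℝ × ℝ → ℝ} {a : ℝ} (ha : 0 < a)
    (hq : HasExp 2 1 q (fun p => a * p.1 ^ 2) q₁) :
    ∃ c > 0, ∀ᶠ p in paraFilter, c * paraSize p ^ 2 ≤ q p + p.2
      ∧ c * paraSize p ^ 2 ≤ a * p.1 ^ 2 + p.2 := by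
  obtain ⟨C, hC, hb⟩ := IsBigO.exists_pos hq.sub_lead
  set c := min a 1 / 2 with hc
  have hc0 : 0 < c := by positivity
  refine ⟨c, hc0, ?_⟩
  filter_upwards [hb.bound, eventually_snd_pos, eventually_paraSize_lt (div_pos hc0 hC)]
    with p h1 hp h2
  have hρ := paraSize_pos hp
  have hs := paraSize_sq hp
  have h3 : 2 * c * paraSize p ^ 2 ≤ a * p.1 ^ 2 + p.2 := by
    rw [hs]
    have e1 : 2 * c ≤ a := by rw [hc]; linarith [min_le_left a 1]
    have e2 : 2 * c ≤ 1 := by rw [hc]; linarith [min_le_right a 1]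
    nlinarith [sq_nonneg p.1]
  norm_num at h1
  rw [abs_of_pos hρ] at h1
  have h4 : C * paraSize p ^ 3 ≤ c * paraSize p ^ 2 := by
    have : C * paraSize p ≤ c := by
      rw [lt_div_iff₀ hC] at h2; linarith
    calc C * paraSize p ^ 3 = C * paraSize p * paraSize p ^ 2 := by ring
      _ ≤ _ := by gcongr
  have h5 := neg_abs_le (q p - a * p.1 ^ 2)
  have : (0 : ℝ) ≤ c * paraSize p ^ 2 := by positivity
  constructor
  · have : |q p - a * p.1 ^ 2| ≤ C * paraSize p ^ 3 := by exact_mod_cast h1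
    linarith
  · linarith

/-- Taylor expansion in `q` around `a s²`: the deviation has order 3 and each derivative of `Hₖ`
costs 2, so each power of the deviation gains one order. The cubic remainder already has the order
at which parity is no longer needed. -/
theorem HasExp.heatMoment (k : ℕ) {q q₁ : ℝ × ℝ → ℝ} {a : ℝ} (ha : 0 < a)
    (hq : HasExp 2 1 q (fun p => a * p.1 ^ 2) q₁) (hq0 : ∀ p, 0 ≤ q p) :
    HasExp (-(2 * (k : ℤ) + 2)) 1 (fun p => heatMoment k (q p) p.2)
      (fun p => heatMoment k (a * p.1 ^ 2) p.2)
      (fun p => (-1 / 4 : ℝ) * (heatMoment (k + 1) (a * p.1 ^ 2) p.2 * q₁ p)) := by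
  obtain ⟨c, hc, hev⟩ := hq.eventually_le_add ha
  have hA : ∀ j : ℕ, ParaO (fun p => _root_.heatMoment j (a * p.1 ^ 2) p.2)
      (-(2 * (j : ℤ) + 2)) := fun j =>
    paraO_heatMoment j hc (hev.mono fun p h => ⟨by positivity, h.2⟩)
  have hQ : ∀ j : ℕ, ParaO (fun p => _root_.heatMoment j (q p) p.2) (-(2 * (j : ℤ) + 2)) :=
    fun j => paraO_heatMoment j hc (hev.mono fun p h => ⟨hq0 p, h.1⟩)
  set d := fun p => q p - a * p.1 ^ 2 with hd
  set g := fun p => q p - a * p.1 ^ 2 - q₁ p with hg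
  have hd3 : ParaO d 3 := hq.sub_lead
  have hg4 : ParaO g 4 := hq.rem
  have hg5 : ParaO (fun p => g (spaceFlip p) - g p) 5 :=
    hq.par.congr_all fun p => by simp [hg]
  set R := fun p => _root_.heatMoment k (q p) p.2 - (_root_.heatMoment k (a * p.1 ^ 2) p.2
    - d p / 4 * _root_.heatMoment (k + 1) (a * p.1 ^ 2) p.2
    + d p ^ 2 / 32 * _root_.heatMoment (k + 2) (a * p.1 ^ 2) p.2) with hR
  have hR3 : ParaO R (-(2 * (k : ℤ) + 2) + 3) := by
    have h1 : ParaO (fun p => d p * (d p * d p) *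
        (_root_.heatMoment (k + 3) (a * p.1 ^ 2) p.2 + _root_.heatMoment (k + 3) (q p) p.2))
        (-(2 * (k : ℤ) + 2) + 3) :=
      ((hd3.mul (hd3.mul hd3)).mul ((hA (k + 3)).add (hQ (k + 3)))).mono (by push_cast; linarith)
    refine IsBigO.trans (IsBigO.of_bound 1 ?_) h1
    filter_upwards [eventually_snd_pos] with p hp
    refine (abs_heatMoment_taylor_le k (a * p.1 ^ 2) (q p) hp).trans (le_of_eq ?_)
    have n1 := heatMoment_nonneg (k + 3) (a * p.1 ^ 2) hp
    have n2 := heatMoment_nonneg (k + 3) (q p) hp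
    rw [one_mul, Real.norm_eq_abs, abs_mul, abs_mul, abs_mul, abs_of_nonneg (add_nonneg n1 n2)]
    ring
  have hrem : ∀ p, _root_.heatMoment k (q p) p.2 - _root_.heatMoment k (a * p.1 ^ 2) p.2
      - (-1 / 4 : ℝ) * (_root_.heatMoment (k + 1) (a * p.1 ^ 2) p.2 * q₁ p)
      = (-1 / 4 : ℝ) • (_root_.heatMoment (k + 1) (a * p.1 ^ 2) p.2 * g p)
        + (1 / 32 : ℝ) • (_root_.heatMoment (k + 2) (a * p.1 ^ 2) p.2 * (d p * d p)) + R p := by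
    intro p
    simp only [hR, hg, hd, smul_eq_mul]
    ring
  have hflip : ∀ p, q₁ (spaceFlip p) = -q₁ p := fun p => by simpa using hq.next_flip p
  have hflipA : ∀ (j : ℕ) p, _root_.heatMoment j (a * (spaceFlip p).1 ^ 2) (spaceFlip p).2
      = _root_.heatMoment j (a * p.1 ^ 2) p.2 := fun j p => by simp [spaceFlip]
  refine ⟨hA k, ?_, ?_, ?_, ?_, ?_⟩
  · exact ((hA (k + 1)).mul hq.next).const_smul (-1 / 4) |>.mono (by push_cast; linarith)
  · refine ParaO.congr_all ?_ hrem
    refine ParaO.add (ParaO.add ?_ ?_) (hR3.mono (by linarith))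
    · exact ((hA (k + 1)).mul hg4).const_smul (-1 / 4) |>.mono (by push_cast; linarith)
    · exact ((hA (k + 2)).mul (hd3.mul hd3)).const_smul (1 / 32) |>.mono (by push_cast; linarith)
  -- The difference of `d²` at reflected points factors as `(d∘flip - d)(d∘flip + d)`. As `q₁` is
  -- odd, the second factor is `g∘flip + g`, which is of order 4 rather than 3.
  · have h1 : ParaO (fun p => (-1 / 4 : ℝ) • (_root_.heatMoment (k + 1) (a * p.1 ^ 2) p.2
          * (g (spaceFlip p) - g p))
        + (1 / 32 : ℝ) • (_root_.heatMoment (k + 2) (a * p.1 ^ 2) p.2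
          * ((d (spaceFlip p) - d p) * (g (spaceFlip p) + g p)))
        + (R (spaceFlip p) - R p)) (-(2 * (k : ℤ) + 2) + 3) := by
      refine ParaO.add (ParaO.add ?_ ?_) (hR3.flip.sub hR3)
      · exact ((hA (k + 1)).mul hg5).const_smul (-1 / 4) |>.mono (by push_cast; linarith)
      · exact ((hA (k + 2)).mul ((hd3.flip.sub hd3).mul (hg4.flip.add hg4))).const_smul (1 / 32)
          |>.mono (by push_cast; linarith)
    refine h1.congr_all fun p => ?_
    rw [hrem p, hrem (spaceFlip p), hflipA, hflipA, one_smul]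
    have e1 : ∀ p, d p = q₁ p + g p := fun p => by simp [hg, hd]
    rw [e1, e1, hflip]
    simp only [smul_eq_mul]
    ring
  · intro p
    simp only [hflipA, one_smul]
  · intro p
    simp only [hflipA, one_smul, hflip]
    ring

end HasExp

/-! ### Taylor expansion on the space-time strip -/

section StripCalculus

variable {E : Type*} [NormedAddCommGroup E] [NormedSpace ℝ E]

/-- The space-time strip of parameters `(θ, τ)` with `0 ≤ τ ≤ T`. -/
def strip (T : ℝ) : Set (ℝ × ℝ) := univ ×ˢ Icc 0 T

theorem mem_strip {T : ℝ} {p : ℝ × ℝ} : p ∈ strip T ↔ p.2 ∈ Icc 0 T := by simp [strip]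

theorem uniqueDiffOn_strip {T : ℝ} (hT : 0 < T) : UniqueDiffOn ℝ (strip T) :=
  uniqueDiffOn_univ.prod (uniqueDiffOn_Icc hT)

/-- The derivative in the curve parameter of a function on the strip. -/
def angDeriv (T : ℝ) (f : ℝ × ℝ → E) (p : ℝ × ℝ) : E := fderivWithin ℝ f (strip T) p (1, 0)

/-- The derivative in time of a function on the strip. -/
def timeDeriv (T : ℝ) (f : ℝ × ℝ → E) (p : ℝ × ℝ) : E := fderivWithin ℝ f (strip T) p (0, 1)

variable {T : ℝ} {f : ℝ × ℝ → E}

theorem contDiffOn_angDeriv (hT : 0 < T) (hf : ContDiffOn ℝ ∞ f (strip T)) :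
    ContDiffOn ℝ ∞ (angDeriv T f) (strip T) :=
  (hf.fderivWithin (m := ∞) (uniqueDiffOn_strip hT) (by simp)).clm_apply contDiffOn_const

theorem contDiffOn_timeDeriv (hT : 0 < T) (hf : ContDiffOn ℝ ∞ f (strip T)) :
    ContDiffOn ℝ ∞ (timeDeriv T f) (strip T) :=
  (hf.fderivWithin (m := ∞) (uniqueDiffOn_strip hT) (by simp)).clm_apply contDiffOn_const

theorem hasFDerivWithinAt_strip (hf : ContDiffOn ℝ ∞ f (strip T)) {p : ℝ × ℝ}
    (hp : p.2 ∈ Icc 0 T) : HasFDerivWithinAt f (fderivWithin ℝ f (strip T) p) (strip T) p :=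
  (hf.differentiableOn (by simp) p (mem_strip.2 hp)).hasFDerivWithinAt

theorem hasDerivAt_angDeriv (hf : ContDiffOn ℝ ∞ f (strip T)) {τ : ℝ} (hτ : τ ∈ Icc 0 T) (θ : ℝ) :
    HasDerivAt (fun θ' => f (θ', τ)) (angDeriv T f (θ, τ)) θ := by
  rw [← hasDerivWithinAt_univ]
  exact (hasFDerivWithinAt_strip hf (p := (θ, τ)) hτ).comp_hasDerivWithinAt θ
    (((hasDerivAt_id θ).prodMk (hasDerivAt_const θ τ)).hasDerivWithinAt)
    (fun _ _ => mem_strip.2 hτ)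

theorem hasDerivWithinAt_timeDeriv (hf : ContDiffOn ℝ ∞ f (strip T)) {τ : ℝ} (hτ : τ ∈ Icc 0 T)
    (θ : ℝ) : HasDerivWithinAt (fun τ' => f (θ, τ')) (timeDeriv T f (θ, τ)) (Icc 0 T) τ :=
  (hasFDerivWithinAt_strip hf (p := (θ, τ)) hτ).comp_hasDerivWithinAt τ
    (((hasDerivAt_const τ θ).prodMk (hasDerivAt_id τ)).hasDerivWithinAt)
    (fun _ h => mem_strip.2 h)

/-- A function on the strip, in terms of the displacement `s` from `θ` and the time `σ` elapsed
before `t`. -/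
def recenter (θ t : ℝ) (f : ℝ × ℝ → E) (p : ℝ × ℝ) : E := f (θ + p.1, t - p.2)

variable {θ t : ℝ}

theorem hasDerivAt_recenter (hf : ContDiffOn ℝ ∞ f (strip T)) (ht : t ∈ Ioc 0 T) {p : ℝ × ℝ}
    (h0 : 0 < p.2) (h1 : p.2 < t) :
    HasDerivAt (fun s => recenter θ t f (s, p.2)) (recenter θ t (angDeriv T f) p) p.1 := by
  have h := hasDerivAt_angDeriv hf (τ := t - p.2) ⟨by linarith, by linarith [ht.2]⟩ (θ + p.1)
  simpa [recenter] using HasDerivAt.comp_const_add θ p.1 h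

theorem paraO_recenter_sub (hf : ContDiffOn ℝ ∞ f (strip T)) (ht : t ∈ Ioc 0 T) :
    ParaO (fun p => recenter θ t f p - f (θ, t)) 1 := by
  have hd := (hf.differentiableOn (by simp) (θ, t) (mem_strip.2 ⟨ht.1.le, ht.2⟩)).isBigO_sub
  have htend : Tendsto (fun p : ℝ × ℝ => (θ + p.1, t - p.2)) paraFilter (𝓝[strip T] (θ, t)) := by
    apply tendsto_nhdsWithin_of_tendsto_nhds_of_eventually_within
    · have : Continuous fun p : ℝ × ℝ => (θ + p.1, t - p.2) := by fun_prop
      have := this.tendsto 0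
      simp only [Prod.fst_zero, Prod.snd_zero, add_zero, sub_zero] at this
      exact this.mono_left nhdsWithin_le_nhds
    · exact eventually_paraFilter.2 ⟨t, ht.1, fun p _ h2 h3 =>
        mem_strip.2 ⟨by simp; linarith, by simp; linarith [ht.2]⟩⟩
  refine (hd.comp_tendsto htend).trans ?_
  have : ParaO (fun p : ℝ × ℝ => ((p.1, -p.2) : ℝ × ℝ)) 1 := by
    have h1 := paraO_fst
    have h2 := paraO_snd.mono (w' := 1) (by norm_num)
    exact IsBigO.prod_left h1 (IsBigO.neg_left h2)
  exact this.congr_all fun p => by simp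

theorem paraO_recenter_time (hf : ContDiffOn ℝ ∞ f (strip T)) (ht : t ∈ Ioc 0 T) :
    ParaO (fun p : ℝ × ℝ => recenter θ t f (0, p.2) - f (θ, t)) 2 := by
  have h1 : Tendsto (fun p : ℝ × ℝ => t - p.2) paraFilter (𝓝[Icc 0 T] t) := by
    apply tendsto_nhdsWithin_of_tendsto_nhds_of_eventually_within
    · have : Continuous fun p : ℝ × ℝ => t - p.2 := by fun_prop
      have := this.tendsto 0
      simp only [Prod.snd_zero, sub_zero] at this
      exact this.mono_left nhdsWithin_le_nhds
    · exact eventually_paraFilter.2 ⟨t, ht.1, fun p _ h2 h3 => ⟨by linarith, by linarith [ht.2]⟩⟩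
  have h := (hasDerivWithinAt_timeDeriv hf ⟨ht.1.le, ht.2⟩ θ).differentiableWithinAt.isBigO_sub
  have h2 := (h.comp_tendsto h1).trans
    ((IsBigO.neg_left paraO_snd).congr_left fun p => by simp : ParaO (fun p : ℝ × ℝ => t - p.2 - t) 2)
  exact h2.congr_left fun p => by simp [recenter]

/-- Time enters with weight 2, so a first-order Taylor polynomial in `σ` alone leaves order 4. This
supplies the values on `s = 0` from which expansions are integrated in `s`. -/
theorem paraO_recenter_time_two (hT : 0 < T) (hf : ContDiffOn ℝ ∞ f (strip T)) (ht : t ∈ Ioc 0 T) :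
    ParaO (fun p : ℝ × ℝ => recenter θ t f (0, p.2) - f (θ, t) + p.2 • timeDeriv T f (θ, t)) 4 := by
  obtain ⟨C, hC, r, hr, h⟩ := (paraO_recenter_time (θ := θ) (contDiffOn_timeDeriv hT hf) ht).exists_bound
  refine IsBigO.of_bound C (eventually_paraFilter.2 ⟨min r t, lt_min hr ht.1, ?_⟩)
  intro p h1 h2 h3
  rw [lt_min_iff] at h1 h3
  have hmaps : MapsTo (fun σ => t - σ) (Icc 0 p.2) (Icc 0 T) := fun σ hσ =>
    ⟨by linarith [hσ.2], by linarith [hσ.1, ht.2]⟩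
  have hder : ∀ σ ∈ Icc 0 p.2, HasDerivWithinAt (fun σ => f (θ, t - σ) + σ • timeDeriv T f (θ, t))
      (-timeDeriv T f (θ, t - σ) + timeDeriv T f (θ, t)) (Icc 0 p.2) σ := by
    intro σ hσ
    have e1 := (hasDerivWithinAt_timeDeriv hf (hmaps hσ) θ).scomp σ
      ((hasDerivAt_id σ).const_sub t).hasDerivWithinAt hmaps
    have e2 := ((hasDerivAt_id σ).smul_const (timeDeriv T f (θ, t))).hasDerivWithinAt
      (s := Icc 0 p.2)
    simpa [Function.comp_def] using e1.fun_add e2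
  have hb : ∀ σ ∈ Ico 0 p.2, ‖-timeDeriv T f (θ, t - σ) + timeDeriv T f (θ, t)‖ ≤ C * p.2 := by
    intro σ hσ
    -- Parabolic bounds speak only of `σ > 0`; at `σ = 0` the difference vanishes.
    rcases hσ.1.eq_or_lt with rfl | h0
    · simpa using by positivity
    have := h (0, σ) (by simpa using hr) h0 (hσ.2.trans h3.1)
    simp only [recenter, add_zero] at this
    rw [zpow_ofNat, paraSize_sq h0] at this
    rw [neg_add_eq_sub, norm_sub_rev]
    refine this.trans ?_
    simp only [ne_eq, OfNat.ofNat_ne_zero, not_false_eq_true, zero_pow, zero_add]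
    gcongr
    exact hσ.2.le
  have := norm_image_sub_le_of_norm_deriv_le_segment' hder hb p.2 ⟨h2.le, le_rfl⟩
  simp only [recenter, add_zero, sub_zero, zero_smul] at this ⊢
  rw [sub_add_eq_add_sub]
  refine this.trans ?_
  have h5 := snd_le_paraSize_sq h2
  rw [mul_assoc, zpow_ofNat, Real.norm_of_nonneg (pow_nonneg (paraSize_nonneg _) _)]
  have e : paraSize p ^ 4 = paraSize p ^ 2 * paraSize p ^ 2 := by ring
  rw [e]
  gcongr

/-- Integration in `s` raises the order by one, so the expansion follows from that of the angular
derivative. For the parity, the odd part of the remainder vanishes at `s = 0` and its derivative is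
the symmetrized remainder of the angular derivative, of order 2. -/
theorem hasExp_recenter (hT : 0 < T) (hf : ContDiffOn ℝ ∞ f (strip T)) (ht : t ∈ Ioc 0 T) :
    HasExp 0 1 (recenter θ t f) (fun _ => f (θ, t)) (fun p => p.1 • angDeriv T f (θ, t)) := by
  have hrem : ∀ {g : ℝ × ℝ → E}, ContDiffOn ℝ ∞ g (strip T) →
      ParaO (fun p => recenter θ t g p - g (θ, t) - p.1 • angDeriv T g (θ, t)) 2 := by
    intro g hg
    refine ParaO.of_hasDerivAt (n := 1) (δ := t) ht.1
      (g' := fun p => recenter θ t (angDeriv T g) p - angDeriv T g (θ, t)) (fun p h0 h1 => ?_) ?_ ?_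
    · have e2 := (hasDerivAt_id p.1).smul_const (angDeriv T g (θ, t))
      simpa using ((hasDerivAt_recenter hg ht h0 h1).sub_const _).fun_sub e2
    · exact paraO_recenter_sub (contDiffOn_angDeriv hT hg) ht
    · exact (paraO_recenter_time (θ := θ) hg ht).congr_all fun p => by simp
  refine ⟨paraO_const _, ?_, hrem hf, ?_, by simp, by simp [spaceFlip]⟩
  · exact (paraO_fst.smul (paraO_const _)).mono (by norm_num)
  · have h1 : ParaO (fun p => recenter θ t f (spaceFlip p) - recenter θ t f p
        + (2 * p.1) • angDeriv T f (θ, t)) 3 := by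
      refine ParaO.of_hasDerivAt (n := 2) (δ := t) ht.1
        (g' := fun p => -recenter θ t (angDeriv T f) (spaceFlip p) - recenter θ t (angDeriv T f) p
          + (2 : ℝ) • angDeriv T f (θ, t)) (fun p h0 h1 => ?_) ?_ ?_
      · have e1 := hasDerivAt_recenter (θ := θ) hf ht (p := p) h0 h1
        have e2 : HasDerivAt (fun s => recenter θ t f (-s, p.2))
            ((-1 : ℝ) • recenter θ t (angDeriv T f) (spaceFlip p)) p.1 :=
          (hasDerivAt_recenter (θ := θ) hf ht (p := spaceFlip p) h0 h1).scomp p.1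
            (hasDerivAt_neg' p.1)
        have e3 := ((hasDerivAt_id p.1).const_mul 2).smul_const (angDeriv T f (θ, t))
        simpa [spaceFlip] using (e2.fun_sub e1).fun_add e3
      · have h2 := hrem (contDiffOn_angDeriv hT hf)
        refine ((h2.add h2.flip).const_smul (-1)).congr_all fun p => ?_
        simp only [spaceFlip]
        module
      · exact (paraO_zero _).congr_all fun p => by simp [spaceFlip]
    refine h1.congr_all fun p => ?_
    simp only [spaceFlip]
    module

/-- The displacement from source to target needs one more Taylor order, because it starts at order
1. The time derivative appears with a plus sign since elapsed time runs backwards. -/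
theorem hasExp_sub_recenter (hT : 0 < T) (hf : ContDiffOn ℝ ∞ f (strip T)) (ht : t ∈ Ioc 0 T) :
    HasExp 1 (-1) (fun p => f (θ, t) - recenter θ t f p) (fun p => -(p.1 • angDeriv T f (θ, t)))
      (fun p => p.2 • timeDeriv T f (θ, t)
        - (p.1 ^ 2 / 2) • angDeriv T (angDeriv T f) (θ, t)) := by
  have hf' := contDiffOn_angDeriv hT hf
  have hexp := hasExp_recenter (θ := θ) hT hf' ht
  have htime := paraO_recenter_time_two (θ := θ) hT hf ht
  set G : ℝ × ℝ → E := fun p => recenter θ t f p - f (θ, t) - p.1 • angDeriv T f (θ, t)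
    + p.2 • timeDeriv T f (θ, t) - (p.1 ^ 2 / 2) • angDeriv T (angDeriv T f) (θ, t) with hG
  set G' : ℝ × ℝ → E := fun p => recenter θ t (angDeriv T f) p - angDeriv T f (θ, t)
    - p.1 • angDeriv T (angDeriv T f) (θ, t) with hG'
  have hder : ∀ p : ℝ × ℝ, 0 < p.2 → p.2 < t → HasDerivAt (fun s => G (s, p.2)) (G' p) p.1 := by
    intro p h0 h1
    have e1 := hasDerivAt_recenter (θ := θ) hf ht (p := p) h0 h1
    have e2 := (hasDerivAt_id p.1).smul_const (angDeriv T f (θ, t))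
    have e3 := ((hasDerivAt_pow 2 p.1).div_const 2).smul_const (angDeriv T (angDeriv T f) (θ, t))
    have := (((e1.sub_const (f (θ, t))).fun_sub e2).add_const (p.2 • timeDeriv T f (θ, t))).fun_sub e3
    simpa [hG, hG'] using this
  have hG3 : ParaO G 3 := by
    refine ParaO.of_hasDerivAt (n := 2) (δ := t) ht.1 hder hexp.rem ?_
    exact (htime.mono (by norm_num)).congr_all fun p => by simp [hG]
  -- The derivative of `G(s) + G(-s)` is the odd part of `G'`, up to a factor, and has order 3 by
  -- the parity of the expansion of the angular derivative; at `s = 0` the time expansion gives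
  -- order 4.
  have hGe : ParaO (fun p => G (spaceFlip p) + G p) 4 := by
    refine ParaO.of_hasDerivAt (n := 3) (δ := t) ht.1
      (g' := fun p => -G' (spaceFlip p) + G' p) (fun p h0 h1 => ?_) ?_ ?_
    · have e2 : HasDerivAt (fun s => G (-s, p.2)) ((-1 : ℝ) • G' (spaceFlip p)) p.1 :=
        (hder (spaceFlip p) h0 h1).scomp p.1 (hasDerivAt_neg' p.1)
      simpa [spaceFlip] using e2.fun_add (hder p h0 h1)
    · refine (hexp.par.const_smul (-1)).congr_all fun p => ?_
      simp only [hG']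
      module
    · refine ((htime.mono (w' := 4) (by norm_num)).const_smul 2).congr_all fun p => ?_
      simp [hG, spaceFlip]
      module
  refine ⟨?_, ?_, ?_, ?_, ?_, ?_⟩
  · exact ((paraO_fst.smul (paraO_const (angDeriv T f (θ, t)))).const_smul (-1)).congr_all
      fun p => by module
  · have h2 := (paraO_fst.mul paraO_fst).smul (paraO_const (angDeriv T (angDeriv T f) (θ, t)))
    refine ((paraO_snd.smul (paraO_const (timeDeriv T f (θ, t)))).sub
      (h2.const_smul (1 / 2))).congr_all fun p => by module
  · exact (hG3.const_smul (-1)).congr_all fun p => by simp only [hG]; module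
  · refine (hGe.const_smul (-1)).congr_all fun p => ?_
    simp only [hG, spaceFlip]
    module
  · intro p; simp [spaceFlip]
  · intro p; simp [spaceFlip]

end StripCalculus

theorem HasExp.congr {E : Type*} [NormedAddCommGroup E] [NormedSpace ℝ E] {w : ℤ} {e : ℝ}
    {f f₀ f₁ g g₀ g₁ : ℝ × ℝ → E} (hf : HasExp w e f f₀ f₁) (h : ∀ p, g p = f p)
    (h₀ : ∀ p, g₀ p = f₀ p) (h₁ : ∀ p, g₁ p = f₁ p) : HasExp w e g g₀ g₁ := by
  obtain rfl : g = f := funext h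
  obtain rfl : g₀ = f₀ := funext h₀
  obtain rfl : g₁ = f₁ := funext h₁
  exact hf

/-! ### Expansion of the layer density -/

/-- The function `H₁ (s² u₁ + σ u₂) + H₂ (s⁴ u₃ + s² σ u₄) + H₃ (s⁶ u₅ + s⁴ σ u₆)`, where
`Hₖ` is the heat moment at `a s²`. -/
def evenProfile (a : ℝ) (u₁ u₂ u₃ u₄ u₅ u₆ : Plane) (p : ℝ × ℝ) : Plane :=
  heatMoment 1 (a * p.1 ^ 2) p.2 • (p.1 ^ 2 • u₁ + p.2 • u₂)
    + heatMoment 2 (a * p.1 ^ 2) p.2 • (p.1 ^ 4 • u₃ + (p.1 ^ 2 * p.2) • u₄)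
    + heatMoment 3 (a * p.1 ^ 2) p.2 • (p.1 ^ 6 • u₅ + (p.1 ^ 4 * p.2) • u₆)

section LayerExpansion

variable {N r φ : ℝ × ℝ → Plane} {N₀ N' X' V A φ₀ φ' : Plane}

theorem hasExp_normSq
    (hr : HasExp 1 (-1) r (fun p => -(p.1 • X')) (fun p => p.2 • V - (p.1 ^ 2 / 2) • A)) :
    HasExp 2 1 (fun p => ⟪r p, r p⟫) (fun p => ⟪X', X'⟫ * p.1 ^ 2)
      (fun p => p.1 ^ 3 * ⟪X', A⟫ - 2 * (p.1 * p.2) * ⟪X', V⟫) := by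
  refine ((hr.inner hr).congr_index (w' := 2) (e' := 1) (by norm_num) (by norm_num)).congr
    (fun _ => rfl) (fun p => ?_) (fun p => ?_)
  · simp only [inner_neg_left, inner_neg_right, real_inner_smul_left, real_inner_smul_right]
    ring
  · simp only [inner_neg_left, inner_neg_right, inner_sub_left, inner_sub_right,
      real_inner_smul_left, real_inner_smul_right]
    rw [real_inner_comm X' V, real_inner_comm X' A]
    ring

/-- Multiplication of the expansions. Orthogonality of `N₀` and `X'` raises the order of `⟪n, r⟫`
from 1 to 2, which removes its terms from the leading part. `H₃` enters only through the variation
of `H₂` with `q`. -/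
theorem hasExp_layerDensity (hX : X' ≠ 0) (hperp : ⟪N₀, X'⟫ = 0)
    (hN : HasExp 0 1 N (fun _ => N₀) (fun p => p.1 • N'))
    (hr : HasExp 1 (-1) r (fun p => -(p.1 • X')) (fun p => p.2 • V - (p.1 ^ 2 / 2) • A))
    (hφ : HasExp 0 1 φ (fun _ => φ₀) (fun p => p.1 • φ')) :
    HasExp (-3) (-1) (fun p => layerDensity (N p) (r p) (φ p) p.2)
      (fun p => heatMoment 1 (⟪X', X'⟫ * p.1 ^ 2) p.2 •
          (-p.1) • (⟪X', φ₀⟫ • N₀ - ⟪N₀, φ₀⟫ • X')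
        + heatMoment 2 (⟪X', X'⟫ * p.1 ^ 2) p.2 • (⟪X', X'⟫ / 4 * p.1 ^ 3) • ⟪X', φ₀⟫ • N₀)
      (evenProfile ⟪X', X'⟫
        ((-⟪A, φ₀⟫ / 2 - ⟪X', φ'⟫) • N₀ - ⟪X', φ₀⟫ • N' + (⟪N₀, φ₀⟫ / 2) • A
          + (⟪N', φ₀⟫ + ⟪N₀, φ'⟫) • X' + (-⟪N₀, A⟫ / 2 - ⟪N', X'⟫) • φ₀)
        (⟪V, φ₀⟫ • N₀ - ⟪N₀, φ₀⟫ • V + ⟪N₀, V⟫ • φ₀)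
        ((⟪X', A⟫ / 4) • (⟪X', φ₀⟫ • N₀ - ⟪N₀, φ₀⟫ • X')
          + ((-⟪N₀, A⟫ / 2 - ⟪N', X'⟫) / 2 * ⟪X', φ₀⟫) • X' + (⟪X', A⟫ / 4 * ⟪X', φ₀⟫) • N₀
          - (⟪X', X'⟫ / 4) • ((-⟪A, φ₀⟫ / 2 - ⟪X', φ'⟫) • N₀ - ⟪X', φ₀⟫ • N'
            + (-⟪N₀, A⟫ / 2 - ⟪N', X'⟫) • φ₀))
        ((-⟪X', V⟫ / 2) • (⟪X', φ₀⟫ • N₀ - ⟪N₀, φ₀⟫ • X') + (⟪N₀, V⟫ / 2 * ⟪X', φ₀⟫) • X'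
          - (⟪X', V⟫ / 2 * ⟪X', φ₀⟫) • N₀ - (⟪X', X'⟫ / 4) • (⟪V, φ₀⟫ • N₀ + ⟪N₀, V⟫ • φ₀))
        ((-⟪X', X'⟫ / 16 * ⟪X', φ₀⟫ * ⟪X', A⟫) • N₀)
        ((⟪X', X'⟫ / 8 * ⟪X', φ₀⟫ * ⟪X', V⟫) • N₀)) := by
  have ha : 0 < ⟪X', X'⟫ := real_inner_self_pos.2 hX
  have hq := hasExp_normSq hr
  have hH := fun k => hq.heatMoment k ha fun p => real_inner_self_nonneg
  have hrφ := (hr.inner hφ).congr_index (w' := 1) (e' := -1) (by norm_num) (by norm_num)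
  have hNφ := (hN.inner hφ).congr_index (w' := 0) (e' := 1) (by norm_num) (by norm_num)
  have hNr := (hN.inner hr).congr_index (w' := 1) (e' := -1) (by norm_num) (by norm_num)
  have t1 := (hrφ.smul hN).congr_index (w' := 1) (e' := -1) (by norm_num) (by norm_num)
  have t2 := (hNφ.smul hr).congr_index (w' := 1) (e' := -1) (by norm_num) (by norm_num)
  have t3 := (hNr.smul hφ).congr_index (w' := 1) (e' := -1) (by norm_num) (by norm_num)
  have b1 := ((hH 1).smul ((t1.sub t2).add t3)).congr_index (w' := -3) (e' := -1) (by norm_num)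
    (by norm_num)
  have t4 := (hNr.smul (hrφ.smul hr)).congr_index (w' := 3) (e' := -1) (by norm_num) (by norm_num)
  have t5 := (hq.smul (t1.add t3)).congr_index (w' := 3) (e' := -1) (by norm_num) (by norm_num)
  have b2 := ((hH 2).smul ((t4.const_smul (1 / 2)).sub (t5.const_smul (1 / 4)))).congr_index
    (w' := -3) (e' := -1) (by norm_num) (by norm_num)
  refine (b1.add b2).congr (fun p => rfl) (fun p => ?_) (fun p => ?_)
  · simp only [inner_neg_left, inner_neg_right, real_inner_smul_left, real_inner_smul_right, hperp]
    module
  · simp only [evenProfile, inner_neg_left, inner_neg_right, inner_sub_left, inner_sub_right,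
      real_inner_smul_left, real_inner_smul_right, hperp, Nat.reduceAdd]
    module

/-- When `Y` is the derivative of the curve, `-2⟪r, Y⟫` is `dq/ds`. To leading order `q = a s²` and
`q' = 2as`, hence `-s = -q'/(2a)` and `a s³/4 = q q'/(8a)`: the leading term is matched by multiples
of `H₁(q) q'` and `H₂(q) q q'`, exact derivatives of functions of `q`. -/
theorem paraO_layerDensity_sub (hX : X' ≠ 0) (hperp : ⟪N₀, X'⟫ = 0) {Y : ℝ × ℝ → Plane}
    (hN : HasExp 0 1 N (fun _ => N₀) (fun p => p.1 • N'))
    (hr : HasExp 1 (-1) r (fun p => -(p.1 • X')) (fun p => p.2 • V - (p.1 ^ 2 / 2) • A))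
    (hY : HasExp 0 1 Y (fun _ => X') (fun p => p.1 • A))
    (hφ : HasExp 0 1 φ (fun _ => φ₀) (fun p => p.1 • φ')) :
    ParaO (fun p => layerDensity (N p) (r p) (φ p) p.2
      - ((heatMoment 1 ⟪r p, r p⟫ p.2 * (-2 * ⟪r p, Y p⟫)) •
          (-1 / (2 * ⟪X', X'⟫)) • (⟪X', φ₀⟫ • N₀ - ⟪N₀, φ₀⟫ • X')
        + (heatMoment 2 ⟪r p, r p⟫ p.2 * ⟪r p, r p⟫ * (-2 * ⟪r p, Y p⟫)) •
          (1 / (8 * ⟪X', X'⟫)) • ⟪X', φ₀⟫ • N₀)) (-2) := by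
  have ha : 0 < ⟪X', X'⟫ := real_inner_self_pos.2 hX
  have hq := hasExp_normSq hr
  have hH := fun k => hq.heatMoment k ha fun p => real_inner_self_nonneg
  have hrY := ((hr.inner hY).const_smul (-2)).congr_index (w' := 1) (e' := -1) (by norm_num)
    (by norm_num)
  have hc : ∀ W : Plane, HasExp 0 1 (fun _ : ℝ × ℝ => W) (fun _ => W) (fun _ => 0) := fun W =>
    ⟨paraO_const _, paraO_zero _, (paraO_zero _).congr_all fun p => by simp,
      (paraO_zero _).congr_all fun p => by simp, by simp, by simp⟩
  have b1 := (((hH 1).smul hrY).smul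
    (hc ((-1 / (2 * ⟪X', X'⟫)) • (⟪X', φ₀⟫ • N₀ - ⟪N₀, φ₀⟫ • X')))).congr_index
    (w' := -3) (e' := -1) (by norm_num) (by norm_num)
  have b2 := ((((hH 2).smul hq).smul hrY).smul
    (hc ((1 / (8 * ⟪X', X'⟫)) • ⟪X', φ₀⟫ • N₀))).congr_index
    (w' := -3) (e' := -1) (by norm_num) (by norm_num)
  have h := ((hasExp_layerDensity hX hperp hN hr hφ).sub (b1.add b2)).sub_lead
  refine h.congr_all fun p => ?_
  simp only [smul_eq_mul, inner_neg_left, real_inner_smul_left]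
  match_scalars <;> field_simp <;> ring

end LayerExpansion

/-! ### Integrals of the even profile over the line -/

theorem integrable_pow_mul_gaussian (j : ℕ) {c : ℝ} (hc : 0 < c) :
    Integrable fun s : ℝ => s ^ (2 * j) * Real.exp (-(c * s ^ 2)) := by
  have := integrable_rpow_mul_exp_neg_mul_sq hc (s := ((2 * j : ℕ) : ℝ))
    (lt_of_lt_of_le (by norm_num) (Nat.cast_nonneg _))
  simpa only [Real.rpow_natCast, neg_mul] using this

theorem integral_pow_mul_gaussian (j : ℕ) {c : ℝ} (hc : 0 < c) :
    ∫ s : ℝ, s ^ (2 * j) * Real.exp (-(c * s ^ 2))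
      = Real.Gamma (j + 1 / 2) * c ^ (-((j : ℝ) + 1 / 2)) := by
  have h1 := integral_comp_abs (f := fun s : ℝ => s ^ (2 * j) * Real.exp (-(c * s ^ 2)))
  simp only [sq_abs, pow_mul] at h1 ⊢
  rw [h1]
  have h2 := integral_rpow_mul_exp_neg_mul_rpow (p := 2) (q := ((2 * j : ℕ) : ℝ)) two_pos
    (lt_of_lt_of_le (by norm_num) (Nat.cast_nonneg _)) hc
  simp only [Real.rpow_natCast, pow_mul, Real.rpow_ofNat, neg_mul] at h2
  rw [h2]
  have e1 : (((2 * j : ℕ) : ℝ) + 1) / 2 = j + 1 / 2 := by push_cast; ring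
  have e2 : -(((2 * j : ℕ) : ℝ) + 1) / 2 = -((j : ℝ) + 1 / 2) := by push_cast; ring
  rw [e1, e2]
  ring

/-- By Fubini, the Gaussian integral in `s` comes first and leaves `u^(k - j - 1/2)`, integrable on
`(0, 1]` because `j ≤ k`. -/
theorem integral_pow_mul_expMoment {k j : ℕ} (hj : j ≤ k) {b : ℝ} (hb : 0 < b) :
    Integrable (fun s : ℝ => s ^ (2 * j) * expMoment k (b * s ^ 2)) ∧
    ∫ s : ℝ, s ^ (2 * j) * expMoment k (b * s ^ 2)
      = Real.Gamma (j + 1 / 2) * b ^ (-((j : ℝ) + 1 / 2)) / ((k : ℝ) - j + 1 / 2) := by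
  set G : ℝ → ℝ → ℝ := fun s u => s ^ (2 * j) * (u ^ k * Real.exp (-(b * s ^ 2 * u))) with hG
  set ν : Measure ℝ := volume.restrict (Ioc 0 1) with hν
  have hjk : (j : ℝ) ≤ k := Nat.cast_le.2 hj
  have hGu : ∀ u s, G s u = u ^ k * (s ^ (2 * j) * Real.exp (-(b * u * s ^ 2))) := by
    intro u s
    simp only [hG]
    rw [show b * s ^ 2 * u = b * u * s ^ 2 by ring]
    ring
  have hslice : ∀ u ∈ Ioc (0 : ℝ) 1, ∫ s, G s u
      = Real.Gamma (j + 1 / 2) * b ^ (-((j : ℝ) + 1 / 2)) * u ^ ((k : ℝ) - j - 1 / 2) := by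
    intro u hu
    simp only [hGu]
    rw [integral_const_mul, integral_pow_mul_gaussian j (mul_pos hb hu.1),
      Real.mul_rpow hb.le hu.1.le, show (k : ℝ) - j - 1 / 2 = k + -((j : ℝ) + 1 / 2) by ring,
      Real.rpow_add hu.1, Real.rpow_natCast]
    ring
  have hnonneg : ∀ u ∈ Ioc (0 : ℝ) 1, ∀ s, 0 ≤ G s u := by
    intro u hu s
    have := hu.1
    simp only [hG, pow_mul]
    positivity
  have hpow : Integrable (fun u : ℝ => u ^ ((k : ℝ) - j - 1 / 2)) ν := by
    have := intervalIntegral.intervalIntegrable_rpow' (a := 0) (b := 1)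
      (r := (k : ℝ) - j - 1 / 2) (by linarith)
    exact (intervalIntegrable_iff_integrableOn_Ioc_of_le zero_le_one).1 this
  have hint : Integrable (Function.uncurry G) ((volume : Measure ℝ).prod ν) := by
    have hm : AEStronglyMeasurable (Function.uncurry G) ((volume : Measure ℝ).prod ν) := by
      apply Continuous.aestronglyMeasurable
      simp only [hG, Function.uncurry_def]
      fun_prop
    rw [integrable_prod_iff' hm]
    constructor
    · refine (ae_restrict_mem measurableSet_Ioc).mono fun u hu => ?_
      simp only [Function.uncurry_apply_pair, hGu]
      exact (integrable_pow_mul_gaussian j (mul_pos hb hu.1)).const_mul _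
    · refine (hpow.const_mul (Real.Gamma (j + 1 / 2) * b ^ (-((j : ℝ) + 1 / 2)))).congr ?_
      refine (ae_restrict_mem measurableSet_Ioc).mono fun u hu => ?_
      simp only [Function.uncurry_apply_pair]
      rw [← hslice u hu]
      refine integral_congr_ae (ae_of_all _ fun s => ?_)
      exact (Real.norm_of_nonneg (hnonneg u hu s)).symm
  have hinner : ∀ s, ∫ u, G s u ∂ν = s ^ (2 * j) * expMoment k (b * s ^ 2) := by
    intro s
    simp only [hG, expMoment]
    rw [integral_const_mul, intervalIntegral.integral_of_le zero_le_one]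
  constructor
  · have := hint.integral_prod_left
    simpa only [Function.uncurry_apply_pair, hinner] using this
  · have := integral_integral_swap hint
    simp only [hinner] at this
    rw [this, setIntegral_congr_fun measurableSet_Ioc hslice, integral_const_mul,
      ← intervalIntegral.integral_of_le zero_le_one, integral_rpow (Or.inl (by linarith)),
      Real.one_rpow, Real.zero_rpow (by linarith)]
    rw [show (k : ℝ) - j - 1 / 2 + 1 = k - j + 1 / 2 by ring]
    ring

/-- The integral of `s²ʲ Hₖ(a s², 1)` over the line. -/
def lineMoment (k j : ℕ) (a : ℝ) : ℝ :=
  Real.Gamma (j + 1 / 2) * ((4 / a) ^ j * (2 / Real.sqrt a)) / ((k : ℝ) - j + 1 / 2)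

/-- The condition `j + i = k` makes the integrand parabolically homogeneous of degree -2, so its
integral over the line scales exactly as `σ^{-1/2}`. -/
theorem integral_pow_mul_heatMoment {k j i : ℕ} (hj : j + i = k) {a σ : ℝ} (ha : 0 < a)
    (hσ : 0 < σ) :
    Integrable (fun s : ℝ => σ ^ i * s ^ (2 * j) * heatMoment k (a * s ^ 2) σ) ∧
    ∫ s : ℝ, σ ^ i * s ^ (2 * j) * heatMoment k (a * s ^ 2) σ
      = lineMoment k j a * (Real.sqrt σ)⁻¹ := by
  have hb : 0 < a / (4 * σ) := by positivity
  obtain ⟨h1, h2⟩ := integral_pow_mul_expMoment (k := k) (j := j) (by omega) hb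
  have e : ∀ s : ℝ, σ ^ i * s ^ (2 * j) * heatMoment k (a * s ^ 2) σ
      = σ ^ i / σ ^ (k + 1) * (s ^ (2 * j) * expMoment k (a / (4 * σ) * s ^ 2)) := by
    intro s
    rw [heatMoment, show a * s ^ 2 / (4 * σ) = a / (4 * σ) * s ^ 2 by ring]
    ring
  simp only [e]
  refine ⟨h1.const_mul _, ?_⟩
  rw [integral_const_mul, h2, lineMoment, Real.rpow_neg hb.le, Real.rpow_add hb, Real.rpow_natCast,
    ← Real.sqrt_eq_rpow, Real.sqrt_div ha.le, Real.sqrt_mul (by norm_num),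
    show Real.sqrt 4 = 2 by rw [show (4 : ℝ) = 2 ^ 2 by norm_num]; simp]
  have hs := Real.sqrt_pos.2 hσ
  have hsa := Real.sqrt_pos.2 ha
  have hden : 0 < (k : ℝ) - j + 1 / 2 := by
    have : (j : ℝ) ≤ k := Nat.cast_le.2 (by omega)
    linarith
  have hsq : σ = Real.sqrt σ ^ 2 := (Real.sq_sqrt hσ.le).symm
  subst hj
  rw [div_pow, div_pow, mul_pow, pow_succ σ, pow_add]
  field_simp
  rw [← hsq]

section EvenProfile

variable {a σ : ℝ} (u₁ u₂ u₃ u₄ u₅ u₆ : Plane)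

/-- The coefficient of `σ^{-1/2}` in the integral of the even profile over the line. -/
def profileIntegral (a : ℝ) (u₁ u₂ u₃ u₄ u₅ u₆ : Plane) : Plane :=
  lineMoment 1 1 a • u₁ + lineMoment 1 0 a • u₂ + lineMoment 2 2 a • u₃ + lineMoment 2 1 a • u₄
    + lineMoment 3 3 a • u₅ + lineMoment 3 2 a • u₆

theorem evenProfile_eq (p : ℝ × ℝ) : evenProfile a u₁ u₂ u₃ u₄ u₅ u₆ p =
    (p.2 ^ 0 * p.1 ^ (2 * 1) * heatMoment 1 (a * p.1 ^ 2) p.2) • u₁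
    + (p.2 ^ 1 * p.1 ^ (2 * 0) * heatMoment 1 (a * p.1 ^ 2) p.2) • u₂
    + (p.2 ^ 0 * p.1 ^ (2 * 2) * heatMoment 2 (a * p.1 ^ 2) p.2) • u₃
    + (p.2 ^ 1 * p.1 ^ (2 * 1) * heatMoment 2 (a * p.1 ^ 2) p.2) • u₄
    + (p.2 ^ 0 * p.1 ^ (2 * 3) * heatMoment 3 (a * p.1 ^ 2) p.2) • u₅
    + (p.2 ^ 1 * p.1 ^ (2 * 2) * heatMoment 3 (a * p.1 ^ 2) p.2) • u₆ := by
  unfold evenProfile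
  module

theorem evenProfile_neg (s : ℝ) :
    evenProfile a u₁ u₂ u₃ u₄ u₅ u₆ (-s, σ) = evenProfile a u₁ u₂ u₃ u₄ u₅ u₆ (s, σ) := by
  simp only [evenProfile, even_two.neg_pow, (show Even 4 by decide).neg_pow,
    (show Even 6 by decide).neg_pow]

theorem integral_evenProfile (ha : 0 < a) (hσ : 0 < σ) :
    Integrable (fun s => evenProfile a u₁ u₂ u₃ u₄ u₅ u₆ (s, σ)) ∧
    ∫ s, evenProfile a u₁ u₂ u₃ u₄ u₅ u₆ (s, σ)
      = (Real.sqrt σ)⁻¹ • profileIntegral a u₁ u₂ u₃ u₄ u₅ u₆ := by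
  simp only [evenProfile_eq]
  obtain ⟨i1, e1⟩ := integral_pow_mul_heatMoment (k := 1) (j := 1) (i := 0) rfl ha hσ
  obtain ⟨i2, e2⟩ := integral_pow_mul_heatMoment (k := 1) (j := 0) (i := 1) rfl ha hσ
  obtain ⟨i3, e3⟩ := integral_pow_mul_heatMoment (k := 2) (j := 2) (i := 0) rfl ha hσ
  obtain ⟨i4, e4⟩ := integral_pow_mul_heatMoment (k := 2) (j := 1) (i := 1) rfl ha hσ
  obtain ⟨i5, e5⟩ := integral_pow_mul_heatMoment (k := 3) (j := 3) (i := 0) rfl ha hσ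
  obtain ⟨i6, e6⟩ := integral_pow_mul_heatMoment (k := 3) (j := 2) (i := 1) rfl ha hσ
  have j1 := i1.smul_const u₁
  have j2 := i2.smul_const u₂
  have j3 := i3.smul_const u₃
  have j4 := i4.smul_const u₄
  have j5 := i5.smul_const u₅
  have j6 := i6.smul_const u₆
  have k2 := j1.fun_add j2
  have k3 := k2.fun_add j3
  have k4 := k3.fun_add j4
  have k5 := k4.fun_add j5
  refine ⟨k5.fun_add j6, ?_⟩
  rw [integral_add k5 j6, integral_add k4 j5, integral_add k3 j4, integral_add k2 j3,
    integral_add j1 j2]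
  simp only [integral_smul_const, e1, e2, e3, e4, e5, e6, profileIntegral]
  module

theorem exists_pow_mul_heatMoment_le {k j i : ℕ} (hj : j + i = k) (ha : 0 < a) :
    ∃ C > 0, ∀ s σ : ℝ, 0 < σ →
      |σ ^ i * s ^ (2 * j) * heatMoment k (a * s ^ 2) σ| ≤ C / (s ^ 2 + σ) := by
  obtain ⟨C, hC, h⟩ := exists_heatMoment_le k
  have hm : 0 < min a 1 := by positivity
  refine ⟨C / min a 1 ^ (k + 1), by positivity, fun s σ hσ => ?_⟩
  have hH := heatMoment_nonneg k (a * s ^ 2) hσ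
  have hs : 0 ≤ s ^ 2 := sq_nonneg s
  rw [pow_mul, abs_of_nonneg (by positivity)]
  have h1 : σ ^ i * (s ^ 2) ^ j ≤ (s ^ 2 + σ) ^ k := by
    rw [← hj, add_comm j i, pow_add]
    gcongr <;> linarith
  have h2 : min a 1 * (s ^ 2 + σ) ≤ a * s ^ 2 + σ := by
    have e1 := min_le_left a 1
    have e2 := min_le_right a 1
    nlinarith
  calc σ ^ i * (s ^ 2) ^ j * heatMoment k (a * s ^ 2) σ
      ≤ (s ^ 2 + σ) ^ k * (C / (min a 1 * (s ^ 2 + σ)) ^ (k + 1)) := by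
        gcongr
        exact (h _ _ (by positivity) hσ).trans (by gcongr)
    _ = C / min a 1 ^ (k + 1) / (s ^ 2 + σ) := by
        have : 0 < s ^ 2 + σ := by positivity
        rw [mul_pow, pow_succ (s ^ 2 + σ)]
        field_simp

theorem exists_evenProfile_le (ha : 0 < a) : ∃ C > 0, ∀ s σ : ℝ, 0 < σ →
    ‖evenProfile a u₁ u₂ u₃ u₄ u₅ u₆ (s, σ)‖ ≤ C / (s ^ 2 + σ) := by
  have key : ∀ (k j i : ℕ) (u : Plane), j + i = k → ∃ C > 0, ∀ s σ : ℝ, 0 < σ →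
      ‖(σ ^ i * s ^ (2 * j) * heatMoment k (a * s ^ 2) σ) • u‖ ≤ C / (s ^ 2 + σ) := by
    intro k j i u hj
    obtain ⟨C, hC, h⟩ := exists_pow_mul_heatMoment_le hj ha
    refine ⟨C * (‖u‖ + 1), by positivity, fun s σ hσ => ?_⟩
    rw [norm_smul, mul_div_right_comm]
    gcongr
    · exact h s σ hσ
    · linarith
  obtain ⟨C1, p1, h1⟩ := key 1 1 0 u₁ rfl
  obtain ⟨C2, p2, h2⟩ := key 1 0 1 u₂ rfl
  obtain ⟨C3, p3, h3⟩ := key 2 2 0 u₃ rfl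
  obtain ⟨C4, p4, h4⟩ := key 2 1 1 u₄ rfl
  obtain ⟨C5, p5, h5⟩ := key 3 3 0 u₅ rfl
  obtain ⟨C6, p6, h6⟩ := key 3 2 1 u₆ rfl
  refine ⟨C1 + C2 + C3 + C4 + C5 + C6, by positivity, fun s σ hσ => ?_⟩
  rw [evenProfile_eq]
  simp only [add_div]
  exact norm_add_le_of_le (norm_add_le_of_le (norm_add_le_of_le (norm_add_le_of_le
    (norm_add_le_of_le (h1 s σ hσ) (h2 s σ hσ)) (h3 s σ hσ)) (h4 s σ hσ)) (h5 s σ hσ)) (h6 s σ hσ)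

end EvenProfile

/-! ### The moving frame and the constant of the expansion -/

/-- Clockwise rotation by a right angle. -/
def rotCW : Plane →L[ℝ] Plane :=
  LinearMap.toContinuousLinearMap
    { toFun := fun w => !₂[w 1, -w 0]
      map_add' := fun v w => by ext i; fin_cases i <;> simp [add_comm]
      map_smul' := fun c w => by ext i; fin_cases i <;> simp }

theorem rotCW_apply (w : Plane) : rotCW w = !₂[w 1, -w 0] := rfl

theorem rotCW_rotCW (w : Plane) : rotCW (rotCW w) = -w := by
  ext i; fin_cases i <;> simp [rotCW_apply]

theorem inner_rotCW_rotCW (v w : Plane) : ⟪rotCW v, rotCW w⟫ = ⟪v, w⟫ := by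
  simp [rotCW_apply, PiLp.inner_apply, Fin.sum_univ_two]
  ring

theorem inner_rotCW_self (w : Plane) : ⟪rotCW w, w⟫ = 0 := by
  simp [rotCW_apply, PiLp.inner_apply, Fin.sum_univ_two]
  ring

theorem eq_frame {w : Plane} (hw : ⟪w, w⟫ = 1) (v : Plane) :
    v = ⟪w, v⟫ • w + ⟪rotCW w, v⟫ • rotCW w := by
  have h : w 0 ^ 2 + w 1 ^ 2 = 1 := by
    simp only [PiLp.inner_apply, Fin.sum_univ_two] at hw
    simpa using hw
  ext i
  fin_cases i <;> simp [rotCW_apply, PiLp.inner_apply, Fin.sum_univ_two]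
  · linear_combination -(v 0) * h
  · linear_combination -(v 1) * h

/-- Half-integer Gamma values give double factorials times `√π`. -/
theorem lineMoment_values {S : ℝ} (hS : 0 < S) :
    lineMoment 1 1 (S ^ 2) = 8 * Real.sqrt Real.pi / S ^ 3 ∧
    lineMoment 1 0 (S ^ 2) = 4 / 3 * Real.sqrt Real.pi / S ∧
    lineMoment 2 2 (S ^ 2) = 48 * Real.sqrt Real.pi / S ^ 5 ∧
    lineMoment 2 1 (S ^ 2) = 8 / 3 * Real.sqrt Real.pi / S ^ 3 ∧
    lineMoment 3 3 (S ^ 2) = 480 * Real.sqrt Real.pi / S ^ 7 ∧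
    lineMoment 3 2 (S ^ 2) = 16 * Real.sqrt Real.pi / S ^ 5 := by
  simp only [lineMoment, Real.Gamma_nat_add_half, Real.sqrt_sq hS.le]
  norm_num [Nat.doubleFactorial]
  refine ⟨?_, ?_, ?_, ?_, ?_, ?_⟩ <;> field_simp <;> norm_num

/-- The constant of the asymptotic expansion, in terms of the frame `(w, n)`, `n` being `w` rotated
clockwise, the speed `S` and the components of the other vectors. -/
theorem profileIntegral_frame {w n : Plane} {S : ℝ} (hS : 0 < S) (hww : ⟪w, w⟫ = 1)
    (hnn : ⟪n, n⟫ = 1) (hwn : ⟪w, n⟫ = 0) (hnw : ⟪n, w⟫ = 0) (α β v₁ v₂ f g f' g' : ℝ)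
    {X' N₀ N' A V φ₀ φ' : Plane} (hX : X' = S • w) (hN : N₀ = S • n)
    (hA : A = α • w + β • n) (hN' : N' = α • n - β • w) (hV : V = v₁ • w + v₂ • n)
    (hφ : φ₀ = f • w + g • n) (hφ' : φ' = f' • w + g' • n) :
    (1 / 4 : ℝ) • profileIntegral ⟪X', X'⟫
        ((-⟪A, φ₀⟫ / 2 - ⟪X', φ'⟫) • N₀ - ⟪X', φ₀⟫ • N' + (⟪N₀, φ₀⟫ / 2) • A
          + (⟪N', φ₀⟫ + ⟪N₀, φ'⟫) • X' + (-⟪N₀, A⟫ / 2 - ⟪N', X'⟫) • φ₀)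
        (⟪V, φ₀⟫ • N₀ - ⟪N₀, φ₀⟫ • V + ⟪N₀, V⟫ • φ₀)
        ((⟪X', A⟫ / 4) • (⟪X', φ₀⟫ • N₀ - ⟪N₀, φ₀⟫ • X')
          + ((-⟪N₀, A⟫ / 2 - ⟪N', X'⟫) / 2 * ⟪X', φ₀⟫) • X' + (⟪X', A⟫ / 4 * ⟪X', φ₀⟫) • N₀
          - (⟪X', X'⟫ / 4) • ((-⟪A, φ₀⟫ / 2 - ⟪X', φ'⟫) • N₀ - ⟪X', φ₀⟫ • N'
            + (-⟪N₀, A⟫ / 2 - ⟪N', X'⟫) • φ₀))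
        ((-⟪X', V⟫ / 2) • (⟪X', φ₀⟫ • N₀ - ⟪N₀, φ₀⟫ • X') + (⟪N₀, V⟫ / 2 * ⟪X', φ₀⟫) • X'
          - (⟪X', V⟫ / 2 * ⟪X', φ₀⟫) • N₀ - (⟪X', X'⟫ / 4) • (⟪V, φ₀⟫ • N₀ + ⟪N₀, V⟫ • φ₀))
        ((-⟪X', X'⟫ / 16 * ⟪X', φ₀⟫ * ⟪X', A⟫) • N₀)
        ((⟪X', X'⟫ / 8 * ⟪X', φ₀⟫ * ⟪X', V⟫) • N₀)
      = Real.sqrt Real.pi • (((⟪V, n⟫ / 6 + -⟪A, n⟫ / S ^ 2 / 2) • φ₀ + (⟪V, n⟫ / 3 * ⟪w, φ₀⟫) • w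
          - ((⟪V, n⟫ / 6 + 3 * (-⟪A, n⟫ / S ^ 2) / 2) * ⟪n, φ₀⟫) • n)
          + S⁻¹ • (⟪w, φ'⟫ • n + (2 * ⟪n, φ'⟫) • w)) := by
  obtain ⟨l1, l2, l3, l4, l5, l6⟩ := lineMoment_values hS
  have hXX : ⟪X', X'⟫ = S ^ 2 := by
    rw [hX, real_inner_smul_left, real_inner_smul_right, hww]; ring
  rw [hXX, profileIntegral, l1, l2, l3, l4, l5, l6]
  subst hX hN hA hN' hV hφ hφ'
  simp only [inner_add_left, inner_add_right, inner_sub_left,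
    real_inner_smul_left, real_inner_smul_right, hww, hnn, hwn, hnw]
  match_scalars <;> field_simp <;> ring

/-! ### Bounds and continuity of the layer density -/

theorem norm_layerDensity_le (n r p : Plane) {σ : ℝ} (hσ : 0 < σ) :
    ‖layerDensity n r p σ‖ ≤ heatMoment 1 ⟪r, r⟫ σ * (3 * (‖n‖ * ‖r‖ * ‖p‖))
      + heatMoment 2 ⟪r, r⟫ σ * (‖n‖ * ‖r‖ ^ 3 * ‖p‖) := by
  have h1 := heatMoment_nonneg 1 ⟪r, r⟫ hσ
  have h2 := heatMoment_nonneg 2 ⟪r, r⟫ hσ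
  have a1 : ‖⟪r, p⟫ • n‖ ≤ ‖n‖ * ‖r‖ * ‖p‖ := by
    rw [norm_smul]
    calc _ ≤ ‖r‖ * ‖p‖ * ‖n‖ := by gcongr; exact norm_inner_le_norm _ _
      _ = _ := by ring
  have a2 : ‖⟪n, p⟫ • r‖ ≤ ‖n‖ * ‖r‖ * ‖p‖ := by
    rw [norm_smul]
    calc _ ≤ ‖n‖ * ‖p‖ * ‖r‖ := by gcongr; exact norm_inner_le_norm _ _
      _ = _ := by ring
  have a3 : ‖⟪n, r⟫ • p‖ ≤ ‖n‖ * ‖r‖ * ‖p‖ := by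
    rw [norm_smul]
    gcongr
    exact norm_inner_le_norm _ _
  have a4 : ‖⟪n, r⟫ • (⟪r, p⟫ • r)‖ ≤ ‖n‖ * ‖r‖ ^ 3 * ‖p‖ := by
    rw [norm_smul, norm_smul]
    calc _ ≤ ‖n‖ * ‖r‖ * (‖r‖ * ‖p‖ * ‖r‖) := by gcongr <;> exact norm_inner_le_norm _ _
      _ = _ := by ring
  have a5 : ‖⟪r, r⟫ • (⟪r, p⟫ • n + ⟪n, r⟫ • p)‖ ≤ 2 * (‖n‖ * ‖r‖ ^ 3 * ‖p‖) := by
    rw [norm_smul, real_inner_self_eq_norm_sq, norm_pow, norm_norm]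
    calc _ ≤ ‖r‖ ^ 2 * (‖n‖ * ‖r‖ * ‖p‖ + ‖n‖ * ‖r‖ * ‖p‖) := by
          gcongr; exact norm_add_le_of_le a1 a3
      _ = _ := by ring
  unfold layerDensity
  refine norm_add_le_of_le ?_ ?_
  · rw [norm_smul, Real.norm_of_nonneg h1]
    gcongr
    refine (norm_add_le_of_le (norm_sub_le_of_le a1 a2) a3).trans (by linarith)
  · rw [norm_smul, Real.norm_of_nonneg h2]
    gcongr
    have b1 : ‖(1 / 2 : ℝ) • (⟪n, r⟫ • (⟪r, p⟫ • r))‖ ≤ 1 / 2 * (‖n‖ * ‖r‖ ^ 3 * ‖p‖) := by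
      rw [norm_smul, Real.norm_of_nonneg (by norm_num)]; gcongr
    have b2 : ‖(1 / 4 : ℝ) • (⟪r, r⟫ • (⟪r, p⟫ • n + ⟪n, r⟫ • p))‖
        ≤ 1 / 4 * (2 * (‖n‖ * ‖r‖ ^ 3 * ‖p‖)) := by
      rw [norm_smul, Real.norm_of_nonneg (by norm_num)]; gcongr
    exact (norm_sub_le_of_le b1 b2).trans (by linarith)

theorem continuousOn_layerDensity {n r f : ℝ × ℝ → Plane} {s : ℝ × ℝ → ℝ} {S : Set (ℝ × ℝ)}
    (hn : ContinuousOn n S) (hr : ContinuousOn r S) (hf : ContinuousOn f S)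
    (hs : ContinuousOn s S) (hpos : ∀ p ∈ S, 0 < s p) :
    ContinuousOn (fun p => layerDensity (n p) (r p) (f p) (s p)) S := by
  have hrr : ContinuousOn (fun p => ⟪r p, r p⟫) S := hr.inner hr
  have hmaps : MapsTo (fun p => ((⟪r p, r p⟫, s p) : ℝ × ℝ)) S {p | 0 < p.2} := hpos
  have hH : ∀ k, ContinuousOn (fun p => heatMoment k ⟪r p, r p⟫ (s p)) S := by
    intro k
    have h := (continuousOn_heatMoment k).comp (hrr.prodMk hs) hmaps
    exact h
  have hrf : ContinuousOn (fun p => ⟪r p, f p⟫) S := hr.inner hf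
  have hnf : ContinuousOn (fun p => ⟪n p, f p⟫) S := hn.inner hf
  have hnr : ContinuousOn (fun p => ⟪n p, r p⟫) S := hn.inner hr
  have c1 : ContinuousOn (fun p => ⟪r p, f p⟫ • n p) S := hrf.smul hn
  have c2 : ContinuousOn (fun p => ⟪n p, f p⟫ • r p) S := hnf.smul hr
  have c3 : ContinuousOn (fun p => ⟪n p, r p⟫ • f p) S := hnr.smul hf
  have c4 : ContinuousOn (fun p => ⟪n p, r p⟫ • (⟪r p, f p⟫ • r p)) S := hnr.smul (hrf.smul hr)
  have c5 : ContinuousOn (fun p => ⟪r p, r p⟫ • (⟪r p, f p⟫ • n p + ⟪n p, r p⟫ • f p)) S :=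
    hrr.smul (c1.add c3)
  have d1 := (hH 1).smul ((c1.fun_sub c2).fun_add c3)
  have d2 := (hH 2).smul ((c4.fun_const_smul (1 / 2 : ℝ)).fun_sub (c5.fun_const_smul (1 / 4 : ℝ)))
  unfold layerDensity
  exact d1.fun_add d2

theorem exists_heatMoment_le_of_gap (k : ℕ) {c : ℝ} (hc : 0 < c) : ∃ C > 0, ∀ q σ : ℝ, 0 ≤ q →
    0 < σ → c ≤ q + σ → heatMoment k q σ ≤ C := by
  obtain ⟨C, hC, h⟩ := exists_heatMoment_le k
  exact ⟨C / c ^ (k + 1), by positivity, fun q σ hq hσ hgap =>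
    (h q σ hq hσ).trans (by gcongr)⟩

theorem exists_layerDensity_le {M c : ℝ} (hM : 0 < M) (hc : 0 < c) : ∃ C > 0,
    ∀ (n r p : Plane) (σ : ℝ), ‖n‖ ≤ M → ‖r‖ ≤ M → ‖p‖ ≤ M → 0 < σ → c ≤ ⟪r, r⟫ + σ →
      ‖layerDensity n r p σ‖ ≤ C := by
  obtain ⟨C1, p1, h1⟩ := exists_heatMoment_le_of_gap 1 hc
  obtain ⟨C2, p2, h2⟩ := exists_heatMoment_le_of_gap 2 hc
  refine ⟨C1 * (3 * (M * M * M)) + C2 * (M * M ^ 3 * M), by positivity, ?_⟩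
  intro n r p σ hn hr hp hσ hgap
  refine (norm_layerDensity_le n r p hσ).trans ?_
  have := h1 _ _ real_inner_self_nonneg hσ hgap
  have := h2 _ _ real_inner_self_nonneg hσ hgap
  gcongr

/-! ### Exact derivatives and their vanishing integrals -/

/-- A vector multiple of the derivative of a function of `q`, where `y` is the derivative of `q`. -/
def exactTerm (W₁ W₂ : Plane) (q y σ : ℝ) : Plane :=
  (heatMoment 1 q σ * y) • W₁ + (heatMoment 2 q σ * q * y) • W₂

theorem exists_exactTerm_le (W₁ W₂ : Plane) {M c : ℝ} (hM : 0 < M) (hc : 0 < c) : ∃ C > 0,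
    ∀ q y σ : ℝ, 0 ≤ q → q ≤ M → |y| ≤ M → 0 < σ → c ≤ q + σ →
      ‖exactTerm W₁ W₂ q y σ‖ ≤ C := by
  obtain ⟨C1, p1, h1⟩ := exists_heatMoment_le_of_gap 1 hc
  obtain ⟨C2, p2, h2⟩ := exists_heatMoment_le_of_gap 2 hc
  refine ⟨C1 * M * (‖W₁‖ + 1) + C2 * M * M * (‖W₂‖ + 1), by positivity, ?_⟩
  intro q y σ hq hqM hy hσ hgap
  have n1 := heatMoment_nonneg 1 q hσ
  have n2 := heatMoment_nonneg 2 q hσ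
  have := h1 _ _ hq hσ hgap
  have := h2 _ _ hq hσ hgap
  refine norm_add_le_of_le ?_ ?_
  · rw [norm_smul, norm_mul, Real.norm_of_nonneg n1, Real.norm_eq_abs]
    gcongr
    linarith
  · rw [norm_smul, norm_mul, norm_mul, Real.norm_of_nonneg n2, Real.norm_of_nonneg hq,
      Real.norm_eq_abs]
    gcongr
    linarith

/-- The integral of the derivative of a function of `q` over a superlevel set of `q` vanishes, if
`q` has the same values at both ends. -/
theorem integral_superlevel_comp_mul_deriv {a b : ℝ} {q q' K : ℝ → ℝ}
    (hq : ∀ θ, HasDerivAt q (q' θ) θ) (hq' : Continuous q') (hK : Continuous K) (hper : q b = q a)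
    (c : ℝ) : ∫ θ in a..b, {θ | c < q θ}.indicator (fun θ => K (q θ) * q' θ) θ = 0 := by
  have hqc : Continuous q := continuous_iff_continuousAt.2 fun θ => (hq θ).continuousAt
  -- The indicator of `q > c` is the bounded pointwise limit of continuous functions of `q`. For
  -- these the substitution rule gives an integral between equal endpoints; no regularity of the
  -- level set is needed.
  set cut : ℕ → ℝ → ℝ := fun n y => min 1 (n * max 0 (y - c)) with hcut
  have hcutc : ∀ n, Continuous (cut n) := fun n => by simp only [hcut]; fun_prop
  have hzero : ∀ n, ∫ θ in a..b, cut n (q θ) * K (q θ) * q' θ = 0 := by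
    intro n
    have := intervalIntegral.integral_comp_mul_deriv (a := a) (b := b)
      (g := fun y => cut n y * K y) (fun θ _ => hq θ) hq'.continuousOn ((hcutc n).mul hK)
    simpa [Function.comp_def, hper] using this
  have hlim : Tendsto (fun n : ℕ => ∫ θ in a..b, cut n (q θ) * K (q θ) * q' θ) atTop
      (𝓝 (∫ θ in a..b, {θ | c < q θ}.indicator (fun θ => K (q θ) * q' θ) θ)) := by
    apply intervalIntegral.tendsto_integral_filter_of_dominated_convergence
      (fun θ => |K (q θ) * q' θ|)
    · refine Eventually.of_forall fun n => Continuous.aestronglyMeasurable ?_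
      have := hcutc n
      fun_prop
    · refine Eventually.of_forall fun n => ae_of_all _ fun θ _ => ?_
      rw [mul_assoc, norm_mul, Real.norm_eq_abs (K _ * _)]
      have h0 : 0 ≤ cut n (q θ) := le_min zero_le_one (by positivity)
      rw [Real.norm_of_nonneg h0]
      exact mul_le_of_le_one_left (abs_nonneg _) (min_le_left _ _)
    · apply Continuous.intervalIntegrable
      fun_prop
    · refine ae_of_all _ fun θ _ => ?_
      by_cases h : c < q θ
      · rw [indicator_of_mem (show θ ∈ {θ | c < q θ} from h)]
        apply tendsto_const_nhds.congr'
        obtain ⟨n₀, hn₀⟩ := exists_nat_ge (1 / (q θ - c))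
        filter_upwards [eventually_ge_atTop n₀] with n hn
        have hpos : 0 < q θ - c := by linarith
        have : (1 : ℝ) ≤ n * max 0 (q θ - c) := by
          rw [max_eq_right hpos.le, ← div_le_iff₀ hpos]
          exact hn₀.trans (Nat.cast_le.2 hn)
        simp only [hcut]
        rw [min_eq_left this]
        ring
      · rw [indicator_of_notMem (show θ ∉ {θ | c < q θ} from h)]
        have : max 0 (q θ - c) = 0 := max_eq_left (by linarith)
        simp [hcut, this]
  exact tendsto_nhds_unique hlim (by simpa only [hzero] using tendsto_const_nhds)

/-! ### The boundary and the integrand in parameters -/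

namespace MovingBoundary

variable {m : ℕ} {T : ℝ} (Γ : MovingBoundary m T) {φ : Plane → ℝ → Plane}

/-- The parametrization of the `i`-th component, as a function on the strip. -/
def curve (i : Fin m) (p : ℝ × ℝ) : Plane := Γ.pos i p.1 p.2

/-- The derivative of the parametrization. -/
def curveDeriv (i : Fin m) : ℝ × ℝ → Plane := angDeriv T (Γ.curve i)

/-- The normal vector whose length is the line element. -/
def conormal (i : Fin m) (p : ℝ × ℝ) : Plane := rotCW (Γ.curveDeriv i p)

/-- The density in terms of the parameters. -/
def pullback (φ : Plane → ℝ → Plane) (i : Fin m) (p : ℝ × ℝ) : Plane := φ (Γ.curve i p) p.2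

/-- `8π` times the double layer integrand. -/
def layerFun (φ : Plane → ℝ → Plane) (x : Plane) (t : ℝ) (i : Fin m) (p : ℝ × ℝ) : Plane :=
  layerDensity (Γ.conormal i p) (x - Γ.curve i p) (Γ.pullback φ i p) (t - p.2)

theorem contDiffOn_curve (i : Fin m) : ContDiffOn ℝ ∞ (Γ.curve i) (strip T) := Γ.smooth i

theorem contDiffOn_curveDeriv (hT : 0 < T) (i : Fin m) :
    ContDiffOn ℝ ∞ (Γ.curveDeriv i) (strip T) := contDiffOn_angDeriv hT (Γ.contDiffOn_curve i)

theorem contDiffOn_pullback (hφ : Γ.SmoothDensity φ) (i : Fin m) :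
    ContDiffOn ℝ ∞ (Γ.pullback φ i) (strip T) := hφ i

theorem deriv_pos (i : Fin m) {τ : ℝ} (hτ : τ ∈ Icc 0 T) (θ : ℝ) :
    deriv (fun θ' => Γ.pos i θ' τ) θ = Γ.curveDeriv i (θ, τ) :=
  (hasDerivAt_angDeriv (Γ.contDiffOn_curve i) hτ θ).deriv

theorem curveDeriv_ne_zero (i : Fin m) {τ : ℝ} (hτ : τ ∈ Icc 0 T) (θ : ℝ) :
    Γ.curveDeriv i (θ, τ) ≠ 0 := by
  rw [← Γ.deriv_pos i hτ θ]
  exact Γ.immersed i τ hτ θ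

theorem speed_eq (i : Fin m) {τ : ℝ} (hτ : τ ∈ Icc 0 T) (θ : ℝ) :
    Γ.speed i θ τ = ‖Γ.curveDeriv i (θ, τ)‖ := by
  rw [speed, Γ.deriv_pos i hτ θ]

theorem speed_pos (i : Fin m) {τ : ℝ} (hτ : τ ∈ Icc 0 T) (θ : ℝ) : 0 < Γ.speed i θ τ := by
  rw [Γ.speed_eq i hτ θ]
  exact norm_pos_iff.2 (Γ.curveDeriv_ne_zero i hτ θ)

theorem tangent_eq (i : Fin m) {τ : ℝ} (hτ : τ ∈ Icc 0 T) (θ : ℝ) :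
    Γ.tangent i θ τ = (Γ.speed i θ τ)⁻¹ • Γ.curveDeriv i (θ, τ) := by
  rw [tangent, arcDeriv, Γ.deriv_pos i hτ θ]

theorem normal_eq (i : Fin m) (θ τ : ℝ) : Γ.normal i θ τ = rotCW (Γ.tangent i θ τ) := rfl

theorem conormal_eq (i : Fin m) {τ : ℝ} (hτ : τ ∈ Icc 0 T) (θ : ℝ) :
    Γ.conormal i (θ, τ) = Γ.speed i θ τ • Γ.normal i θ τ := by
  rw [normal_eq, Γ.tangent_eq i hτ θ, map_smul, smul_inv_smul₀ (Γ.speed_pos i hτ θ).ne', conormal]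

/-- Linearity in the normal absorbs the line element into the conormal, which is smooth without any
normalization of the tangent. -/
theorem dlIntegrand_eq (x : Plane) (i : Fin m) {t τ : ℝ} (hτ : τ ∈ Icc 0 T) (hτt : τ < t)
    (θ : ℝ) : Γ.dlIntegrand φ x t i θ τ = (1 / (8 * Real.pi)) • Γ.layerFun φ x t i (θ, τ) := by
  rw [dlIntegrand, dlKernel_apply _ _ _ (sub_pos.2 hτt), smul_comm, ← layerDensity_smul,
    ← Γ.conormal_eq i hτ θ]
  rfl

theorem continuousOn_curve (i : Fin m) : ContinuousOn (Γ.curve i) (strip T) :=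
  (Γ.contDiffOn_curve i).continuousOn

theorem continuousOn_conormal (hT : 0 < T) (i : Fin m) :
    ContinuousOn (Γ.conormal i) (strip T) :=
  rotCW.continuous.comp_continuousOn (Γ.contDiffOn_curveDeriv hT i).continuousOn

theorem continuousOn_layerFun (hT : 0 < T) (hφ : Γ.SmoothDensity φ) (x : Plane) {t : ℝ}
    (i : Fin m) : ContinuousOn (Γ.layerFun φ x t i) (strip T ∩ {p | p.2 < t}) := by
  have hsub : strip T ∩ {p : ℝ × ℝ | p.2 < t} ⊆ strip T := inter_subset_left
  exact continuousOn_layerDensity ((Γ.continuousOn_conormal hT i).mono hsub)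
    (continuousOn_const.sub ((Γ.continuousOn_curve i).mono hsub))
    ((Γ.contDiffOn_pullback hφ i).continuousOn.mono hsub) (by fun_prop)
    fun p hp => sub_pos.2 hp.2

theorem curve_periodic (i : Fin m) {τ : ℝ} (hτ : τ ∈ Icc 0 T) :
    Function.Periodic (fun θ => Γ.curve i (θ, τ)) (2 * Real.pi) := Γ.periodic i τ hτ

theorem curveDeriv_periodic (i : Fin m) {τ : ℝ} (hτ : τ ∈ Icc 0 T) :
    Function.Periodic (fun θ => Γ.curveDeriv i (θ, τ)) (2 * Real.pi) := by
  intro θ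
  simp only [← Γ.deriv_pos i hτ]
  have h : (fun θ' => Γ.pos i θ' τ) = fun θ' => Γ.pos i (θ' + 2 * Real.pi) τ :=
    funext fun θ' => (Γ.periodic i τ hτ θ').symm
  conv_rhs => rw [h]
  exact (deriv_comp_add_const (fun θ' => Γ.pos i θ' τ) (2 * Real.pi) θ).symm

theorem layerFun_periodic (x : Plane) (t : ℝ) (i : Fin m) {τ : ℝ} (hτ : τ ∈ Icc 0 T) :
    Function.Periodic (fun θ => Γ.layerFun φ x t i (θ, τ)) (2 * Real.pi) := by
  intro θ
  have h1 := Γ.curve_periodic i hτ θ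
  have h2 := Γ.curveDeriv_periodic i hτ θ
  simp only [layerFun, conormal, pullback] at h1 h2 ⊢
  rw [h1, h2]

/-- The points of `Γ(τ)` determine the component and the parameter modulo the period. -/
theorem curve_injective {τ : ℝ} (hτ : τ ∈ Icc 0 T) {i j : Fin m} {θ θ' : ℝ}
    (h : Γ.curve i (θ, τ) = Γ.curve j (θ', τ)) : i = j ∧ ∃ k : ℤ, θ' - θ = k * (2 * Real.pi) := by
  have hp := Real.two_pi_pos
  have hm : ∀ (i : Fin m) (θ : ℝ), Γ.curve i (toIcoMod hp 0 θ, τ) = Γ.curve i (θ, τ) := by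
    intro i θ
    exact (Γ.curve_periodic i hτ).sub_zsmul_eq (x := θ) (toIcoDiv hp 0 θ)
  have hmem : ∀ θ : ℝ, toIcoMod hp 0 θ ∈ Ico 0 (2 * Real.pi) := fun θ => by
    simpa using toIcoMod_mem_Ico hp 0 θ
  obtain ⟨h1, h2⟩ := Γ.embedded τ hτ i j _ (hmem θ) _ (hmem θ')
    (by simpa only [curve] using (hm i θ).trans (h.trans (hm j θ').symm))
  refine ⟨h1, toIcoDiv hp 0 θ' - toIcoDiv hp 0 θ, ?_⟩
  simp only [toIcoMod, zsmul_eq_mul] at h2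
  push_cast
  linarith

end MovingBoundary

/-! ### Geometry and expansions along the moving boundary -/

namespace MovingBoundary

variable {m : ℕ} {T : ℝ} (Γ : MovingBoundary m T) {φ : Plane → ℝ → Plane}

theorem velocity_eq (hT : 0 < T) (i : Fin m) {τ : ℝ} (hτ : τ ∈ Icc 0 T) (θ : ℝ) :
    Γ.velocity i θ τ = timeDeriv T (Γ.curve i) (θ, τ) :=
  (hasDerivWithinAt_timeDeriv (Γ.contDiffOn_curve i) hτ θ).derivWithin
    (uniqueDiffOn_Icc hT τ hτ)

theorem arcDeriv_pullback (hφ : Γ.SmoothDensity φ) (i : Fin m) {τ : ℝ} (hτ : τ ∈ Icc 0 T)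
    (θ : ℝ) : Γ.arcDeriv i τ (fun θ' => φ (Γ.pos i θ' τ) τ) θ
      = (Γ.speed i θ τ)⁻¹ • angDeriv T (Γ.pullback φ i) (θ, τ) := by
  have h := hasDerivAt_angDeriv (Γ.contDiffOn_pullback hφ i) hτ θ
  rw [arcDeriv, ← h.deriv]
  rfl

theorem inner_tangent_self (i : Fin m) {τ : ℝ} (hτ : τ ∈ Icc 0 T) (θ : ℝ) :
    ⟪Γ.tangent i θ τ, Γ.tangent i θ τ⟫ = 1 := by
  have h := Γ.speed_pos i hτ θ
  rw [Γ.tangent_eq i hτ θ, real_inner_smul_left, real_inner_smul_right,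
    real_inner_self_eq_norm_sq, ← Γ.speed_eq i hτ θ]
  field_simp

theorem curveDeriv_eq (i : Fin m) {τ : ℝ} (hτ : τ ∈ Icc 0 T) (θ : ℝ) :
    Γ.curveDeriv i (θ, τ) = Γ.speed i θ τ • Γ.tangent i θ τ := by
  rw [Γ.tangent_eq i hτ θ, smul_inv_smul₀ (Γ.speed_pos i hτ θ).ne']

/-- Differentiating the normalizing factor only produces a tangential vector, so the normal
component comes from the second derivative; the two factors of the speed come from the unit tangent
and the arclength derivative. -/
theorem curvature_eq (hT : 0 < T) (i : Fin m) {τ : ℝ} (hτ : τ ∈ Icc 0 T) (θ : ℝ) :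
    Γ.curvature i θ τ
      = -⟪angDeriv T (Γ.curveDeriv i) (θ, τ), Γ.normal i θ τ⟫ / Γ.speed i θ τ ^ 2 := by
  have hS := Γ.speed_pos i hτ θ
  have hd := hasDerivAt_angDeriv (Γ.contDiffOn_curveDeriv hT i) hτ θ
  have hn : DifferentiableAt ℝ (fun θ' => ‖Γ.curveDeriv i (θ', τ)‖⁻¹) θ :=
    (hd.differentiableAt.norm ℝ (Γ.curveDeriv_ne_zero i hτ θ)).fun_inv
      (norm_ne_zero_iff.2 (Γ.curveDeriv_ne_zero i hτ θ))
  have ht : (fun θ' => Γ.tangent i θ' τ)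
      = fun θ' => ‖Γ.curveDeriv i (θ', τ)‖⁻¹ • Γ.curveDeriv i (θ', τ) :=
    funext fun θ' => by rw [Γ.tangent_eq i hτ, Γ.speed_eq i hτ]
  have hperp : ⟪Γ.curveDeriv i (θ, τ), Γ.normal i θ τ⟫ = 0 := by
    rw [Γ.curveDeriv_eq i hτ, real_inner_smul_left, normal_eq, real_inner_comm, inner_rotCW_self,
      mul_zero]
  have hder := (hn.hasDerivAt.fun_smul hd).deriv
  rw [curvature, arcDeriv, ht, hder, ← Γ.speed_eq i hτ]
  simp only [real_inner_smul_left, inner_add_left, hperp]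
  field_simp
  ring

theorem pos_mem_Icc {t : ℝ} (ht : t ∈ Ioc 0 T) : t ∈ Icc 0 T := ⟨ht.1.le, ht.2⟩

theorem sub_mem_Icc {t σ : ℝ} (ht : t ∈ Ioc 0 T) (h0 : 0 ≤ σ) (h1 : σ ≤ t) : t - σ ∈ Icc 0 T :=
  ⟨by linarith, by linarith [ht.2]⟩

section Expansion

variable (i : Fin m) (θ : ℝ) {t : ℝ}

theorem hasExp_displacement (ht : t ∈ Ioc 0 T) :
    HasExp 1 (-1) (fun p => Γ.curve i (θ, t) - recenter θ t (Γ.curve i) p)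
      (fun p => -(p.1 • Γ.curveDeriv i (θ, t)))
      (fun p => p.2 • timeDeriv T (Γ.curve i) (θ, t)
        - (p.1 ^ 2 / 2) • angDeriv T (Γ.curveDeriv i) (θ, t)) :=
  hasExp_sub_recenter (ht.1.trans_le ht.2) (Γ.contDiffOn_curve i) ht

theorem hasExp_curveDeriv (ht : t ∈ Ioc 0 T) :
    HasExp 0 1 (recenter θ t (Γ.curveDeriv i)) (fun _ => Γ.curveDeriv i (θ, t))
      (fun p => p.1 • angDeriv T (Γ.curveDeriv i) (θ, t)) :=
  hasExp_recenter (ht.1.trans_le ht.2) (Γ.contDiffOn_curveDeriv (ht.1.trans_le ht.2) i) ht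

theorem hasExp_conormal (ht : t ∈ Ioc 0 T) :
    HasExp 0 1 (recenter θ t (Γ.conormal i)) (fun _ => Γ.conormal i (θ, t))
      (fun p => p.1 • rotCW (angDeriv T (Γ.curveDeriv i) (θ, t))) :=
  ((Γ.hasExp_curveDeriv i θ ht).clm rotCW).congr (fun _ => rfl) (fun _ => rfl)
    fun p => by rw [map_smul]

theorem hasExp_pullback (ht : t ∈ Ioc 0 T) (hφ : Γ.SmoothDensity φ) :
    HasExp 0 1 (recenter θ t (Γ.pullback φ i)) (fun _ => Γ.pullback φ i (θ, t))
      (fun p => p.1 • angDeriv T (Γ.pullback φ i) (θ, t)) :=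
  hasExp_recenter (ht.1.trans_le ht.2) (Γ.contDiffOn_pullback hφ i) ht

theorem recenter_layerFun (x : Plane) (j : Fin m) (p : ℝ × ℝ) :
    recenter θ t (Γ.layerFun φ x t j) p = layerDensity (recenter θ t (Γ.conormal j) p)
      (x - recenter θ t (Γ.curve j) p) (recenter θ t (Γ.pullback φ j) p) p.2 := by
  simp [recenter, layerFun]

theorem inner_conormal_curveDeriv : ⟪Γ.conormal i (θ, t), Γ.curveDeriv i (θ, t)⟫ = 0 :=
  inner_rotCW_self _

/-- The expansion of the double layer integrand near its singularity; the second term is an even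
profile, whose integral is given by the geometry. -/
theorem exists_hasExp_layerFun (ht : t ∈ Ioc 0 T) (hφ : Γ.SmoothDensity φ) {x n tan v φs : Plane}
    {κ : ℝ} (hx : x = Γ.pos i θ t) (hn : n = Γ.normal i θ t) (htan : tan = Γ.tangent i θ t)
    (hv : v = Γ.velocity i θ t) (hκ : κ = Γ.curvature i θ t)
    (hφs : φs = Γ.arcDeriv i t (fun θ' => φ (Γ.pos i θ' t) t) θ) :
    ∃ (a : ℝ) (u₁ u₂ u₃ u₄ u₅ u₆ : Plane) (f₀ : ℝ × ℝ → Plane), 0 < a ∧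
      HasExp (-3) (-1) (recenter θ t (Γ.layerFun φ x t i)) f₀ (evenProfile a u₁ u₂ u₃ u₄ u₅ u₆) ∧
      (1 / 4 : ℝ) • profileIntegral a u₁ u₂ u₃ u₄ u₅ u₆
        = Real.sqrt Real.pi • (((⟪v, n⟫ / 6 + κ / 2) • φ x t + (⟪v, n⟫ / 3 * ⟪tan, φ x t⟫) • tan
          - ((⟪v, n⟫ / 6 + 3 * κ / 2) * ⟪n, φ x t⟫) • n)
          + (⟪tan, φs⟫ • n + (2 * ⟪n, φs⟫) • tan)) := by
  have hT : 0 < T := ht.1.trans_le ht.2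
  have htI := pos_mem_Icc ht
  have hS := Γ.speed_pos i htI θ
  set X' := Γ.curveDeriv i (θ, t) with hX'
  set A := angDeriv T (Γ.curveDeriv i) (θ, t) with hA
  have hXne : X' ≠ 0 := Γ.curveDeriv_ne_zero i htI θ
  have hexp := hasExp_layerDensity hXne (Γ.inner_conormal_curveDeriv i θ)
    (Γ.hasExp_conormal i θ ht) (Γ.hasExp_displacement i θ ht) (Γ.hasExp_pullback i θ ht hφ)
  have htt : ⟪tan, tan⟫ = 1 := htan ▸ Γ.inner_tangent_self i htI θ
  have hnt : n = rotCW tan := by rw [hn, htan]; rfl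
  have hnn : ⟪n, n⟫ = 1 := by rw [hnt, inner_rotCW_rotCW, htt]
  have hntan : ⟪n, tan⟫ = 0 := by rw [hnt, inner_rotCW_self]
  have htn : ⟪tan, n⟫ = 0 := by rw [real_inner_comm, hntan]
  have hframe : ∀ w : Plane, w = ⟪tan, w⟫ • tan + ⟪n, w⟫ • n := fun w => by
    rw [hnt]; exact eq_frame htt w
  have hrotn : rotCW n = -tan := by rw [hnt, rotCW_rotCW]
  have hN' : rotCW A = ⟪tan, A⟫ • n - ⟪n, A⟫ • tan := by
    conv_lhs => rw [hframe A]
    rw [map_add, map_smul, map_smul, hrotn, ← hnt]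
    module
  have hconst := profileIntegral_frame hS htt hnn htn hntan ⟪tan, A⟫ ⟪n, A⟫ ⟪tan, v⟫ ⟪n, v⟫
    ⟪tan, φ x t⟫ ⟪n, φ x t⟫ ⟪tan, angDeriv T (Γ.pullback φ i) (θ, t)⟫
    ⟪n, angDeriv T (Γ.pullback φ i) (θ, t)⟫ (X' := X') (N₀ := Γ.conormal i (θ, t))
    (by rw [hX', Γ.curveDeriv_eq i htI, htan]) (by rw [Γ.conormal_eq i htI, hn])
    (hframe A) hN' (hframe v) (hframe _) (hframe _)
  refine ⟨_, _, _, _, _, _, _, _, real_inner_self_pos.2 hXne,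
    hexp.congr (fun p => ?_) (fun _ => rfl) (fun _ => rfl), ?_⟩
  · rw [recenter_layerFun, hx]; rfl
  · have hpull : Γ.pullback φ i (θ, t) = φ x t := by rw [hx]; rfl
    rw [hpull, ← Γ.velocity_eq hT i htI θ, ← hv]
    refine hconst.trans ?_
    rw [hκ, Γ.curvature_eq hT i htI θ, ← hn, hφs, Γ.arcDeriv_pullback hφ i htI θ]
    simp only [real_inner_smul_right]
    module

/-- The vectors `W₁` and `W₂` are frozen at the singular point, so the subtracted term is an exact
`s`-derivative on each time slice. -/
theorem exists_paraO_layerFun_sub (ht : t ∈ Ioc 0 T) (hφ : Γ.SmoothDensity φ) {x : Plane}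
    (hx : x = Γ.pos i θ t) : ∃ W₁ W₂ : Plane,
      ParaO (fun p => recenter θ t (Γ.layerFun φ x t i) p
        - exactTerm W₁ W₂ ⟪x - recenter θ t (Γ.curve i) p, x - recenter θ t (Γ.curve i) p⟫
          (-2 * ⟪x - recenter θ t (Γ.curve i) p, recenter θ t (Γ.curveDeriv i) p⟫) p.2) (-2) := by
  have h := paraO_layerDensity_sub (Γ.curveDeriv_ne_zero i (pos_mem_Icc ht) θ)
    (Γ.inner_conormal_curveDeriv i θ) (Γ.hasExp_conormal i θ ht) (Γ.hasExp_displacement i θ ht)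
    (Γ.hasExp_curveDeriv i θ ht) (Γ.hasExp_pullback i θ ht hφ)
  refine ⟨(-1 / (2 * ⟪Γ.curveDeriv i (θ, t), Γ.curveDeriv i (θ, t)⟫)) •
      (⟪Γ.curveDeriv i (θ, t), Γ.pullback φ i (θ, t)⟫ • Γ.conormal i (θ, t)
        - ⟪Γ.conormal i (θ, t), Γ.pullback φ i (θ, t)⟫ • Γ.curveDeriv i (θ, t)),
    (1 / (8 * ⟪Γ.curveDeriv i (θ, t), Γ.curveDeriv i (θ, t)⟫)) •
      ⟪Γ.curveDeriv i (θ, t), Γ.pullback φ i (θ, t)⟫ • Γ.conormal i (θ, t),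
    h.congr_all fun p => ?_⟩
  rw [recenter_layerFun, hx]
  rfl

end Expansion

/-! ### Bounds uniform over the whole boundary -/

section Bounds

variable {i : Fin m} {θ t : ℝ} {x : Plane}

theorem exists_recenter_le {f : ℝ × ℝ → Plane} (ht : t ∈ Ioc 0 T)
    (hf : ContinuousOn f (strip T)) : ∃ M > 0, ∀ s σ : ℝ, |s| ≤ Real.pi → 0 ≤ σ → σ ≤ t →
      ‖f (θ + s, t - σ)‖ ≤ M := by
  have hK : IsCompact (Icc (θ - Real.pi) (θ + Real.pi) ×ˢ Icc 0 T) := isCompact_Icc.prod isCompact_Icc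
  obtain ⟨M, hM⟩ := hK.exists_bound_of_continuousOn (hf.mono (prod_mono_left (subset_univ _)))
  refine ⟨max M 1, by positivity, fun s σ hs h0 h1 => (hM _ ⟨?_, ?_⟩).trans (le_max_left _ _)⟩
  · have := abs_le.1 hs
    exact ⟨by simp; linarith, by simp; linarith⟩
  · exact sub_mem_Icc ht h0 h1

/-- Away from the singularity, the parabolic distance has a positive lower bound. -/
theorem exists_gap (ht : t ∈ Ioc 0 T) (hx : x = Γ.pos i θ t) (j : Fin m) {r : ℝ} (hr : 0 < r) :
    ∃ c > 0, ∀ s σ : ℝ, |s| ≤ Real.pi → 0 ≤ σ → σ ≤ t → (j = i → r ≤ |s| ∨ r ≤ σ) →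
      c ≤ ⟪x - Γ.curve j (θ + s, t - σ), x - Γ.curve j (θ + s, t - σ)⟫ + σ := by
  set K : Set (ℝ × ℝ) := (Icc (-Real.pi) Real.pi ×ˢ Icc 0 t) ∩ {p | j = i → r ≤ |p.1| ∨ r ≤ p.2}
    with hK
  have hKc : IsCompact K := by
    refine (isCompact_Icc.prod isCompact_Icc).inter_right ?_
    by_cases hj : j = i
    · simp only [hj, true_imp_iff]
      exact (isClosed_le continuous_const (continuous_abs.comp continuous_fst)).union
        (isClosed_le continuous_const continuous_snd)
    · simp [hj]
  have hmaps : MapsTo (fun p : ℝ × ℝ => (θ + p.1, t - p.2)) K (strip T) := fun p hp =>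
    mem_strip.2 (sub_mem_Icc ht hp.1.2.1 hp.1.2.2)
  have hc : ContinuousOn (fun p : ℝ × ℝ => x - Γ.curve j (θ + p.1, t - p.2)) K :=
    continuousOn_const.sub ((Γ.continuousOn_curve j).comp (by fun_prop) hmaps)
  have hcont : ContinuousOn (fun p : ℝ × ℝ => ⟪x - Γ.curve j (θ + p.1, t - p.2),
      x - Γ.curve j (θ + p.1, t - p.2)⟫ + p.2) K := by
    have : ContinuousOn (fun p : ℝ × ℝ => ⟪x - Γ.curve j (θ + p.1, t - p.2),
      x - Γ.curve j (θ + p.1, t - p.2)⟫) K := hc.inner hc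
    exact this.add (by fun_prop)
  have hpos : ∀ p ∈ K, 0 < ⟪x - Γ.curve j (θ + p.1, t - p.2),
      x - Γ.curve j (θ + p.1, t - p.2)⟫ + p.2 := by
    rintro ⟨s, σ⟩ ⟨⟨hs, hσ⟩, hfar⟩
    simp only at hs hσ ⊢
    have h0 : 0 ≤ ⟪x - Γ.curve j (θ + s, t - σ), x - Γ.curve j (θ + s, t - σ)⟫ :=
      real_inner_self_nonneg
    rcases hσ.1.lt_or_eq with h | rfl
    · linarith
    · rw [add_zero]
      refine real_inner_self_pos.2 fun heq => ?_
      rw [sub_zero, sub_eq_zero, hx] at heq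
      obtain ⟨rfl, k, hk⟩ := Γ.curve_injective (pos_mem_Icc ht) (i := i) (θ := θ) heq
      have hfar := hfar rfl
      simp only at hfar
      rcases hfar with h | h
      · have hp := Real.pi_pos
        rw [add_sub_cancel_left] at hk
        have hs' : |s| ≤ Real.pi := abs_le.2 hs
        -- At `σ = 0` embeddedness makes `s` a multiple of `2π`, and `|s| ≤ π` leaves only `s = 0`,
        -- which is excluded on the component of `x`.
        have hk0 : k = 0 := by
          by_contra hne
          have : (1 : ℝ) ≤ |(k : ℝ)| := by exact_mod_cast Int.one_le_abs hne
          rw [hk, abs_mul, abs_of_pos Real.two_pi_pos] at hs'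
          nlinarith
        rw [hk, hk0] at h
        simp at h
        linarith
      · linarith
  obtain ⟨c, hc0, hcK⟩ := hKc.exists_forall_le' hcont hpos
  exact ⟨c, hc0, fun s σ hs h0 h1 hfar => hcK (s, σ) ⟨⟨abs_le.1 hs, h0, h1⟩, hfar⟩⟩

theorem exists_layerFun_le (ht : t ∈ Ioc 0 T) (hφ : Γ.SmoothDensity φ) (x : Plane) (θ : ℝ)
    (j : Fin m) {c : ℝ} (hc : 0 < c) : ∃ C > 0, ∀ s σ : ℝ, |s| ≤ Real.pi → 0 < σ → σ ≤ t →
      c ≤ ⟪x - Γ.curve j (θ + s, t - σ), x - Γ.curve j (θ + s, t - σ)⟫ + σ →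
      ‖Γ.layerFun φ x t j (θ + s, t - σ)‖ ≤ C := by
  have hT : 0 < T := ht.1.trans_le ht.2
  obtain ⟨M1, p1, h1⟩ := exists_recenter_le (θ := θ) ht (Γ.continuousOn_conormal hT j)
  obtain ⟨M2, p2, h2⟩ := exists_recenter_le (f := fun p => x - Γ.curve j p) (θ := θ) ht
    (continuousOn_const.sub (Γ.continuousOn_curve j))
  obtain ⟨M3, p3, h3⟩ := exists_recenter_le (θ := θ) ht (Γ.contDiffOn_pullback hφ j).continuousOn
  obtain ⟨C, hC, h⟩ := exists_layerDensity_le (M := M1 + M2 + M3) (by positivity) hc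
  refine ⟨C, hC, fun s σ hs h0 hσt hgap => ?_⟩
  have := h (Γ.conormal j (θ + s, t - σ)) (x - Γ.curve j (θ + s, t - σ))
    (Γ.pullback φ j (θ + s, t - σ)) σ
    (by linarith [h1 s σ hs h0.le hσt]) (by linarith [h2 s σ hs h0.le hσt])
    (by linarith [h3 s σ hs h0.le hσt]) h0 hgap
  simpa [layerFun] using this

theorem exists_exactTerm_curve_le (ht : t ∈ Ioc 0 T) (x : Plane) (θ : ℝ) (j : Fin m)
    (W₁ W₂ : Plane) {c : ℝ} (hc : 0 < c) :
    ∃ C > 0, ∀ s σ : ℝ, |s| ≤ Real.pi → 0 < σ → σ ≤ t →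
      c ≤ ⟪x - Γ.curve j (θ + s, t - σ), x - Γ.curve j (θ + s, t - σ)⟫ + σ →
      ‖exactTerm W₁ W₂ ⟪x - Γ.curve j (θ + s, t - σ), x - Γ.curve j (θ + s, t - σ)⟫
        (-2 * ⟪x - Γ.curve j (θ + s, t - σ), Γ.curveDeriv j (θ + s, t - σ)⟫) σ‖ ≤ C := by
  have hT : 0 < T := ht.1.trans_le ht.2
  obtain ⟨M1, p1, h1⟩ := exists_recenter_le (θ := θ) ht (Γ.contDiffOn_curveDeriv hT j).continuousOn
  obtain ⟨M2, p2, h2⟩ := exists_recenter_le (f := fun p => x - Γ.curve j p) (θ := θ) ht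
    (continuousOn_const.sub (Γ.continuousOn_curve j))
  obtain ⟨C, hC, h⟩ := exists_exactTerm_le W₁ W₂ (M := M2 ^ 2 + 2 * (M2 * M1)) (by positivity) hc
  refine ⟨C, hC, fun s σ hs h0 hσt hgap => h _ _ _ real_inner_self_nonneg ?_ ?_ h0 hgap⟩
  · rw [real_inner_self_eq_norm_sq]
    have := pow_le_pow_left₀ (norm_nonneg _) (h2 s σ hs h0.le hσt) 2
    have : 0 < M2 * M1 := by positivity
    linarith
  · rw [abs_mul, abs_neg, abs_two]
    have e1 := abs_real_inner_le_norm (x - Γ.curve j (θ + s, t - σ))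
      (Γ.curveDeriv j (θ + s, t - σ))
    have e2 := mul_le_mul (h2 s σ hs h0.le hσt) (h1 s σ hs h0.le hσt) (norm_nonneg _) p2.le
    have : 0 < M2 ^ 2 := by positivity
    linarith

theorem exists_layerFun_le_of_ne (ht : t ∈ Ioc 0 T) (hφ : Γ.SmoothDensity φ)
    (hx : x = Γ.pos i θ t) {j : Fin m} (hj : j ≠ i) : ∃ C > 0, ∀ s σ : ℝ, |s| ≤ Real.pi →
      0 < σ → σ ≤ t → ‖Γ.layerFun φ x t j (θ + s, t - σ)‖ ≤ C := by
  obtain ⟨c, hc, hgap⟩ := Γ.exists_gap ht hx j one_pos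
  obtain ⟨C, hC, h⟩ := Γ.exists_layerFun_le ht hφ x θ j hc
  exact ⟨C, hC, fun s σ hs h0 h1 => h s σ hs h0 h1 (hgap s σ hs h0.le h1 fun e => absurd e hj)⟩

theorem exists_layerFun_le_of_away (ht : t ∈ Ioc 0 T) (hφ : Γ.SmoothDensity φ) (x : Plane) (θ : ℝ)
    (j : Fin m) {η : ℝ} (hη : 0 < η) : ∃ C > 0, ∀ s σ : ℝ, |s| ≤ Real.pi →
      0 < σ → σ ≤ t → η < ‖x - Γ.curve j (θ + s, t - σ)‖ →
      ‖Γ.layerFun φ x t j (θ + s, t - σ)‖ ≤ C := by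
  obtain ⟨C, hC, h⟩ := Γ.exists_layerFun_le ht hφ x θ j (pow_pos hη 2)
  refine ⟨C, hC, fun s σ hs h0 h1 hfar => h s σ hs h0 h1 ?_⟩
  rw [real_inner_self_eq_norm_sq]
  have := pow_le_pow_left₀ hη.le hfar.le 2
  linarith

theorem exists_layerFun_sub_exactTerm_le (ht : t ∈ Ioc 0 T) (hφ : Γ.SmoothDensity φ)
    (hx : x = Γ.pos i θ t) : ∃ W₁ W₂ : Plane, ∃ C > 0, ∀ s σ : ℝ, |s| ≤ Real.pi →
      0 < σ → σ ≤ t → ‖Γ.layerFun φ x t i (θ + s, t - σ)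
        - exactTerm W₁ W₂ ⟪x - Γ.curve i (θ + s, t - σ), x - Γ.curve i (θ + s, t - σ)⟫
        (-2 * ⟪x - Γ.curve i (θ + s, t - σ), Γ.curveDeriv i (θ + s, t - σ)⟫) σ‖
          ≤ C / (s ^ 2 + σ) := by
  obtain ⟨W₁, W₂, hO⟩ := Γ.exists_paraO_layerFun_sub i θ ht hφ hx
  obtain ⟨C1, hC1, r, hr, h1⟩ := hO.exists_bound
  obtain ⟨c, hc, hgap⟩ := Γ.exists_gap ht hx i hr
  obtain ⟨C2, hC2, h2⟩ := Γ.exists_layerFun_le ht hφ x θ i hc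
  obtain ⟨C3, hC3, h3⟩ := Γ.exists_exactTerm_curve_le ht x θ i W₁ W₂ hc
  have ht0 := ht.1
  -- Near the origin the parabolic bound gives `C1`. Elsewhere both terms are bounded, and `π² + t`
  -- is an upper bound for `s² + σ`.
  refine ⟨W₁, W₂, C1 + (C2 + C3) * (Real.pi ^ 2 + t), by positivity, fun s σ hs h0 hσt => ?_⟩
  have hpos : 0 < s ^ 2 + σ := by positivity
  have hsum : s ^ 2 + σ ≤ Real.pi ^ 2 + t := by
    have := sq_le_sq' (abs_le.1 hs).1 (abs_le.1 hs).2
    linarith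
  rw [le_div_iff₀ hpos]
  by_cases hnear : |s| < r ∧ σ < r
  · have h := h1 (s, σ) hnear.1 h0 hnear.2
    rw [zpow_neg, zpow_ofNat, paraSize_sq h0, ← div_eq_mul_inv, le_div_iff₀ hpos] at h
    refine (show _ ≤ C1 from h).trans ?_
    have : 0 ≤ (C2 + C3) * (Real.pi ^ 2 + t) := by positivity
    linarith
  · have hfar : r ≤ |s| ∨ r ≤ σ := by
      by_contra hcon
      push Not at hcon
      exact hnear hcon
    have hg := hgap s σ hs h0.le hσt fun _ => hfar
    have := norm_sub_le_of_le (h2 s σ hs h0 hσt hg) (h3 s σ hs h0 hσt hg)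
    calc _ ≤ (C2 + C3) * (Real.pi ^ 2 + t) := by gcongr
      _ ≤ _ := by linarith

/-- In the pair sum the odd leading term cancels and the even one doubles; what remains is the
parity defect of the remainder, of order -3 + 3 = 0. -/
theorem exists_layerFun_pair_le (ht : t ∈ Ioc 0 T) (hφ : Γ.SmoothDensity φ)
    (hx : x = Γ.pos i θ t) {a : ℝ} (ha : 0 < a) {u₁ u₂ u₃ u₄ u₅ u₆ : Plane} {f₀ : ℝ × ℝ → Plane}
    (hexp : HasExp (-3) (-1) (recenter θ t (Γ.layerFun φ x t i)) f₀
      (evenProfile a u₁ u₂ u₃ u₄ u₅ u₆)) : ∃ C > 0, ∀ s σ : ℝ, |s| ≤ Real.pi →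
      0 < σ → σ ≤ t → ‖Γ.layerFun φ x t i (θ + s, t - σ) + Γ.layerFun φ x t i (θ + -s, t - σ)
        - (2 : ℝ) • evenProfile a u₁ u₂ u₃ u₄ u₅ u₆ (s, σ)‖ ≤ C := by
  obtain ⟨C1, hC1, r, hr, h1⟩ := hexp.par.exists_bound
  obtain ⟨c, hc, hgap⟩ := Γ.exists_gap ht hx i hr
  obtain ⟨C2, hC2, h2⟩ := Γ.exists_layerFun_le ht hφ x θ i hc
  obtain ⟨C3, hC3, h3⟩ := exists_evenProfile_le u₁ u₂ u₃ u₄ u₅ u₆ ha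
  set d := min (r ^ 2) r with hd
  have hd0 : 0 < d := by positivity
  refine ⟨C1 + (C2 + C2 + 2 * (C3 / d)), by positivity, fun s σ hs h0 hσt => ?_⟩
  by_cases hnear : |s| < r ∧ σ < r
  · have h := h1 (s, σ) hnear.1 h0 hnear.2
    rw [hexp.lead_flip, hexp.next_flip] at h
    norm_num at h
    have e : Γ.layerFun φ x t i (θ + s, t - σ) + Γ.layerFun φ x t i (θ + -s, t - σ)
        - (2 : ℝ) • evenProfile a u₁ u₂ u₃ u₄ u₅ u₆ (s, σ)
        = recenter θ t (Γ.layerFun φ x t i) (spaceFlip (s, σ)) + f₀ (s, σ)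
          - evenProfile a u₁ u₂ u₃ u₄ u₅ u₆ (s, σ)
          - (evenProfile a u₁ u₂ u₃ u₄ u₅ u₆ (s, σ)
            - (recenter θ t (Γ.layerFun φ x t i) (s, σ) - f₀ (s, σ))) := by
      simp only [recenter, spaceFlip]
      module
    rw [e]
    refine h.trans ?_
    have : 0 ≤ C3 / d := by positivity
    linarith
  · have hfar : r ≤ |s| ∨ r ≤ σ := by
      by_contra hcon
      push Not at hcon
      exact hnear hcon
    have hds : d ≤ s ^ 2 + σ := by
      rcases hfar with h | h
      · have : r ^ 2 ≤ s ^ 2 := by rw [← sq_abs s]; gcongr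
        linarith [min_le_left (r ^ 2) r]
      · linarith [min_le_right (r ^ 2) r, sq_nonneg s]
    have g1 := h2 s σ hs h0 hσt (hgap s σ hs h0.le hσt fun _ => hfar)
    have hs' : |-s| ≤ Real.pi := by rwa [abs_neg]
    have g2 := h2 (-s) σ hs' h0 hσt (hgap (-s) σ hs' h0.le hσt fun _ => by rwa [abs_neg])
    have g3 : ‖(2 : ℝ) • evenProfile a u₁ u₂ u₃ u₄ u₅ u₆ (s, σ)‖ ≤ 2 * (C3 / d) := by
      rw [norm_smul, Real.norm_of_nonneg zero_le_two]
      gcongr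
      exact (h3 s σ h0).trans (by gcongr)
    refine (norm_sub_le_of_le (norm_add_le_of_le g1 g2) g3).trans ?_
    linarith

end Bounds

end MovingBoundary

/-! ### Integration in the space parameter -/

theorem integral_div_sq_add_le {C σ : ℝ} (hC : 0 ≤ C) (hσ : 0 < σ) (b : ℝ) :
    ∫ s in (-b)..b, C / (s ^ 2 + σ) ≤ C * Real.pi / Real.sqrt σ := by
  have hr := Real.sqrt_pos.2 hσ
  have hsq := Real.sq_sqrt hσ.le
  have hd : ∀ s : ℝ, HasDerivAt (fun s => C / Real.sqrt σ * Real.arctan (s / Real.sqrt σ))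
      (C / (s ^ 2 + σ)) s := by
    intro s
    refine ((((hasDerivAt_id s).div_const (Real.sqrt σ)).arctan).const_mul
      (C / Real.sqrt σ)).congr_deriv ?_
    have : 0 < s ^ 2 + σ := by positivity
    simp only [id]
    rw [div_pow, hsq]
    field_simp
    rw [hsq]
    ring
  rw [intervalIntegral.integral_eq_sub_of_hasDerivAt (fun s _ => hd s)]
  · have h1 := (Real.arctan_lt_pi_div_two (b / Real.sqrt σ)).le
    rw [neg_div, Real.arctan_neg]
    have : C / Real.sqrt σ * Real.arctan (b / Real.sqrt σ) ≤ C / Real.sqrt σ * (Real.pi / 2) := by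
      gcongr
    calc _ = 2 * (C / Real.sqrt σ * Real.arctan (b / Real.sqrt σ)) := by ring
      _ ≤ 2 * (C / Real.sqrt σ * (Real.pi / 2)) := by gcongr
      _ = _ := by ring
  · apply Continuous.intervalIntegrable
    have : ∀ s : ℝ, s ^ 2 + σ ≠ 0 := fun s => by positivity
    fun_prop (disch := assumption)

/-- Only the even part contributes over a symmetric interval. -/
theorem norm_integral_le_of_pair {h : ℝ → Plane} {b C : ℝ} (hb : 0 ≤ b)
    (hint : IntervalIntegrable h volume (-b) b) (hC : ∀ s, |s| ≤ b → ‖h s + h (-s)‖ ≤ C) :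
    ‖∫ s in (-b)..b, h s‖ ≤ C * b := by
  have hneg : IntervalIntegrable (fun s => h (-s)) volume (-b) b := by
    simpa using ((IntervalIntegrable.iff_comp_neg (by finiteness)).1 hint).symm
  have h1 : (2 : ℝ) • ∫ s in (-b)..b, h s = ∫ s in (-b)..b, (h s + h (-s)) := by
    rw [intervalIntegral.integral_add hint hneg, intervalIntegral.integral_comp_neg, neg_neg,
      two_smul]
  have h2 : ‖∫ s in (-b)..b, (h s + h (-s))‖ ≤ C * |b - -b| := by
    apply intervalIntegral.norm_integral_le_of_norm_le_const
    intro s hs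
    rw [uIoc_of_le (by linarith)] at hs
    exact hC s (abs_le.2 ⟨hs.1.le, hs.2⟩)
  rw [← h1, norm_smul, Real.norm_of_nonneg zero_le_two, sub_neg_eq_add,
    abs_of_nonneg (by linarith)] at h2
  linarith

/-- Each of the two tails cut off is at most `∫_b^∞ C / s² ds = C / b`, independently of `σ`. -/
theorem exists_integral_evenProfile_sub_le {a : ℝ} (ha : 0 < a) (u₁ u₂ u₃ u₄ u₅ u₆ : Plane) {b : ℝ}
    (hb : 0 < b) : ∃ C > 0, ∀ σ : ℝ, 0 < σ →
      ‖(∫ s in (-b)..b, evenProfile a u₁ u₂ u₃ u₄ u₅ u₆ (s, σ))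
        - (Real.sqrt σ)⁻¹ • profileIntegral a u₁ u₂ u₃ u₄ u₅ u₆‖ ≤ C := by
  obtain ⟨C, hC, h⟩ := exists_evenProfile_le u₁ u₂ u₃ u₄ u₅ u₆ ha
  refine ⟨2 * (C * b⁻¹), by positivity, fun σ hσ => ?_⟩
  obtain ⟨hint, hval⟩ := integral_evenProfile u₁ u₂ u₃ u₄ u₅ u₆ ha hσ
  set E := fun s => evenProfile a u₁ u₂ u₃ u₄ u₅ u₆ (s, σ) with hE
  have heven : ∀ s, E (-s) = E s := fun s => evenProfile_neg _ _ _ _ _ _ s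
  have htail : ‖∫ s in Ioi b, E s‖ ≤ C * b⁻¹ := by
    have e : ∫ s in Ioi b, C * s ^ (-2 : ℝ) = C * b⁻¹ := by
      rw [integral_const_mul, integral_Ioi_rpow_of_lt (by norm_num) hb]
      norm_num [Real.rpow_neg_one]
    rw [← e]
    refine norm_integral_le_of_norm_le
      ((integrableOn_Ioi_rpow_of_lt (by norm_num) hb).const_mul C) ?_
    refine (ae_restrict_mem measurableSet_Ioi).mono fun s hs => ?_
    have hs0 : 0 < s := hb.trans hs
    refine (h s σ hσ).trans ?_
    rw [Real.rpow_neg hs0.le, ← div_eq_mul_inv, Real.rpow_ofNat]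
    gcongr
    linarith
  have hleft : ∫ s in Iic (-b), E s = ∫ s in Ioi b, E s := by
    rw [← integral_comp_neg_Ioi]
    simp only [heven]
  have hsplit : ∫ s, E s = (∫ s in Iic (-b), E s) + (∫ s in (-b)..b, E s) + ∫ s in Ioi b, E s := by
    rw [← intervalIntegral.integral_Iic_sub_Iic hint.integrableOn hint.integrableOn,
      add_sub_cancel, intervalIntegral.integral_Iic_add_Ioi hint.integrableOn hint.integrableOn]
  rw [← hval, hsplit, hleft]
  have : (∫ s in (-b)..b, E s) - ((∫ s in Ioi b, E s) + (∫ s in (-b)..b, E s) + ∫ s in Ioi b, E s)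
      = -((2 : ℝ) • ∫ s in Ioi b, E s) := by module
  rw [this, norm_neg, norm_smul, Real.norm_of_nonneg zero_le_two]
  gcongr

/-! ### Truncated integrals over one curve -/

namespace MovingBoundary

variable {m : ℕ} {T : ℝ} (Γ : MovingBoundary m T) {φ : Plane → ℝ → Plane}
  {i : Fin m} {θ t : ℝ} {x : Plane}

/-- The values of the displacement `s` at which the distance from `x` is more than `η`. -/
def farSet (x : Plane) (j : Fin m) (θ τ η : ℝ) : Set ℝ := {s | η < ‖x - Γ.curve j (θ + s, τ)‖}

theorem continuous_curve_slice (j : Fin m) {τ : ℝ} (hτ : τ ∈ Icc 0 T) :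
    Continuous fun s => Γ.curve j (θ + s, τ) :=
  (Γ.continuousOn_curve j).comp_continuous (by fun_prop) fun _ => mem_strip.2 hτ

theorem measurableSet_farSet (x : Plane) (j : Fin m) (θ : ℝ) {τ : ℝ} (hτ : τ ∈ Icc 0 T) (η : ℝ) :
    MeasurableSet (Γ.farSet x j θ τ η) :=
  (isOpen_lt continuous_const
    (continuous_const.sub (Γ.continuous_curve_slice j hτ)).norm).measurableSet

theorem continuous_layerFun_slice (hφ : Γ.SmoothDensity φ) (x : Plane) (j : Fin m) (θ : ℝ) {τ : ℝ}
    (hτ : τ ∈ Icc 0 T) (hτt : τ < t) (ht : t ∈ Ioc 0 T) :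
    Continuous fun s => Γ.layerFun φ x t j (θ + s, τ) :=
  (Γ.continuousOn_layerFun (ht.1.trans_le ht.2) hφ x j).comp_continuous (by fun_prop)
    fun _ => ⟨mem_strip.2 hτ, hτt⟩

/-- Periodicity moves the fundamental interval `[0, 2π)` to the one centred at the singular
parameter, where reflection in `s` makes sense. -/
theorem setIntegral_awayFrom (x : Plane) (j : Fin m) (θ η : ℝ) {τ : ℝ} (hτ : τ ∈ Icc 0 T) :
    ∫ θ' in Γ.awayFrom x η j τ, Γ.layerFun φ x t j (θ', τ)
      = ∫ s in (-Real.pi)..Real.pi, (Γ.farSet x j θ τ η).indicator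
          (fun s => Γ.layerFun φ x t j (θ + s, τ)) s := by
  set B : Set ℝ := {θ' | η < ‖x - Γ.curve j (θ', τ)‖} with hB
  have hBm : MeasurableSet B := by
    have := Γ.measurableSet_farSet x j 0 hτ η
    simp only [farSet, zero_add] at this
    exact this
  set g := B.indicator fun θ' => Γ.layerFun φ x t j (θ', τ) with hg
  have hper : Function.Periodic g (2 * Real.pi) := by
    intro θ'
    have h1 := Γ.layerFun_periodic (φ := φ) x t j hτ θ'
    have h2 := Γ.curve_periodic j hτ θ'
    simp only at h1 h2
    simp only [hg, indicator, hB, mem_ofPred_eq, h1, h2]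
  have h1 : ∫ θ' in Γ.awayFrom x η j τ, Γ.layerFun φ x t j (θ', τ)
      = ∫ θ' in (0 : ℝ)..(0 + 2 * Real.pi), g θ' := by
    have : Γ.awayFrom x η j τ = Ico 0 (2 * Real.pi) ∩ B := rfl
    rw [this, ← setIntegral_indicator hBm, integral_Ico_eq_integral_Ioc, zero_add,
      intervalIntegral.integral_of_le Real.two_pi_pos.le]
  rw [h1, hper.intervalIntegral_add_eq 0 (θ + -Real.pi),
    show θ + -Real.pi + 2 * Real.pi = θ + Real.pi by ring,
    ← intervalIntegral.integral_comp_add_left]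
  rfl

theorem hasDerivAt_distSq (x : Plane) (j : Fin m) (θ : ℝ) {τ : ℝ} (hτ : τ ∈ Icc 0 T) (s : ℝ) :
    HasDerivAt (fun s => ⟪x - Γ.curve j (θ + s, τ), x - Γ.curve j (θ + s, τ)⟫)
      (-2 * ⟪x - Γ.curve j (θ + s, τ), Γ.curveDeriv j (θ + s, τ)⟫) s := by
  have h := (HasDerivAt.comp_const_add θ s
    (hasDerivAt_angDeriv (Γ.contDiffOn_curve j) hτ (θ + s))).const_sub x
  refine (h.inner ℝ h).congr_deriv ?_
  rw [inner_neg_right, inner_neg_left, real_inner_comm (x - Γ.curve j (θ + s, τ))]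
  simp only [curveDeriv]
  ring

theorem continuous_distSq_deriv (hT : 0 < T) (x : Plane) (j : Fin m) (θ : ℝ) {τ : ℝ}
    (hτ : τ ∈ Icc 0 T) :
    Continuous fun s => -2 * ⟪x - Γ.curve j (θ + s, τ), Γ.curveDeriv j (θ + s, τ)⟫ := by
  have h1 : Continuous fun s => Γ.curveDeriv j (θ + s, τ) :=
    (Γ.contDiffOn_curveDeriv hT j).continuousOn.comp_continuous (by fun_prop)
      fun _ => mem_strip.2 hτ
  exact continuous_const.mul ((continuous_const.sub (Γ.continuous_curve_slice j hτ)).inner h1)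

/-- The excised set is a sublevel set of `q`, and `q` returns to its initial value around the closed
curve, so both exact derivatives integrate to zero over the remaining part. -/
theorem integral_exactTerm (hT : 0 < T) (W₁ W₂ x : Plane) (j : Fin m) (θ : ℝ) {τ η : ℝ}
    (hτ : τ ∈ Icc 0 T) (hη : 0 ≤ η) (σ : ℝ) :
    ∫ s in (-Real.pi)..Real.pi, (Γ.farSet x j θ τ η).indicator (fun s => exactTerm W₁ W₂
      ⟪x - Γ.curve j (θ + s, τ), x - Γ.curve j (θ + s, τ)⟫
      (-2 * ⟪x - Γ.curve j (θ + s, τ), Γ.curveDeriv j (θ + s, τ)⟫) σ) s = 0 := by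
  set q := fun s => ⟪x - Γ.curve j (θ + s, τ), x - Γ.curve j (θ + s, τ)⟫ with hq
  set q' := fun s => -2 * ⟪x - Γ.curve j (θ + s, τ), Γ.curveDeriv j (θ + s, τ)⟫ with hq'
  have hd : ∀ s, HasDerivAt q (q' s) s := Γ.hasDerivAt_distSq x j θ hτ
  have hqc : Continuous q := continuous_iff_continuousAt.2 fun s => (hd s).continuousAt
  have hq'c : Continuous q' := Γ.continuous_distSq_deriv hT x j θ hτ
  have hper : q Real.pi = q (-Real.pi) := by
    have := Γ.curve_periodic j hτ (θ + -Real.pi)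
    simp only at this
    rw [show θ + -Real.pi + 2 * Real.pi = θ + Real.pi by ring] at this
    simp only [hq, this]
  have hset : Γ.farSet x j θ τ η = {s | η ^ 2 < q s} := by
    ext s
    simp only [farSet, hq, mem_ofPred_eq, real_inner_self_eq_norm_sq]
    exact (pow_lt_pow_iff_left₀ hη (norm_nonneg _) two_ne_zero).symm
  have hm := Γ.measurableSet_farSet x j θ hτ η
  have hH := fun k => continuous_heatMoment k σ
  have z1 := integral_superlevel_comp_mul_deriv hd hq'c (hH 1) hper (η ^ 2)
  have z2 := integral_superlevel_comp_mul_deriv (K := fun y => heatMoment 2 y σ * y) hd hq'c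
    ((hH 2).mul continuous_id) hper (η ^ 2)
  rw [← hset] at z1 z2
  have c1 : Continuous fun s => heatMoment 1 (q s) σ * q' s := ((hH 1).comp hqc).mul hq'c
  have c2 : Continuous fun s => heatMoment 2 (q s) σ * q s * q' s :=
    (((hH 2).comp hqc).mul hqc).mul hq'c
  have hi : ∀ {f : ℝ → ℝ} (W : Plane) (_ : Continuous f), IntervalIntegrable
      (fun s => (Γ.farSet x j θ τ η).indicator f s • W) volume (-Real.pi) Real.pi := fun W hf =>
    ⟨((hf.intervalIntegrable _ _).1.indicator hm).smul_const W,
      ((hf.intervalIntegrable _ _).2.indicator hm).smul_const W⟩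
  have e : ∀ s, (Γ.farSet x j θ τ η).indicator (fun s => exactTerm W₁ W₂ (q s) (q' s) σ) s
      = (Γ.farSet x j θ τ η).indicator (fun s => heatMoment 1 (q s) σ * q' s) s • W₁
        + (Γ.farSet x j θ τ η).indicator (fun s => heatMoment 2 (q s) σ * q s * q' s) s • W₂ := by
    intro s
    by_cases hs : s ∈ Γ.farSet x j θ τ η <;> simp [hs, exactTerm]
  refine (intervalIntegral.integral_congr fun s _ => e s).trans ?_
  rw [intervalIntegral.integral_add (hi W₁ c1) (hi W₂ c2),
    intervalIntegral.integral_smul_const, intervalIntegral.integral_smul_const]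
  rw [z1, z2, zero_smul, zero_smul, add_zero]

end MovingBoundary

/-! ### Integrals over time slices of the boundary -/

namespace MovingBoundary

variable {m : ℕ} {T : ℝ} (Γ : MovingBoundary m T) {φ : Plane → ℝ → Plane}
  {i : Fin m} {θ t : ℝ} {x : Plane}

/-- The integral over the part of `Γ(τ)` at distance more than `η` from `x`. -/
def farSlice (φ : Plane → ℝ → Plane) (x : Plane) (t θ η τ : ℝ) : Plane :=
  ∑ j, ∫ s in (-Real.pi)..Real.pi, (Γ.farSet x j θ τ η).indicator
    (fun s => Γ.layerFun φ x t j (θ + s, τ)) s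

/-- The integral over `Γ(τ)`. -/
def fullSlice (φ : Plane → ℝ → Plane) (x : Plane) (t θ τ : ℝ) : Plane :=
  ∑ j, ∫ s in (-Real.pi)..Real.pi, Γ.layerFun φ x t j (θ + s, τ)

/-- The bound is uniform in `η`. On the component of `x` the exact term is subtracted at no cost and
the rest is dominated by `C / (s² + σ)`; on the others the integrand is bounded and `√σ ≤ √t`. -/
theorem exists_norm_farIntegral_le (ht : t ∈ Ioc 0 T) (hφ : Γ.SmoothDensity φ)
    (hx : x = Γ.pos i θ t) (j : Fin m) : ∃ C > 0, ∀ η σ : ℝ, 0 ≤ η → 0 < σ → σ ≤ t →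
      ‖∫ s in (-Real.pi)..Real.pi, (Γ.farSet x j θ (t - σ) η).indicator
        (fun s => Γ.layerFun φ x t j (θ + s, t - σ)) s‖ ≤ C / Real.sqrt σ := by
  have hT : 0 < T := ht.1.trans_le ht.2
  have hpi : -Real.pi ≤ Real.pi := by linarith [Real.pi_pos]
  by_cases hj : j = i
  · subst hj
    obtain ⟨W₁, W₂, C, hC, h⟩ := Γ.exists_layerFun_sub_exactTerm_le ht hφ hx
    refine ⟨C * Real.pi, by positivity, fun η σ hη h0 h1 => ?_⟩
    have hτ := sub_mem_Icc ht h0.le h1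
    have hm := Γ.measurableSet_farSet x j θ hτ η
    set S := Γ.farSet x j θ (t - σ) η with hS
    set F := fun s => Γ.layerFun φ x t j (θ + s, t - σ) with hF
    set G := fun s => exactTerm W₁ W₂
      ⟪x - Γ.curve j (θ + s, t - σ), x - Γ.curve j (θ + s, t - σ)⟫
      (-2 * ⟪x - Γ.curve j (θ + s, t - σ), Γ.curveDeriv j (θ + s, t - σ)⟫) σ with hG
    have hFc : Continuous F := Γ.continuous_layerFun_slice hφ x j θ hτ (by linarith) ht
    have hGc : Continuous G := by
      have hq : Continuous fun s => ⟪x - Γ.curve j (θ + s, t - σ), x - Γ.curve j (θ + s, t - σ)⟫ :=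
        continuous_iff_continuousAt.2 fun s => (Γ.hasDerivAt_distSq x j θ hτ s).continuousAt
      have hq' := Γ.continuous_distSq_deriv hT x j θ hτ
      exact ((((continuous_heatMoment 1 σ).comp hq).mul hq').smul continuous_const).add
        (((((continuous_heatMoment 2 σ).comp hq).mul hq).mul hq').smul continuous_const)
    have hi : ∀ {f : ℝ → Plane} (_ : Continuous f), IntervalIntegrable (S.indicator f) volume
        (-Real.pi) Real.pi := fun hf =>
      ⟨(hf.intervalIntegrable _ _).1.indicator hm, (hf.intervalIntegrable _ _).2.indicator hm⟩
    have hzero : ∫ s in (-Real.pi)..Real.pi, S.indicator G s = 0 :=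
      Γ.integral_exactTerm hT W₁ W₂ x j θ hτ hη σ
    have e : ∫ s in (-Real.pi)..Real.pi, S.indicator F s
        = ∫ s in (-Real.pi)..Real.pi, S.indicator (fun s => F s - G s) s := by
      have h2 := intervalIntegral.integral_sub (hi hFc) (hi hGc)
      rw [hzero, sub_zero] at h2
      rw [← h2]
      refine intervalIntegral.integral_congr fun s _ => ?_
      by_cases hs : s ∈ S <;> simp [hs]
    rw [e]
    refine (intervalIntegral.norm_integral_le_of_norm_le (g := fun s => C / (s ^ 2 + σ)) hpi
      (ae_of_all _ fun s hs => ?_) ?_).trans (integral_div_sq_add_le hC.le h0 Real.pi)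
    · refine (norm_indicator_le_norm_self _ _).trans ?_
      exact h s σ (abs_le.2 ⟨hs.1.le, hs.2⟩) h0 h1
    · apply Continuous.intervalIntegrable
      have : ∀ s : ℝ, s ^ 2 + σ ≠ 0 := fun s => by positivity
      fun_prop (disch := assumption)
  · obtain ⟨C, hC, h⟩ := Γ.exists_layerFun_le_of_ne ht hφ hx hj
    have ht0 := ht.1
    refine ⟨C * (2 * Real.pi) * Real.sqrt t, by positivity, fun η σ _ h0 h1 => ?_⟩
    have hb : ‖∫ s in (-Real.pi)..Real.pi, (Γ.farSet x j θ (t - σ) η).indicator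
        (fun s => Γ.layerFun φ x t j (θ + s, t - σ)) s‖ ≤ C * |Real.pi - -Real.pi| := by
      apply intervalIntegral.norm_integral_le_of_norm_le_const
      intro s hs
      rw [uIoc_of_le hpi] at hs
      exact (norm_indicator_le_norm_self _ _).trans (h s σ (abs_le.2 ⟨hs.1.le, hs.2⟩) h0 h1)
    rw [show Real.pi - -Real.pi = 2 * Real.pi by ring, abs_of_pos Real.two_pi_pos] at hb
    refine hb.trans ?_
    rw [le_div_iff₀ (Real.sqrt_pos.2 h0)]
    gcongr

theorem exists_norm_farSlice_le (ht : t ∈ Ioc 0 T) (hφ : Γ.SmoothDensity φ)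
    (hx : x = Γ.pos i θ t) : ∃ C > 0, ∀ η σ : ℝ, 0 ≤ η → 0 < σ → σ ≤ t →
      ‖Γ.farSlice φ x t θ η (t - σ)‖ ≤ C / Real.sqrt σ := by
  choose C hC h using Γ.exists_norm_farIntegral_le ht hφ hx
  refine ⟨∑ j, C j, Finset.sum_pos (fun j _ => hC j) ⟨i, Finset.mem_univ i⟩,
    fun η σ hη h0 h1 => ?_⟩
  rw [Finset.sum_div]
  exact norm_sum_le_of_le _ fun j _ => h j η σ hη h0 h1

theorem layerDensity_zero (n p : Plane) (σ : ℝ) : layerDensity n 0 p σ = 0 := by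
  simp [layerDensity]

theorem tendsto_farSlice (ht : t ∈ Ioc 0 T) (hφ : Γ.SmoothDensity φ) (x : Plane) (θ : ℝ) {τ : ℝ}
    (hτ : τ ∈ Icc 0 T) (hτt : τ < t) :
    Tendsto (fun η => Γ.farSlice φ x t θ η τ) (𝓝[>] 0) (𝓝 (Γ.fullSlice φ x t θ τ)) := by
  refine tendsto_finsetSum _ fun j _ => ?_
  have hc := Γ.continuous_layerFun_slice hφ x j θ hτ hτt ht
  apply intervalIntegral.tendsto_integral_filter_of_dominated_convergence
    (fun s => ‖Γ.layerFun φ x t j (θ + s, τ)‖)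
  · exact Eventually.of_forall fun η =>
      hc.aestronglyMeasurable.indicator (Γ.measurableSet_farSet x j θ hτ η)
  · exact Eventually.of_forall fun η => ae_of_all _ fun s _ => norm_indicator_le_norm_self _ _
  · exact hc.norm.intervalIntegrable _ _
  · refine ae_of_all _ fun s _ => tendsto_const_nhds.congr' ?_
    -- A point at zero distance from `x` is never in the far set, but there the integrand is zero.
    by_cases hs : x - Γ.curve j (θ + s, τ) = 0
    · refine Eventually.of_forall fun η => ?_
      have : Γ.layerFun φ x t j (θ + s, τ) = 0 := by rw [layerFun, hs, layerDensity_zero]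
      simp [indicator, this]
    · filter_upwards [mem_nhdsWithin_of_mem_nhds (Iio_mem_nhds (norm_pos_iff.2 hs))] with η hη
      rw [indicator_of_mem (show s ∈ Γ.farSet x j θ τ η from hη)]

/-- On the component of `x`, pairing `s` with `-s` replaces the integrand by the even profile up to
a bounded error, and extending the profile to the line costs another; the remaining components
contribute a bounded amount. -/
theorem exists_fullSlice_sub_le (ht : t ∈ Ioc 0 T) (hφ : Γ.SmoothDensity φ)
    (hx : x = Γ.pos i θ t) {a : ℝ} (ha : 0 < a) {u₁ u₂ u₃ u₄ u₅ u₆ : Plane} {f₀ : ℝ × ℝ → Plane}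
    (hexp : HasExp (-3) (-1) (recenter θ t (Γ.layerFun φ x t i)) f₀
      (evenProfile a u₁ u₂ u₃ u₄ u₅ u₆)) : ∃ C > 0, ∀ σ : ℝ, 0 < σ → σ ≤ t →
      ‖Γ.fullSlice φ x t θ (t - σ)
        - (Real.sqrt σ)⁻¹ • profileIntegral a u₁ u₂ u₃ u₄ u₅ u₆‖ ≤ C := by
  have hpi : -Real.pi ≤ Real.pi := by linarith [Real.pi_pos]
  obtain ⟨C1, hC1, h1⟩ := Γ.exists_layerFun_pair_le ht hφ hx ha hexp
  obtain ⟨C2, hC2, h2⟩ := exists_integral_evenProfile_sub_le ha u₁ u₂ u₃ u₄ u₅ u₆ Real.pi_pos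
  have h3 : ∀ j : Fin m, ∃ C > 0, j ≠ i → ∀ s σ : ℝ, |s| ≤ Real.pi →
      0 < σ → σ ≤ t → ‖Γ.layerFun φ x t j (θ + s, t - σ)‖ ≤ C := by
    intro j
    by_cases hj : j = i
    · exact ⟨1, one_pos, fun h => absurd hj h⟩
    · obtain ⟨C, hC, h⟩ := Γ.exists_layerFun_le_of_ne ht hφ hx hj
      exact ⟨C, hC, fun _ => h⟩
  choose C3 hC3 h3 using h3
  refine ⟨C1 * Real.pi + C2 + ∑ j, C3 j * (2 * Real.pi), ?_, fun σ h0 hσt => ?_⟩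
  · have : 0 ≤ ∑ j, C3 j * (2 * Real.pi) := Finset.sum_nonneg fun j _ => by
      have := hC3 j
      positivity
    positivity
  have hτ := sub_mem_Icc ht h0.le hσt
  have hE := (integral_evenProfile u₁ u₂ u₃ u₄ u₅ u₆ ha h0).1.intervalIntegrable
    (a := -Real.pi) (b := Real.pi)
  have hF := fun j => (Γ.continuous_layerFun_slice hφ x j θ hτ (by linarith) ht).intervalIntegrable
    (μ := volume) (-Real.pi) Real.pi
  have hmain : ‖(∫ s in (-Real.pi)..Real.pi, Γ.layerFun φ x t i (θ + s, t - σ))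
      - ∫ s in (-Real.pi)..Real.pi, evenProfile a u₁ u₂ u₃ u₄ u₅ u₆ (s, σ)‖ ≤ C1 * Real.pi := by
    rw [← intervalIntegral.integral_sub (hF i) hE]
    refine norm_integral_le_of_pair Real.pi_pos.le ((hF i).sub hE) fun s hs => ?_
    have := h1 s σ hs h0 hσt
    rw [evenProfile_neg]
    convert this using 2
    module
  have hother : ‖∑ j ∈ Finset.univ.erase i, ∫ s in (-Real.pi)..Real.pi,
      Γ.layerFun φ x t j (θ + s, t - σ)‖ ≤ ∑ j, C3 j * (2 * Real.pi) := by
    refine (norm_sum_le_of_le (f := fun j => ∫ s in (-Real.pi)..Real.pi,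
      Γ.layerFun φ x t j (θ + s, t - σ)) (n := fun j => C3 j * (2 * Real.pi)) _
      fun j hj => ?_).trans (Finset.sum_le_sum_of_subset_of_nonneg (Finset.erase_subset _ _)
        fun j _ _ => by have := hC3 j; positivity)
    have hb : ‖∫ s in (-Real.pi)..Real.pi, Γ.layerFun φ x t j (θ + s, t - σ)‖
        ≤ C3 j * |Real.pi - -Real.pi| := by
      apply intervalIntegral.norm_integral_le_of_norm_le_const
      intro s hs
      rw [uIoc_of_le hpi] at hs
      exact h3 j (Finset.ne_of_mem_erase hj) s σ (abs_le.2 ⟨hs.1.le, hs.2⟩) h0 hσt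
    rwa [show Real.pi - -Real.pi = 2 * Real.pi by ring, abs_of_pos Real.two_pi_pos] at hb
  rw [fullSlice, ← Finset.add_sum_erase _ _ (Finset.mem_univ i)]
  refine (congrArg norm ?_).trans_le (norm_add_le_of_le (norm_add_le_of_le hmain (h2 σ h0)) hother)
  abel

theorem integrableOn_layerFun (ht : t ∈ Ioc 0 T) (hφ : Γ.SmoothDensity φ) (x : Plane) (j : Fin m)
    {ε η : ℝ} (hε : ε ∈ Ioc 0 t) (hη : 0 < η) :
    MeasurableSet {p : ℝ × ℝ | p.1 ∈ Ioo (t - ε) t ∧ p.2 ∈ Γ.awayFrom x η j p.1} ∧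
    IntegrableOn (fun p : ℝ × ℝ => Γ.layerFun φ x t j (p.2, p.1))
      {p : ℝ × ℝ | p.1 ∈ Ioo (t - ε) t ∧ p.2 ∈ Γ.awayFrom x η j p.1} := by
  have hT : 0 < T := ht.1.trans_le ht.2
  set U : Set (ℝ × ℝ) := Ioo (t - ε) t ×ˢ univ with hU
  have hUo : IsOpen U := isOpen_Ioo.prod isOpen_univ
  have hmaps : MapsTo Prod.swap U (strip T ∩ {p : ℝ × ℝ | p.2 < t}) := by
    rintro ⟨τ, θ'⟩ ⟨hτ, -⟩
    simp only at hτ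
    exact ⟨mem_strip.2 ⟨by simp; linarith [hτ.1, hε.2], by simp; linarith [hτ.2, ht.2]⟩, hτ.2⟩
  have hFc : ContinuousOn (fun p : ℝ × ℝ => Γ.layerFun φ x t j (p.2, p.1)) U :=
    (Γ.continuousOn_layerFun hT hφ x j).comp continuous_swap.continuousOn hmaps
  have hXc : ContinuousOn (fun p : ℝ × ℝ => ‖x - Γ.curve j (p.2, p.1)‖) U :=
    (continuousOn_const.sub ((Γ.continuousOn_curve j).comp continuous_swap.continuousOn
      (hmaps.mono_right inter_subset_left))).norm
  set S := {p : ℝ × ℝ | p.1 ∈ Ioo (t - ε) t ∧ p.2 ∈ Γ.awayFrom x η j p.1} with hS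
  have hSeq : S = (U ∩ (fun p : ℝ × ℝ => ‖x - Γ.curve j (p.2, p.1)‖) ⁻¹' Ioi η)
      ∩ (univ ×ˢ Ico 0 (2 * Real.pi)) := by
    ext ⟨τ, θ'⟩
    simp only [hS, hU, awayFrom, curve, mem_ofPred_eq, mem_inter_iff, mem_prod, mem_univ,
      mem_preimage, mem_Ioi, and_true, true_and]
    tauto
  have hSm : MeasurableSet S := by
    rw [hSeq]
    exact (hXc.isOpen_inter_preimage hUo isOpen_Ioi).measurableSet.inter
      (MeasurableSet.univ.prod measurableSet_Ico)
  have hSU : S ⊆ U := by rw [hSeq]; exact fun p hp => hp.1.1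
  have hfin : volume S ≠ ⊤ := by
    have hsub : S ⊆ Icc (t - ε) t ×ˢ Icc 0 (2 * Real.pi) := by
      rintro ⟨τ, θ'⟩ ⟨h1, h2⟩
      exact ⟨Ioo_subset_Icc_self h1, Ico_subset_Icc_self h2.1⟩
    exact ((isCompact_Icc.prod isCompact_Icc).measure_lt_top.trans_le' (measure_mono hsub)).ne
  -- Centring at `π` turns the parameter interval `[0, 2π)` into displacements with `|s| ≤ π`.
  obtain ⟨C, hC, h⟩ := Γ.exists_layerFun_le_of_away ht hφ x Real.pi j hη
  have : IsFiniteMeasure (volume.restrict S) := isFiniteMeasure_restrict.2 hfin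
  refine ⟨hSm, Integrable.of_bound ((hFc.mono hSU).aestronglyMeasurable hSm) C ?_⟩
  refine (ae_restrict_mem hSm).mono ?_
  rintro ⟨τ, θ'⟩ ⟨h1, h2, h3⟩
  simp only at h1 h2 h3 ⊢
  have := h (θ' - Real.pi) (t - τ) (abs_le.2 ⟨by linarith [h2.1], by linarith [h2.2]⟩)
    (by linarith [h1.2]) (by linarith [h1.1, hε.2])
  simp only [add_sub_cancel, sub_sub_cancel] at this
  exact this h3

/-- Measurability in time is inherited, through Fubini, from the absolute integrability of the
truncated space-time integrand. -/
theorem aestronglyMeasurable_farSlice (ht : t ∈ Ioc 0 T) (hφ : Γ.SmoothDensity φ) (x : Plane)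
    (θ : ℝ) {ε η : ℝ} (hε : ε ∈ Ioc 0 t) (hη : 0 < η) :
    AEStronglyMeasurable (Γ.farSlice φ x t θ η) (volume.restrict (Ioo (t - ε) t)) := by
  have key : ∀ j : Fin m, AEStronglyMeasurable (fun τ => ∫ s in (-Real.pi)..Real.pi,
      (Γ.farSet x j θ τ η).indicator (fun s => Γ.layerFun φ x t j (θ + s, τ)) s)
      (volume.restrict (Ioo (t - ε) t)) := by
    intro j
    obtain ⟨hSm, hS⟩ := Γ.integrableOn_layerFun ht hφ x j hε hη
    rw [← integrable_indicator_iff hSm, Measure.volume_eq_prod] at hS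
    refine hS.integral_prod_left.aestronglyMeasurable.restrict.congr ?_
    refine (ae_restrict_mem measurableSet_Ioo).mono fun τ hτ => ?_
    have hτI : τ ∈ Icc 0 T := ⟨by linarith [hτ.1, hε.2], by linarith [hτ.2, ht.2]⟩
    simp only
    rw [← Γ.setIntegral_awayFrom x j θ η hτI, ← integral_indicator]
    · refine integral_congr_ae (ae_of_all _ fun θ' => ?_)
      beta_reduce
      by_cases h : θ' ∈ Γ.awayFrom x η j τ
      · rw [indicator_of_mem h, indicator_of_mem]
        exact ⟨hτ, h⟩
      · rw [indicator_of_notMem h, indicator_of_notMem]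
        exact fun h' => h h'.2
    · have h0 := Γ.measurableSet_farSet x j 0 hτI η
      simp only [farSet, zero_add] at h0
      exact measurableSet_Ico.inter h0
  have := Finset.aestronglyMeasurable_sum (μ := volume.restrict (Ioo (t - ε) t)) Finset.univ
    fun j _ => key j
  refine this.congr (ae_of_all _ fun τ => ?_)
  simp [farSlice]

end MovingBoundary

/-! ### Integration in time and the principal value -/

theorem integral_inv_sqrt_sub (t : ℝ) {ε : ℝ} (hε : 0 ≤ ε) :
    IntervalIntegrable (fun τ => (Real.sqrt (t - τ))⁻¹) volume (t - ε) t ∧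
    ∫ τ in (t - ε)..t, (Real.sqrt (t - τ))⁻¹ = 2 * Real.sqrt ε := by
  have e : ∀ σ : ℝ, 0 ≤ σ → (Real.sqrt σ)⁻¹ = σ ^ (-(1 / 2) : ℝ) := fun σ hσ => by
    rw [Real.rpow_neg hσ, Real.sqrt_eq_rpow]
  have h0 : IntervalIntegrable (fun σ => (Real.sqrt σ)⁻¹) volume 0 ε := by
    refine (intervalIntegral.intervalIntegrable_rpow' (r := -(1 / 2)) (by norm_num)).congr ?_
    intro σ hσ
    rw [uIoc_of_le hε] at hσ
    exact (e σ hσ.1.le).symm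
  constructor
  · simpa using (h0.comp_sub_left t).symm
  · rw [intervalIntegral.integral_comp_sub_left (fun σ => (Real.sqrt σ)⁻¹) t, sub_self,
      sub_sub_cancel]
    have : ∫ σ in (0 : ℝ)..ε, (Real.sqrt σ)⁻¹ = ∫ σ in (0 : ℝ)..ε, σ ^ (-(1 / 2) : ℝ) := by
      refine intervalIntegral.integral_congr fun σ hσ => ?_
      rw [uIcc_of_le hε] at hσ
      exact e σ hσ.1
    rw [this, integral_rpow (Or.inl (by norm_num)), Real.zero_rpow (by norm_num),
      Real.sqrt_eq_rpow]
    norm_num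
    ring

namespace MovingBoundary

variable {m : ℕ} {T : ℝ} (Γ : MovingBoundary m T) {φ : Plane → ℝ → Plane}
  {i : Fin m} {θ t : ℝ} {x : Plane}

/-- The principal value: the iterated integral, in which the integration over `Γ(τ)` comes first. -/
def iteratedPV (φ : Plane → ℝ → Plane) (x : Plane) (t θ ε : ℝ) : Plane :=
  ∫ τ in (t - ε)..t, (1 / (8 * Real.pi)) • Γ.fullSlice φ x t θ τ

theorem sum_setIntegral_dlIntegrand (φ : Plane → ℝ → Plane) (x : Plane) (θ η : ℝ) {τ : ℝ}
    (hτ : τ ∈ Icc 0 T) (hτt : τ < t) :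
    ∑ j, ∫ θ' in Γ.awayFrom x η j τ, Γ.dlIntegrand φ x t j θ' τ
      = (1 / (8 * Real.pi)) • Γ.farSlice φ x t θ η τ := by
  rw [farSlice, Finset.smul_sum]
  refine Finset.sum_congr rfl fun j _ => ?_
  rw [← Γ.setIntegral_awayFrom x j θ η hτ, ← integral_smul]
  exact integral_congr_ae (ae_of_all _ fun θ' => Γ.dlIntegrand_eq x j hτ hτt θ')

/-- Discards the instant `τ = t`, at which the formulas for positive elapsed time are not available.
-/
theorem ae_mem_Ioo (t ε : ℝ) : ∀ᵐ τ : ℝ, τ ∈ uIoc (t - ε) t → 0 ≤ ε → τ ∈ Ioo (t - ε) t := by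
  have : ∀ᵐ τ : ℝ, τ ≠ t := by simp [ae_iff]
  filter_upwards [this] with τ h1 h2 h3
  rw [uIoc_of_le (by linarith)] at h2
  exact ⟨h2.1, lt_of_le_of_ne h2.2 h1⟩

/-- Dominated convergence in `τ`: the slices converge for each `τ < t`, and `C / √(t - τ)` is an
integrable majorant independent of `η`. -/
theorem tendsto_farIntegral (ht : t ∈ Ioc 0 T) (hφ : Γ.SmoothDensity φ)
    (hx : x = Γ.pos i θ t) {ε : ℝ} (hε : ε ∈ Ioc 0 t) :
    IntervalIntegrable (Γ.fullSlice φ x t θ) volume (t - ε) t ∧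
    Tendsto (fun η : ℝ => ∫ τ in (t - ε)..t, ∑ j, ∫ θ' in Γ.awayFrom x η j τ,
      Γ.dlIntegrand φ x t j θ' τ) (𝓝[>] 0) (𝓝 (Γ.iteratedPV φ x t θ ε)) := by
  obtain ⟨C, hC, hb⟩ := Γ.exists_norm_farSlice_le ht hφ hx
  have hle : t - ε ≤ t := by linarith [hε.1]
  obtain ⟨hint, -⟩ := integral_inv_sqrt_sub t hε.1.le
  have hmem : ∀ τ ∈ Ioo (t - ε) t, τ ∈ Icc 0 T := fun τ hτ =>
    ⟨by linarith [hτ.1, hε.2], by linarith [hτ.2, ht.2]⟩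
  have hbound : ∀ η, 0 < η → ∀ τ ∈ Ioo (t - ε) t,
      ‖Γ.farSlice φ x t θ η τ‖ ≤ C * (Real.sqrt (t - τ))⁻¹ := by
    intro η hη τ hτ
    have := hb η (t - τ) hη.le (by linarith [hτ.2]) (by linarith [hτ.1, hε.2])
    rwa [sub_sub_cancel, div_eq_mul_inv] at this
  have hrestrict : volume.restrict (uIoc (t - ε) t) = volume.restrict (Ioo (t - ε) t) := by
    rw [uIoc_of_le hle, restrict_Ioo_eq_restrict_Ioc]
  have hpos : ∀ᶠ η : ℝ in 𝓝[>] 0, 0 < η := eventually_mem_nhdsWithin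
  have hlim := fun τ (hτ : τ ∈ Ioo (t - ε) t) => Γ.tendsto_farSlice ht hφ x θ (hmem τ hτ) hτ.2
  have hmeas : AEStronglyMeasurable (Γ.fullSlice φ x t θ) (volume.restrict (Ioo (t - ε) t)) := by
    -- A countable sequence of radii suffices to make the limit of the slices measurable.
    have hseq : Tendsto (fun k : ℕ => (1 / ((k : ℝ) + 1))) atTop (𝓝[>] 0) :=
      tendsto_nhdsWithin_of_tendsto_nhds_of_eventually_within _
        tendsto_one_div_add_atTop_nhds_zero_nat
        (Eventually.of_forall fun k => by simp only [mem_Ioi]; positivity)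
    refine aestronglyMeasurable_of_tendsto_ae atTop
      (f := fun k : ℕ => Γ.farSlice φ x t θ (1 / ((k : ℝ) + 1)))
      (fun k => Γ.aestronglyMeasurable_farSlice ht hφ x θ hε (by positivity)) ?_
    exact (ae_restrict_mem measurableSet_Ioo).mono fun τ hτ => (hlim τ hτ).comp hseq
  constructor
  · rw [intervalIntegrable_iff, IntegrableOn, hrestrict]
    refine Integrable.mono' (g := fun τ => C * (Real.sqrt (t - τ))⁻¹) ?_ hmeas ?_
    · have := hint.const_mul C
      rwa [intervalIntegrable_iff, IntegrableOn, hrestrict] at this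
    · refine (ae_restrict_mem measurableSet_Ioo).mono fun τ hτ => ?_
      exact le_of_tendsto (hlim τ hτ).norm (hpos.mono fun η hη => hbound η hη τ hτ)
  · apply intervalIntegral.tendsto_integral_filter_of_dominated_convergence
      (fun τ => ‖(1 / (8 * Real.pi) : ℝ)‖ * (C * (Real.sqrt (t - τ))⁻¹))
    · filter_upwards [hpos] with η hη
      rw [hrestrict]
      refine ((Γ.aestronglyMeasurable_farSlice ht hφ x θ hε hη).const_smul
        (1 / (8 * Real.pi))).congr ?_
      refine (ae_restrict_mem measurableSet_Ioo).mono fun τ hτ => ?_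
      exact (Γ.sum_setIntegral_dlIntegrand φ x θ η (hmem τ hτ) hτ.2).symm
    · filter_upwards [hpos] with η hη
      filter_upwards [ae_mem_Ioo t ε] with τ h1 h2
      have hτ := h1 h2 hε.1.le
      rw [Γ.sum_setIntegral_dlIntegrand φ x θ η (hmem τ hτ) hτ.2, norm_smul]
      gcongr
      exact hbound η hη τ hτ
    · exact (hint.const_mul C).const_mul _
    · filter_upwards [ae_mem_Ioo t ε] with τ h1 h2
      have hτ := h1 h2 hε.1.le
      refine ((hlim τ hτ).const_smul (1 / (8 * Real.pi))).congr fun η => ?_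
      exact (Γ.sum_setIntegral_dlIntegrand φ x θ η (hmem τ hτ) hτ.2).symm

theorem isDoubleLayerPV_iteratedPV (ht : t ∈ Ioc 0 T) (hφ : Γ.SmoothDensity φ)
    (hx : x = Γ.pos i θ t) {ε : ℝ} (hε : ε ∈ Ioc 0 t) :
    Γ.IsDoubleLayerPV φ x t ε (Γ.iteratedPV φ x t θ ε) := by
  refine ⟨fun η hη j => ?_, (Γ.tendsto_farIntegral ht hφ hx hε).2⟩
  obtain ⟨hSm, hS⟩ := Γ.integrableOn_layerFun ht hφ x j hε hη
  refine Integrable.congr (hS.smul (1 / (8 * Real.pi))) ?_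
  refine (ae_restrict_mem hSm).mono fun p hp => ?_
  exact (Γ.dlIntegrand_eq x j ⟨by linarith [hp.1.1, hε.2], by linarith [hp.1.2, ht.2]⟩
    hp.1.2 p.2).symm

/-- The expansion of the principal value, with the constant given by the even profile. -/
theorem exists_iteratedPV_sub_le (ht : t ∈ Ioc 0 T) (hφ : Γ.SmoothDensity φ)
    (hx : x = Γ.pos i θ t) {a : ℝ} (ha : 0 < a) {u₁ u₂ u₃ u₄ u₅ u₆ : Plane} {f₀ : ℝ × ℝ → Plane}
    (hexp : HasExp (-3) (-1) (recenter θ t (Γ.layerFun φ x t i)) f₀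
      (evenProfile a u₁ u₂ u₃ u₄ u₅ u₆)) : ∃ C > 0, ∀ ε ∈ Ioc 0 t,
      ‖Γ.iteratedPV φ x t θ ε - (Real.sqrt ε / Real.pi) •
        (1 / 4 : ℝ) • profileIntegral a u₁ u₂ u₃ u₄ u₅ u₆‖ ≤ C * ε := by
  obtain ⟨C, hC, h⟩ := Γ.exists_fullSlice_sub_le ht hφ hx ha hexp
  have hpi := Real.pi_pos
  refine ⟨1 / (8 * Real.pi) * C, by positivity, fun ε hε => ?_⟩
  set P := profileIntegral a u₁ u₂ u₃ u₄ u₅ u₆ with hP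
  obtain ⟨hint, hval⟩ := integral_inv_sqrt_sub t hε.1.le
  have hF := (Γ.tendsto_farIntegral ht hφ hx hε).1
  have hsub : ∫ τ in (t - ε)..t, (Γ.fullSlice φ x t θ τ - (Real.sqrt (t - τ))⁻¹ • P)
      = (∫ τ in (t - ε)..t, Γ.fullSlice φ x t θ τ) - (2 * Real.sqrt ε) • P := by
    have hPint : IntervalIntegrable (fun τ => (Real.sqrt (t - τ))⁻¹ • P) volume (t - ε) t :=
      ⟨hint.1.smul_const P, hint.2.smul_const P⟩
    rw [intervalIntegral.integral_sub hF hPint, intervalIntegral.integral_smul_const, hval]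
  have hb : ‖∫ τ in (t - ε)..t, (Γ.fullSlice φ x t θ τ - (Real.sqrt (t - τ))⁻¹ • P)‖
      ≤ C * |t - (t - ε)| := by
    apply intervalIntegral.norm_integral_le_of_norm_le_const_ae
    filter_upwards [ae_mem_Ioo t ε] with τ h1 h2
    have hτ := h1 h2 hε.1.le
    have := h (t - τ) (by linarith [hτ.2]) (by linarith [hτ.1, hε.2])
    rwa [sub_sub_cancel] at this
  rw [sub_sub_cancel, abs_of_pos hε.1] at hb
  -- The factor `1/(8π)` of the kernel times `∫ σ^{-1/2} dσ = 2√ε` equals `√ε/π` times 1/4.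
  have e : Γ.iteratedPV φ x t θ ε - (Real.sqrt ε / Real.pi) • (1 / 4 : ℝ) • P
      = (1 / (8 * Real.pi)) •
        ∫ τ in (t - ε)..t, (Γ.fullSlice φ x t θ τ - (Real.sqrt (t - τ))⁻¹ • P) := by
    rw [hsub, iteratedPV, intervalIntegral.integral_smul]
    match_scalars <;> field_simp <;> ring
  rw [e, norm_smul, Real.norm_of_nonneg (by positivity), mul_assoc]
  gcongr

end MovingBoundary

end

theorem mainTheorem2 {m : ℕ} {T : ℝ} (Γ : MovingBoundary m T) (φ : Plane → ℝ → Plane)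
    (hφ : Γ.SmoothDensity φ) (i : Fin m) (θ t : ℝ) (ht : t ∈ Ioc 0 T)
    (x n tan v φs : Plane) (κ : ℝ)
    (hx : x = Γ.pos i θ t) (hn : n = Γ.normal i θ t) (htan : tan = Γ.tangent i θ t)
    (hv : v = Γ.velocity i θ t) (hκ : κ = Γ.curvature i θ t)
    (hφs : φs = Γ.arcDeriv i t (fun θ' => φ (Γ.pos i θ' t) t) θ) :
    ∃ D : ℝ → Plane,
      (∀ ε ∈ Ioc 0 t, Γ.IsDoubleLayerPV φ x t ε (D ε)) ∧
      (fun ε : ℝ => D ε -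
        (Real.sqrt (ε / Real.pi) •
            ((⟪v, n⟫ / 6 + κ / 2) • (1 : Plane →L[ℝ] Plane) + (⟪v, n⟫ / 3) • dyad tan tan
              - (⟪v, n⟫ / 6 + 3 * κ / 2) • dyad n n) (φ x t)
          + Real.sqrt (ε / Real.pi) • (dyad n tan + (2 : ℝ) • dyad tan n) φs))
        =O[𝓝[>] 0] (fun ε : ℝ => ε) := by
  obtain ⟨a, u₁, u₂, u₃, u₄, u₅, u₆, f₀, ha, hexp, hconst⟩ :=
    Γ.exists_hasExp_layerFun i θ ht hφ hx hn htan hv hκ hφs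
  obtain ⟨C, -, hC⟩ := Γ.exists_iteratedPV_sub_le ht hφ hx ha hexp
  refine ⟨Γ.iteratedPV φ x t θ, fun ε hε => Γ.isDoubleLayerPV_iteratedPV ht hφ hx hε, ?_⟩
  refine IsBigO.of_bound C ?_
  filter_upwards [Ioc_mem_nhdsGT ht.1] with ε hε
  rw [Real.norm_of_nonneg hε.1.le]
  refine le_trans (le_of_eq ?_) (hC ε hε)
  -- The `√π` of the Gaussian moments combines with `√ε/π` into `√(ε/π)`.
  have hsqrt : Real.sqrt (ε / Real.pi) = Real.sqrt ε / Real.pi * Real.sqrt Real.pi := by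
    have hpi := Real.sqrt_pos.2 Real.pi_pos
    have hsq := Real.mul_self_sqrt Real.pi_pos.le
    rw [Real.sqrt_div hε.1.le, div_eq_iff hpi.ne', mul_assoc, hsq,
      div_mul_cancel₀ _ Real.pi_pos.ne']
  have hdyad : ∀ p q w : Plane, dyad p q w = ⟪q, w⟫ • p := fun p q w => by
    simp [dyad]
  rw [hconst, smul_smul, ← hsqrt, ← smul_add]
  simp only [add_apply, sub_apply,
    smul_apply, one_apply_eq_self, hdyad, smul_smul]
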